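/- **Setting.** Let $x^\mu$, $1\le\mu\le n$, be coordinates on $\mathbb R^n$ and let $\Psi^A$ be fields with Grassmann parities $|A|$ and ghost numbers $\mathrm{gh}(A)$. Local functions depend on $x$ and on finitely many jet coordinates $\Psi^A_{(\mu)}$; they are smooth in the even and polynomial in the odd ones. $\partial_\mu$ is the total derivative. Let $s$ be the odd vector field of ghost number $1$ with $s x^\mu=0$, $s\Psi^A=S^A[x,\Psi]$, $[s,\partial_\mu]=0$, and assume $s^2=0$. The parent theory has the fields $\Psi^A_{(\lambda)[\nu]}(x)$, where $(\lambda)$ is a symmetric and $[\nu]$ a skew-symmetric multi-index, of parity $|A|+|\nu|$ and ghost number $\mathrm{gh}(A)-|\nu|$ (with $|\nu|$ the number of $\nu$ indices), and $\Psi^A_{()[]}\equiv\Psi^A$. They are the components of $\Psi^A(x,y,\theta)=\sum_{k,l}\frac1{k!\,l!}\Psi^A_{\lambda_1\dots\lambda_k|\nu_1\dots\nu_l}\theta^{\nu_l}\cdots\theta^{\nu_1}y^{\lambda_k}\cdots y^{\lambda_1}$, with $y$ even and $\theta$ odd. An operator $\mathcal O$ acting from the right on functions of $x,y,\theta$ induces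 a vector field $\mathcal O^F$ by $\mathcal O^F\Psi^A(x,y,\theta)=(-1)^{|\mathcal O||A|}\Psi^A(x,y,\theta)\mathcal O$. Let $d^F,\sigma^F,\rho^F$ be induced by $\Psi d=\Psi\overleftarrow{\partial}_{x^\mu}\theta^\mu$, $\Psi\sigma=\Psi\overleftarrow{\partial}_{y^\mu}\theta^\mu$, $\Psi\rho=\Psi\overleftarrow{\partial}_{\theta^\mu}y^\mu$. Let $\bar s$ be the vector field with $\bar sx^\mu=0$, with $\bar s\Psi^A=\bar S^A$, which is $S^A$ with the $x$-derivatives of the fields replaced by $y$-derivatives, and with $[\bar s,\partial_\mu]=[\bar s,\tfrac{\partial^F}{\partial\theta^\nu}]=[\bar s,\tfrac{\partial}{\partial x^\lambda}+\tfrac{\partial^F}{\partial y^\lambda}]=0$ (graded commutators). Put $s^P=d^F-\sigma^F+\bar s$. **Definitions.** Let the fields split, after an invertible local change of fields possibly involving derivatives, into $\varphi,w,v$. The $w,v$ are *algebraically trivial pairs* for a differential $D$ if $v=Dw$ and $D\varphi$ depends on the $\varphi$ only. They are *generalized auxiliary fields* for $D$ if the equations $(Dw)|_{w=0}=0$, with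 their total derivatives, are equivalent to $v=V[\varphi]$ for local functions $V$ of the $\varphi$. The reduced differential is then $s_R\varphi=(D\varphi)|_{w=0,\,v=V[\varphi]}$. For the parent theory, equivalence is understood order by order in the fields carrying $\nu$ indices. Let $\mathcal E$ be the ideal generated by $w$, $Dw$ and their total derivatives, $\mathcal K$ the ideal generated by $w$, $v-V[\varphi]$ and their total derivatives, and $\mathcal J$ the ideal generated by all $\Psi^A_{(\mu)(\lambda)[\nu]}$ with $|\nu|\ge1$. Then equivalence means $\mathcal E\subseteq\mathcal K$, $\mathcal J\subseteq\mathcal K$, and $\mathcal K\subseteq\mathcal E+\mathcal J^k$ for every $k\ge0$. **Proposition.** 1. $\bar s$ exists and is unique, and $s^P$ is odd, has ghost number $1$ and satisfies $(s^P)^2=0$. 2. If every $S^A$ is a sum of terms with at most $T$ derivatives of the fields in total, then for the degree $-\mathcal N_{\partial_y}+T\cdot(\text{target-space ghost number})$, where $\mathcal N_{\partial_y}$ counts the $\lambda$ indices and the target-space ghost number of $\Psi^A_{(\mu)(\lambda)[\nu]}$ is $\mathrm{gh}(A)$, $-\sigma^F$ has degree $-1$, $d^F$ has degree $0$ and $\bar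 s$ has only components of degree $\ge0$. 3. There is a basis $\{w^a\}$, of definite parities, of the image of $\rho^F$ on the real span of the fields $\Psi^A_{(\lambda)[\nu]}$. For every such basis, with $v^a=\sigma^Fw^a$: - the $\Psi^A,w^a,v^a$ form a system of independent fields, and the $w^a,\,-\sigma^Fw^a$ are algebraically trivial pairs for $-\sigma^F$, with remaining fields $\varphi=\Psi^A$; - the $w^a,v^a$ are generalized auxiliary fields for $s^P$, with remaining fields $\varphi=\Psi^A$, and the surface $w=0,\ v=V[\Psi]$ is $$\Psi^A_{\lambda_1\dots\lambda_k|[]}=\partial_{\lambda_1}\cdots\partial_{\lambda_k}\Psi^A,\qquad \Psi^A_{(\lambda)|\nu_1\dots\nu_l}=0\quad(l\ge1).$$ 4. Restriction to this surface commutes with the total derivatives and is the identity on local functions of the $\Psi^A$ and their $x$-derivatives. It carries $s^P$ to $s$; in particular the reduced differential is the original one: $s_R\Psi^A=(s^P\Psi^A)|_{w=0,\,v=V[\Psi]}=S^A=s\Psi^A$. -/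

import Mathlib

open scoped ContDiff TensorProduct Pointwise

/-! ## Smooth superfunctions of (possibly infinitely many) even and odd coordinates -/

/-- A function of the real coordinates `z e`, `e : E`, is a smooth cylinder function if it is a
smooth function of finitely many of them. -/
def IsSmoothCyl {E : Type*} (f : (E → ℝ) → ℝ) : Prop :=
  ∃ (S : Finset E) (g : (S → ℝ) → ℝ), ContDiff ℝ ∞ g ∧ ∀ z, f z = g (fun i => z i)

theorem IsSmoothCyl.enlarge {E : Type*} {f : (E → ℝ) → ℝ} {S : Finset E} {g : (S → ℝ) → ℝ}
    (hg : ContDiff ℝ ∞ g) (h : ∀ z, f z = g (fun i => z i)) (S' : Finset E) (hS : S ⊆ S') :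
    ∃ g' : (S' → ℝ) → ℝ, ContDiff ℝ ∞ g' ∧ ∀ z, f z = g' (fun i => z i) := by
  refine ⟨fun y => g (fun i => y ⟨i, hS i.2⟩), ?_, fun z => h z⟩
  exact hg.comp (contDiff_pi.2 fun i => contDiff_apply ℝ ℝ _)

theorem IsSmoothCyl.binop {E : Type*} {f₁ f₂ : (E → ℝ) → ℝ} (h₁ : IsSmoothCyl f₁)
    (h₂ : IsSmoothCyl f₂) (op : ℝ → ℝ → ℝ) (hop : ContDiff ℝ ∞ (fun q : ℝ × ℝ => op q.1 q.2)) :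
    IsSmoothCyl (fun z => op (f₁ z) (f₂ z)) := by
  classical
  obtain ⟨S₁, g₁, hg₁, e₁⟩ := h₁
  obtain ⟨S₂, g₂, hg₂, e₂⟩ := h₂
  obtain ⟨k₁, hk₁, e₁'⟩ := IsSmoothCyl.enlarge hg₁ e₁ (S₁ ∪ S₂) Finset.subset_union_left
  obtain ⟨k₂, hk₂, e₂'⟩ := IsSmoothCyl.enlarge hg₂ e₂ (S₁ ∪ S₂) Finset.subset_union_right
  refine ⟨S₁ ∪ S₂, fun y => op (k₁ y) (k₂ y), hop.comp (hk₁.prodMk hk₂), fun z => ?_⟩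
  simp only [e₁' z, e₂' z]

/-- The algebra of smooth cylinder functions on `E → ℝ`. -/
def SmoothCyl (E : Type*) : Subalgebra ℝ ((E → ℝ) → ℝ) where
  carrier := {f | IsSmoothCyl f}
  mul_mem' h₁ h₂ := h₁.binop h₂ (fun a b => a * b) (contDiff_fst.mul contDiff_snd)
  add_mem' h₁ h₂ := h₁.binop h₂ (fun a b => a + b) (contDiff_fst.add contDiff_snd)
  algebraMap_mem' r := ⟨∅, fun _ => r, contDiff_const, fun _ => rfl⟩

/-- A coordinate, as a smooth cylinder function. -/
def SmoothCyl.proj {E : Type*} (e : E) : SmoothCyl E :=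
  ⟨fun z => z e, {e}, fun y => y ⟨e, Finset.mem_singleton_self e⟩, contDiff_apply ℝ ℝ _,
    fun _ => rfl⟩

open scoped Classical in
/-- The partial derivative of a function on `E → ℝ` along the coordinate `e`. -/
noncomputable def cylDeriv {E : Type*} (e : E) (f : (E → ℝ) → ℝ) : (E → ℝ) → ℝ :=
  fun z => deriv (fun t => f (Function.update z e t)) (z e)

theorem cylDeriv_eq_of_notMem {E : Type*} (e : E) {f : (E → ℝ) → ℝ} {S : Finset E}
    {g : (S → ℝ) → ℝ} (h : ∀ z, f z = g (fun i => z i)) (he : e ∉ S) : cylDeriv e f = 0 := by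
  classical
  funext z
  change deriv (fun t => f (Function.update z e t)) (z e) = 0
  have : (fun t => f (Function.update z e t)) = fun _ => f z := by
    funext t
    rw [h, h]
    congr 1
    funext i
    have : (i : E) ≠ e := fun hi => he (hi ▸ i.2)
    simp [Function.update_of_ne this]
  rw [this, deriv_const]

open scoped Classical in
theorem hasDerivAt_cyl {E : Type*} (e : E) {f : (E → ℝ) → ℝ} {S : Finset E}
    {g : (S → ℝ) → ℝ} (hg : ContDiff ℝ ∞ g) (h : ∀ z, f z = g (fun i => z i)) (he : e ∈ S)
    (z : E → ℝ) :
    HasDerivAt (fun t => f (Function.update z e t))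
      (fderiv ℝ g (fun i => z i) (Pi.single (⟨e, he⟩ : S) 1)) (z e) := by
  have h1 : (fun t => f (Function.update z e t))
      = fun t => g (Function.update (fun i : S => z i) ⟨e, he⟩ t) := by
    funext t
    rw [h]
    congr 1
    funext i
    by_cases hi : i = ⟨e, he⟩
    · subst hi; simp
    · have : (i : E) ≠ e := fun hh => hi (Subtype.ext hh)
      rw [Function.update_of_ne hi, Function.update_of_ne this]
  have h2 : HasFDerivAt g (fderiv ℝ g (fun i => z i))
      (Function.update (fun i : S => z i) ⟨e, he⟩ (z e)) := by
    have : Function.update (fun i : S => z i) ⟨e, he⟩ (z e) = fun i : S => z i :=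
      Function.update_eq_self (⟨e, he⟩ : S) (fun i : S => z i)
    rw [this]
    exact ((hg.differentiable (by simp)) _).hasFDerivAt
  have h3 := h2.comp_hasDerivAt (z e)
    (hasDerivAt_update (fun i : S => z i) (⟨e, he⟩ : S) (z e))
  rw [h1]
  exact h3

open scoped Classical in
theorem cylDeriv_mem {E : Type*} (e : E) {f : (E → ℝ) → ℝ} (hf : IsSmoothCyl f) :
    IsSmoothCyl (cylDeriv e f) := by
  obtain ⟨S, g, hg, h⟩ := hf
  by_cases he : e ∈ S
  · exact ⟨S, fun y => fderiv ℝ g y (Pi.single ⟨e, he⟩ 1),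
      (hg.fderiv_right (m := ∞) (by simp)).clm_apply contDiff_const,
      fun z => (hasDerivAt_cyl e hg h he z).deriv⟩
  · rw [cylDeriv_eq_of_notMem e h he]
    exact (SmoothCyl E).zero_mem

open scoped Classical in
theorem cyl_differentiableAt {E : Type*} (e : E) {f : (E → ℝ) → ℝ} (hf : IsSmoothCyl f)
    (z : E → ℝ) :
      DifferentiableAt ℝ (fun t => f (Function.update z e t)) (z e) := by
  obtain ⟨S, g, hg, h⟩ := hf
  obtain ⟨g', hg', h'⟩ := IsSmoothCyl.enlarge hg h (insert e S) (Finset.subset_insert e S)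
  exact (hasDerivAt_cyl e hg' h' (Finset.mem_insert_self e S) z).differentiableAt

/-- The partial derivative along `e` as a linear operator on smooth cylinder functions. -/
noncomputable def SmoothCyl.pderiv {E : Type*} (e : E) : SmoothCyl E →ₗ[ℝ] SmoothCyl E where
  toFun f := ⟨cylDeriv e f.1, cylDeriv_mem e f.2⟩
  map_add' f g := by
    classical
    apply Subtype.ext
    funext z
    exact deriv_fun_add (cyl_differentiableAt e f.2 z) (cyl_differentiableAt e g.2 z)
  map_smul' c f := by
    classical
    apply Subtype.ext
    funext z
    exact deriv_const_mul c (cyl_differentiableAt e f.2 z)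

/-- Superfunctions of coordinates `v : V` with parities `p v`: polynomials in the (anticommuting)
odd coordinates whose coefficients are smooth functions of finitely many even coordinates. -/
abbrev SuperFun {V : Type*} (p : V → ZMod 2) : Type _ :=
  SmoothCyl {v // p v = 0} ⊗[ℝ] ExteriorAlgebra ℝ ({v // p v ≠ 0} →₀ ℝ)

namespace SuperFun

variable {V V' : Type*} (p : V → ZMod 2) (p' : V' → ZMod 2)

/-- The coordinate `v` as a superfunction. -/
noncomputable def coord (v : V) : SuperFun p :=
  if h : p v = 0 then SmoothCyl.proj ⟨v, h⟩ ⊗ₜ 1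
  else 1 ⊗ₜ ExteriorAlgebra.ι ℝ (Finsupp.single ⟨v, h⟩ 1)

/-- The left partial derivative along the coordinate `v`. -/
noncomputable def pderiv (v : V) : SuperFun p →ₗ[ℝ] SuperFun p :=
  if h : p v = 0 then LinearMap.rTensor _ (SmoothCyl.pderiv ⟨v, h⟩)
  else LinearMap.lTensor _ (CliffordAlgebra.contractLeft (Q := 0)
    (Finsupp.lapply (R := ℝ) (⟨v, h⟩ : {v // p v ≠ 0})))

/-- The vector field `∑ Q^v ∂/∂v`. Any superfunction has only finitely many nonzero partial
derivatives (`finite_pderiv` below), so the sum is always finite. -/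
noncomputable def vf (Q : V → SuperFun p) (F : SuperFun p) : SuperFun p :=
  ∑ᶠ v, Q v * pderiv p v F

theorem finite_contractLeft {M : Type*} (b : ExteriorAlgebra ℝ (M →₀ ℝ)) :
    {v : M | CliffordAlgebra.contractLeft (Q := 0) (Finsupp.lapply (R := ℝ) v) b ≠ 0}.Finite := by
  refine CliffordAlgebra.left_induction (Q := (0 : QuadraticForm ℝ (M →₀ ℝ)))
    (P := fun b => {v : M | CliffordAlgebra.contractLeft (Q := 0)
      (Finsupp.lapply (R := ℝ) v) b ≠ 0}.Finite) ?_ ?_ ?_ b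
  · intro r
    simp
  · intro x y hx hy
    refine (hx.union hy).subset fun v hv => ?_
    by_contra hcon
    simp only [Set.mem_union, Set.mem_ofPred_eq, not_or, not_not] at hcon
    exact hv (by rw [map_add, hcon.1, hcon.2, add_zero])
  · intro x m hx
    refine (hx.union m.support.finite_toSet).subset fun v hv => ?_
    by_contra hcon
    simp only [Set.mem_union, Set.mem_ofPred_eq, not_or, not_not, Finset.mem_coe,
      Finsupp.mem_support_iff] at hcon
    refine hv ?_
    rw [CliffordAlgebra.contractLeft_ι_mul, hcon.1]
    simp [hcon.2]

theorem finite_pderiv (F : SuperFun p) : {v | pderiv p v F ≠ 0}.Finite := by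
  induction F using TensorProduct.induction_on with
  | zero => simp
  | add x y hx hy =>
    refine (hx.union hy).subset fun v hv => ?_
    by_contra hcon
    simp only [Set.mem_union, Set.mem_ofPred_eq, not_or, not_not] at hcon
    exact hv (by rw [map_add, hcon.1, hcon.2, add_zero])
  | tmul f b =>
    obtain ⟨S, g, hg, h⟩ := f.2
    have h2 := finite_contractLeft b
    refine ((S.finite_toSet.image Subtype.val).union (h2.image Subtype.val)).subset fun v hv => ?_
    by_cases hp : p v = 0
    · left
      refine ⟨⟨v, hp⟩, ?_, rfl⟩
      by_contra hcon
      apply hv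
      have : SmoothCyl.pderiv ⟨v, hp⟩ f = 0 :=
        Subtype.ext (cylDeriv_eq_of_notMem _ h hcon)
      simp [pderiv, hp, this]
    · right
      refine ⟨⟨v, hp⟩, ?_, rfl⟩
      intro hcon
      apply hv
      simp only [pderiv, hp, dite_false, LinearMap.lTensor_tmul]
      rw [hcon, TensorProduct.tmul_zero]

/-- The values of the even coordinates `v : V` under the linear substitution `L`. -/
noncomputable def evenSubst (L : V → V' →₀ ℝ) (z : {v // p' v = 0} → ℝ) (v : {v // p v = 0}) : ℝ :=
  ((L v).subtypeDomain (fun u => p' u = 0)).sum fun u c => c * z u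

/-- Linear substitution of even coordinates in smooth functions. -/
noncomputable def bodySubst (L : V → V' →₀ ℝ) :
    SmoothCyl {v // p v = 0} →ₐ[ℝ] SmoothCyl {v // p' v = 0} :=
  have hev : ∀ f : SmoothCyl {v // p v = 0}, IsSmoothCyl fun z => f.1 (evenSubst p p' L z) := fun f => by
    classical
    obtain ⟨f, S, g, hg, h⟩ := f
    let S' : Finset {v // p' v = 0} :=
      S.biUnion fun v => ((L v).subtypeDomain (fun u => p' u = 0)).support
    have hS' : ∀ v ∈ S, ((L v).subtypeDomain (fun u => p' u = 0)).support ⊆ S' := fun v hv =>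
      Finset.subset_biUnion_of_mem
        (fun v : {v // p v = 0} => ((L v).subtypeDomain (fun u => p' u = 0)).support) hv
    refine ⟨S', fun y => g fun v => ∑ u : S',
      ((L v).subtypeDomain (fun u => p' u = 0)) u * y u, ?_, fun z => ?_⟩
    · exact hg.comp (contDiff_pi.2 fun v => ContDiff.sum fun u _ =>
        contDiff_const.mul (contDiff_apply ℝ ℝ u))
    · refine (h _).trans ?_
      congr 1
      funext v
      rw [evenSubst, Finsupp.sum_of_support_subset _ (hS' v v.2) _ (by simp)]
      exact (Finset.sum_coe_sort S' fun u =>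
        ((L v).subtypeDomain (fun u => p' u = 0)) u * z u).symm
  { toFun := fun f => ⟨fun z => f.1 (evenSubst p p' L z), hev f⟩
    map_one' := rfl
    map_mul' := fun _ _ => rfl
    map_zero' := rfl
    map_add' := fun _ _ => rfl
    commutes' := fun _ => rfl }

/-- The linear substitution `v ↦ ∑ u, L v u • u` of the coordinates. It is used only for
parity-preserving `L` (terms of the wrong parity would be dropped). -/
noncomputable def subst (L : V → V' →₀ ℝ) : SuperFun p →ₐ[ℝ] SuperFun p' :=
  Algebra.TensorProduct.map (bodySubst p p' L)
    (ExteriorAlgebra.map (Finsupp.linearCombination ℝ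
      fun v : {v // p v ≠ 0} => (L v).subtypeDomain (fun u => p' u ≠ 0)))

/-- The sign `(-1)^a`. -/
noncomputable def sgn (a : ZMod 2) : ℝ := if a = 0 then 1 else -1

/-- `F` has Grassmann parity `a`: changing the sign of all odd coordinates multiplies `F`
by `(-1)^a`. -/
def HasParity (a : ZMod 2) (F : SuperFun p) : Prop :=
  Algebra.TensorProduct.map (AlgHom.id ℝ _) (CliffordAlgebra.involute (Q := 0)) F = sgn a • F

end SuperFun

/-! ## Local functions, total derivatives, evolutionary vector fields -/

namespace LocalTheory

open SuperFun

variable {n : ℕ} {F F' : Type*} (par : F → ZMod 2) (par' : F' → ZMod 2)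

/-- Jet space coordinates for fields `f : F` on an `n`-dimensional base: `Sum.inl μ` is `x^μ` and
`Sum.inr (f, m)` is the derivative of the field `f` with symmetric multi-index `m`
(`m μ` derivatives with respect to `x^μ`). -/
abbrev Jet (n : ℕ) (F : Type*) : Type _ := Fin n ⊕ F × (Fin n → ℕ)

/-- Parities of jet coordinates. -/
def jetPar (n : ℕ) : Jet n F → ZMod 2 := Sum.elim (fun _ => 0) (fun q => par q.1)

/-- The algebra of local functions of `x` and of the fields `f : F` of parity `par f`. -/
abbrev LocalFun (n : ℕ) (par : F → ZMod 2) : Type _ := SuperFun (jetPar par n)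

/-- The coordinate `x^μ`. -/
noncomputable def xc (μ : Fin n) : LocalFun n par := coord _ (Sum.inl μ)

/-- The jet coordinate `f_{(m)}`. -/
noncomputable def jc (f : F) (m : Fin n → ℕ) : LocalFun n par := coord _ (Sum.inr (f, m))

/-- The constant coefficient linear combination `∑ u_f f` of undifferentiated fields. -/
noncomputable def lin (n : ℕ) (u : F →₀ ℝ) : LocalFun n par := u.sum fun f c => c • jc par f 0

/-- The total derivative `∂_μ = ∂/∂x^μ + ∂^F/∂x^μ`. -/
noncomputable def tot (μ : Fin n) (G : LocalFun n par) : LocalFun n par :=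
  vf _ (Sum.elim (fun κ => if κ = μ then 1 else 0)
    (fun q => jc par q.1 (q.2 + Pi.single μ 1))) G

/-- The iterated total derivative with multi-index `m`. -/
noncomputable def totIter (m : Fin n → ℕ) (G : LocalFun n par) : LocalFun n par :=
  (List.finRange n).foldr (fun μ H => (tot par μ)^[m μ] H) G

/-- The evolutionary vector field with characteristic `Q`: it maps `x^μ` to `0`, `f` to `Q f` and
is prolonged to the derivatives so as to commute with the total derivatives. -/
noncomputable def evol (Q : F → LocalFun n par) (G : LocalFun n par) : LocalFun n par :=
  vf _ (Sum.elim (fun _ => 0) (fun q => totIter par q.2 (Q q.1))) G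

/-- The diagonal (Euler) vector field that gives weight `c f m` to `f_{(m)}` and `0` to `x^μ`. -/
noncomputable def euler (c : F → (Fin n → ℕ) → ℤ) (G : LocalFun n par) : LocalFun n par :=
  vf _ (Sum.elim (fun _ => 0) (fun q => (c q.1 q.2 : ℝ) • jc par q.1 q.2)) G

/-- The length `|m|` of a multi-index. -/
def len (m : Fin n → ℕ) : ℕ := ∑ μ, m μ

/-- Linear substitution of field jets that fixes the `x^μ`. -/
noncomputable def fieldSubst (L : F → (Fin n → ℕ) → (F' × (Fin n → ℕ) →₀ ℝ)) :
    LocalFun n par →ₐ[ℝ] LocalFun n par' :=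
  subst _ _ (Sum.elim (fun μ => Finsupp.single (Sum.inl μ) 1)
    (fun q => (L q.1 q.2).mapDomain Sum.inr))

/-- Renaming of fields (derivatives included) along `i : F → F'`. -/
noncomputable def rename (i : F → F') : LocalFun n par →ₐ[ℝ] LocalFun n par' :=
  fieldSubst par par' fun f m => Finsupp.single (i f, m) 1

/-- `Φ` exhibits the local functions `u f'`, `f' : F'`, as new independent fields of
parity `par'`: it is an isomorphism from the local functions in the new fields to the local
functions in the old ones, it fixes `x`, commutes with total derivatives and sends the new field
`f'` to `u f'`. This is an invertible local change of fields, possibly involving derivatives. -/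
def IsFieldChange (u : F' → LocalFun n par) (Φ : LocalFun n par' ≃ₐ[ℝ] LocalFun n par) : Prop :=
  (∀ f, HasParity _ (par' f) (u f)) ∧ (∀ μ, Φ (xc par' μ) = xc par μ) ∧
  (∀ μ G, Φ (tot par' μ G) = tot par μ (Φ G)) ∧ ∀ f, Φ (jc par' f 0) = u f

variable {A B : Type*} (parA : A → ZMod 2) (parB : B → ZMod 2)

/-- Parities of a split set of fields `φ`, `w`, `v`, with `w` and `v` of opposite parity. -/
def splitPar : A ⊕ B ⊕ B → ZMod 2 := Sum.elim parA (Sum.elim parB fun b => parB b + 1)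

/-- The `w b` and `D (w b)` are algebraically trivial pairs for `D`, with remaining fields `φ`:
`(φ, w, D w)` is a system of fields obtained by an invertible local change, and `D φ` is a local
function of the `φ` alone. -/
def IsAlgTrivialPairs (D : LocalFun n par → LocalFun n par) (φ : A → LocalFun n par)
    (w : B → LocalFun n par) : Prop :=
  ∃ Φ : LocalFun n (splitPar parA parB) ≃ₐ[ℝ] LocalFun n par,
    IsFieldChange par (splitPar parA parB) (Sum.elim φ (Sum.elim w fun b => D (w b))) Φ ∧
    ∀ a, ∃ G : LocalFun n parA, D (φ a) = Φ (rename parA (splitPar parA parB) Sum.inl G)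

/-- The differential ideal generated by a family of local functions: the ideal generated by all
their total derivatives. (Left ideals; all families below have definite parities, so that left
and two-sided ideals agree.) -/
noncomputable def diffIdeal {C : Type*} (u : C → LocalFun n par) : Ideal (LocalFun n par) :=
  Ideal.span {G | ∃ c m, G = totIter par m (u c)}

/-- The ideal of the equations `w = 0`, `D w = 0`, that is of `(D w)|_{w = 0} = 0` on `w = 0`. -/
noncomputable def eqIdeal (D : LocalFun n par → LocalFun n par) (w : B → LocalFun n par) :
    Ideal (LocalFun n par) :=
  diffIdeal par w ⊔ diffIdeal par fun b => D (w b)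

/-- The ideal of the surface `w = 0`, `v = U`. -/
noncomputable def surfIdeal (w v U : B → LocalFun n par) : Ideal (LocalFun n par) :=
  diffIdeal par w ⊔ diffIdeal par fun b => v b - U b

/-- The fields `w`, `v` are generalized auxiliary fields for `D`, with remaining fields `φ`:
`(φ, w, v)` is a system of fields obtained by an invertible local change, the `U b` are local
functions of the `φ` alone, and the equations `(D w)|_{w = 0} = 0` are equivalent to `v = U`.
The equivalence is understood order by order in the coordinates `z ∈ Z`, which vanish on the
surface: the surface solves the equations, and conversely the equations imply those of the
surface up to terms of arbitrarily high order in the `z ∈ Z`. -/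
def IsGenAux (D : LocalFun n par → LocalFun n par) (Z : Set (LocalFun n par))
    (φ : A → LocalFun n par) (w v U : B → LocalFun n par) : Prop :=
  (∃ Φ : LocalFun n (splitPar parA parB) ≃ₐ[ℝ] LocalFun n par,
    IsFieldChange par (splitPar parA parB) (Sum.elim φ (Sum.elim w v)) Φ ∧
    ∀ b, ∃ G : LocalFun n parA, U b = Φ (rename parA (splitPar parA parB) Sum.inl G)) ∧
  eqIdeal par D w ≤ surfIdeal par w v U ∧
  Z ⊆ surfIdeal par w v U ∧
  ∀ k : ℕ, surfIdeal par w v U ≤ eqIdeal par D w ⊔ Ideal.span (Z ^ k)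

end LocalTheory

/-! ## The parent theory -/

namespace Parent

open SuperFun LocalTheory

variable {n : ℕ} {I : Type*} (par : I → ZMod 2) (gh : I → ℤ)

/-- The fields `Ψ^A_{(l)[N]}` of the parent theory: `l` is the symmetric multi-index of
`y`-derivatives and `N = {ν₁ < ⋯ < ν_p}` the skew-symmetric one of `θ`-derivatives. -/
abbrev PField (n : ℕ) (I : Type*) : Type _ := I × (Fin n → ℕ) × Finset (Fin n)

/-- Parity of `Ψ^A_{(l)[N]}`. -/
def ppar (n : ℕ) : PField n I → ZMod 2 := fun f => par f.1 + (f.2.2.card : ZMod 2)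

/-- Ghost number of `Ψ^A_{(l)[N]}`. -/
def pgh (n : ℕ) : PField n I → ℤ := fun f => gh f.1 - f.2.2.card

/-- Local functions of the parent theory. -/
abbrev PFun (n : ℕ) (par : I → ZMod 2) : Type _ := LocalFun n (ppar par n)

/-- The sign of sorting `i` into the increasing sequence `N`. -/
noncomputable def eps (i : Fin n) (N : Finset (Fin n)) : ℝ := (-1) ^ (N.filter (· < i)).card

/-- `σ^F` on fields: moves a skew index to the `y`-derivative indices. -/
noncomputable def sigmaRow (f : PField n I) : PField n I →₀ ℝ :=
  ∑ i ∈ f.2.2, Finsupp.single (f.1, f.2.1 + Pi.single i 1, f.2.2.erase i)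
    (sgn (par f.1) * eps i f.2.2)

/-- `ρ^F` on fields, for `ρ = (∂/∂θ^μ) y^μ`. -/
noncomputable def rhoRow (f : PField n I) : PField n I →₀ ℝ :=
  ∑ i ∈ f.2.2ᶜ, Finsupp.single (f.1, f.2.1 - Pi.single i 1, insert i f.2.2)
    (sgn (par f.1) * (f.2.1 i : ℝ) * eps i f.2.2)

/-- `∂^F/∂θ^ν` on fields. -/
noncomputable def thetaRow (ν : Fin n) (f : PField n I) : PField n I →₀ ℝ :=
  if ν ∈ f.2.2 then 0
  else Finsupp.single (f.1, f.2.1, insert ν f.2.2) (sgn (par f.1) * eps ν f.2.2)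

/-- The vector field `σ^F`. -/
noncomputable def sigmaF (G : PFun n par) : PFun n par :=
  evol (ppar par n) (fun f => lin (ppar par n) n (sigmaRow par f)) G

/-- The vector field `d^F`: moves a skew index to the `x`-derivative indices. -/
noncomputable def dF (G : PFun n par) : PFun n par :=
  evol (ppar par n) (fun f => ∑ i ∈ f.2.2, (sgn (par f.1) * eps i f.2.2) •
    jc (ppar par n) (f.1, f.2.1, f.2.2.erase i) (Pi.single i 1)) G

/-- The vector field `∂^F/∂θ^ν`. -/
noncomputable def thetaF (ν : Fin n) (G : PFun n par) : PFun n par :=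
  evol (ppar par n) (fun f => lin (ppar par n) n (thetaRow par ν f)) G

/-- The vector field `∂^F/∂y^κ`. -/
noncomputable def yF (κ : Fin n) (G : PFun n par) : PFun n par :=
  evol (ppar par n) (fun f => jc (ppar par n) (f.1, f.2.1 + Pi.single κ 1, f.2.2) 0) G

/-- The operator `∂/∂x^κ + ∂^F/∂y^κ`. -/
noncomputable def yTot (κ : Fin n) (G : PFun n par) : PFun n par :=
  SuperFun.pderiv _ (Sum.inl κ) G + yF par κ G

/-- Replacement of the `x`-derivatives of the original fields by `y`-derivatives. -/
noncomputable def toY (n : ℕ) : LocalFun n par →ₐ[ℝ] PFun n par :=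
  fieldSubst par (ppar par n) fun a m => Finsupp.single ((a, m, ∅), 0) 1

/-- The original fields as fields of the parent theory, `Ψ^A ↦ Ψ^A_{()[]}`. -/
noncomputable def incl (n : ℕ) : LocalFun n par →ₐ[ℝ] PFun n par :=
  rename par (ppar par n) fun a => (a, 0, ∅)

/-- Restriction to the surface `Ψ^A_{(l)[]} = ∂_{(l)} Ψ^A`, `Ψ^A_{(l)[N]} = 0` for `N ≠ ∅`. -/
noncomputable def restrict (n : ℕ) : PFun n par →ₐ[ℝ] LocalFun n par :=
  fieldSubst (ppar par n) par fun f m =>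
    if f.2.2 = ∅ then Finsupp.single (f.1, f.2.1 + m) 1 else 0

/-- The components `Q` are those of the vector field `s̄` belonging to `s Ψ^A = S^A`: it
annihilates `x`, `s̄ Ψ^A` is `S^A` with `x`-derivatives replaced by `y`-derivatives, and `s̄`
(anti)commutes with `∂_μ`, `∂^F/∂θ^ν` and `∂/∂x^κ + ∂^F/∂y^κ`. -/
structure IsSBar (S : I → LocalFun n par) (Q : Jet n (PField n I) → PFun n par) : Prop where
  x_zero : ∀ μ, Q (Sum.inl μ) = 0
  base : ∀ a, Q (Sum.inr ((a, 0, ∅), 0)) = toY par n (S a)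
  comm_tot : ∀ μ G, vf _ Q (tot (ppar par n) μ G) = tot (ppar par n) μ (vf _ Q G)
  comm_theta : ∀ ν G, vf _ Q (thetaF par ν G) = -thetaF par ν (vf _ Q G)
  comm_y : ∀ κ G, vf _ Q (yTot par κ G) = yTot par κ (vf _ Q G)

/-- The parent differential `s^P = d^F - σ^F + s̄`. -/
noncomputable def sP (Q : Jet n (PField n I) → PFun n par) (G : PFun n par) : PFun n par :=
  dF par G - sigmaF par G + vf _ Q G

/-- The degree operator `-N_{∂y} + T · (target space ghost number)`. -/
noncomputable def degOp (T : ℕ) (G : PFun n par) : PFun n par :=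
  euler (ppar par n) (fun f _ => -(len f.2.1 : ℤ) + T * gh f.1) G

/-- Sums of functions of degrees at least `g`. -/
noncomputable def degGE (T : ℕ) (g : ℤ) : Submodule ℝ (PFun n par) :=
  Submodule.span ℝ {G | ∃ j : ℤ, g ≤ j ∧ degOp par gh T G = (j : ℝ) • G}

/-- `s Ψ^A = S^A` contains at most `T` derivatives in total: every `S^A` is a sum of components
of degree at most `T` with respect to the operator counting the `x`-derivatives on fields. -/
def DerivBound (S : I → LocalFun n par) (T : ℕ) : Prop :=
  ∀ a, S a ∈ Submodule.span ℝ
    {G : LocalFun n par | ∃ j : ℕ, j ≤ T ∧ euler par (fun _ m => (len m : ℤ)) G = (j : ℝ) • G}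

/-- `W` is a basis of the image of `ρ^F` on the space of fields, made of elements `w` of definite
parity `pw w`. -/
def IsRhoBasis (W : Set (PField n I →₀ ℝ)) (pw : W → ZMod 2) : Prop :=
  LinearIndependent ℝ (Subtype.val : W → PField n I →₀ ℝ) ∧
  Submodule.span ℝ W = LinearMap.range (Finsupp.linearCombination ℝ (rhoRow (n := n) par)) ∧
  ∀ (w : W), ∀ f ∈ w.1.support, ppar par n f = pw w

/-- The coordinates that carry at least one skew index (all `x`-derivatives of such fields). -/
def thetaCoords (n : ℕ) : Set (PFun n par) :=
  {G | ∃ (f : PField n I) (m : Fin n → ℕ), f.2.2.Nonempty ∧ G = jc (ppar par n) f m}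

end Parent

/-!
A vector field on a superspace is determined by its values on the coordinates, and the graded
commutator of two vector fields is again one (`SF.IsVF.comm`: the second order parts cancel by
supercommutativity). Hence every identity between `d^F`, `σ^F`, `s̄`, `∂^F/∂θ^ν`, `∂_μ` and
`Y_κ = ∂/∂x^κ + ∂^F/∂y^κ` can be checked on coordinates, and for vector fields that commute with the
`∂_μ` on undifferentiated fields. The same holds for the statement that a linear substitution
intertwines two vector fields (`SF.IsVF.intertwine`).

*The differential.* The field `Ψ^A_{(l)[N]}` is obtained, up to a sign, from `Ψ^A` by applying
powers of the `Y_κ` and then a product of the `∂^F/∂θ^ν`. The (anti)commutation relations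
therefore leave no choice for `s̄` (`Parent.apply_jt_eq`), and applying the same operators to `S^A`,
with `x`-derivatives replaced by `y`-derivatives, defines it (`Parent.sbChar`). The operator
`d^F - σ^F` squares to zero, commutes with the `Y_κ`, and its anticommutator with `∂^F/∂θ^ν` is
`∂_ν - Y_ν`, which commutes with `s̄`. So `s̄²` and the anticommutator of `d^F - σ^F` with `s̄` both
commute with `∂_μ`, `∂^F/∂θ^ν` and `Y_κ`, the second one by the Jacobi identity. As they
vanish on the original fields, they vanish (`Parent.spE_mul_self`).

*The degree.* The components of `s̄` arise from those of `s` by operators of known weight. A term of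
`S^A` with `j ≤ T` derivatives becomes one of degree `T (gh A + 1) - j ≥ T gh A`; that `S^A` has
ghost number `gh A + 1` passes to its components with a fixed number of derivatives, because
the two counting operators commute (`mem_span_common_eigen`).

*The fields.* On the span of the fields `σ^F ρ^F + ρ^F σ^F` multiplies `Ψ^A_{(l)[N]}` by `|l| + |N|`
(`Parent.homotopy_fld`), as for the Koszul complex. Hence `σ^F` is injective on the image of
`ρ^F`, and the `Ψ^A` together with bases `w` of this image and `σ^F w` of its image under `σ^F`
form a basis of the span (`Parent.bijective_newRow`), which is an invertible change of fields
(`LF.exists_fieldChange`).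

*The equations of motion.* Let `E` be the ideal of `w = 0`, `s^P w = 0` and let `Z` be the set of
coordinates with skew indices. On the image of `ρ^F` the equation `s^P w = 0` expresses `σ^F w`
through `d^F w` and `s̄ w`. With the homotopy formula, a field with skew indices is then, modulo `E`, a
combination of derivatives of fields with as many skew and fewer symmetric indices, of fields
with more skew indices, and of products of two elements of `Z`. Induction shows that `Z` lies in
`E + (Z²)` (`Parent.jt_mem_eqI_sup`), hence in `E + (Z^k)` for all `k`. As `E` is stable
under `s^P`, the equation of the field `Ψ^A_{(l)[κ]}` gives `Ψ^A_{(l+κ)[]} = ∂_κ Ψ^A_{(l)[]}` up to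
the same error, and so all equations of the surface follow (`Parent.zIdeal_le_eqI_sup`). Conversely
`d^F - σ^F` vanishes on the surface, `s̄` of a field with skew indices lies in the ideal of `Z`, and
`s̄ Ψ^A_{(l)[]}` restricts to `∂_{(l)} S^A` (`Parent.resL_spE`).
-/

/-! ### Smooth functions of finitely many coordinates -/

theorem SmoothCyl.pderiv_mul {E : Type*} (e : E) (f g : SmoothCyl E) :
    SmoothCyl.pderiv e (f * g) = SmoothCyl.pderiv e f * g + f * SmoothCyl.pderiv e g := by
  classical
  apply Subtype.ext
  funext z
  have h := deriv_fun_mul (cyl_differentiableAt e f.2 z) (cyl_differentiableAt e g.2 z)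
  simp only [Function.update_eq_self] at h
  exact h

open scoped Classical in
theorem SmoothCyl.pderiv_proj {E : Type*} (e e' : E) :
    SmoothCyl.pderiv e (SmoothCyl.proj e') = if e = e' then 1 else 0 := by
  apply Subtype.ext
  funext z
  change deriv (fun t => Function.update z e t e') (z e) = _
  split_ifs with h
  · subst h
    simp [deriv_id'']
  · simp [Function.update_of_ne (Ne.symm h)]

theorem SmoothCyl.pderiv_comm {E : Type*} (e e' : E) (f : SmoothCyl E) :
    SmoothCyl.pderiv e (SmoothCyl.pderiv e' f) = SmoothCyl.pderiv e' (SmoothCyl.pderiv e f) := by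
  classical
  obtain ⟨f, S₀, g₀, hg₀, h₀⟩ := f
  obtain ⟨g, hg, h⟩ := IsSmoothCyl.enlarge hg₀ h₀ (insert e (insert e' S₀))
    ((Finset.subset_insert _ _).trans (Finset.subset_insert _ _))
  generalize hS : insert e (insert e' S₀) = S at *
  have he : e ∈ S := by simp [← hS]
  have he' : e' ∈ S := by simp [← hS]
  apply Subtype.ext
  change cylDeriv e (cylDeriv e' f) = cylDeriv e' (cylDeriv e f)
  -- both sides are second directional derivatives of `g`
  have key : ∀ (a b : E) (ha : a ∈ S) (hb : b ∈ S) (z : E → ℝ), cylDeriv a (cylDeriv b f) z =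
      fderiv ℝ (fderiv ℝ g) (fun i => z i) (Pi.single (⟨a, ha⟩ : S) 1)
        (Pi.single (⟨b, hb⟩ : S) 1) := fun a b ha hb z => by
    have hc : ContDiff ℝ ∞ (fun y => fderiv ℝ g y (Pi.single (⟨b, hb⟩ : S) 1)) :=
      (hg.fderiv_right (m := ∞) (by simp)).clm_apply contDiff_const
    have h1 : ∀ z, cylDeriv b f z = fderiv ℝ g (fun i => z i) (Pi.single (⟨b, hb⟩ : S) 1) :=
      fun z => (hasDerivAt_cyl b hg h hb z).deriv
    refine (hasDerivAt_cyl a hc h1 ha z).deriv.trans ?_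
    have hd : DifferentiableAt ℝ (fderiv ℝ g) (fun i => z i) :=
      ((hg.fderiv_right (m := ∞) (by simp)).differentiable (by simp)) _
    rw [fderiv_clm_apply hd (by fun_prop)]
    simp
  funext z
  rw [key e e' he he', key e' e he' he]
  have hsymm : IsSymmSndFDerivAt ℝ g (fun i => z i) :=
    (hg.contDiffAt).isSymmSndFDerivAt (by simp; exact WithTop.coe_le_coe.2 le_top)
  exact hsymm.eq _ _

/-! ### Derivations of the exterior algebra -/

namespace ExteriorAlgebra

variable {M : Type*} [AddCommGroup M] [Module ℝ M]

/-- Contractions are antiderivations. -/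
theorem contractLeft_mul (d : Module.Dual ℝ M) (b c : ExteriorAlgebra ℝ M) :
    CliffordAlgebra.contractLeft (Q := 0) d (b * c) =
      CliffordAlgebra.contractLeft (Q := 0) d b * c +
        CliffordAlgebra.involute (Q := 0) b * CliffordAlgebra.contractLeft (Q := 0) d c := by
  induction b using CliffordAlgebra.left_induction with
  | algebraMap r => simp [CliffordAlgebra.contractLeft_algebraMap_mul]
  | add x y hx hy => simp only [add_mul, map_add, hx, hy]; abel
  | ι_mul x m hx =>
    rw [mul_assoc, CliffordAlgebra.contractLeft_ι_mul, CliffordAlgebra.contractLeft_ι_mul, hx]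
    simp only [map_mul, CliffordAlgebra.involute_ι, mul_add, sub_mul, smul_mul_assoc, mul_assoc,
      neg_mul]
    abel

theorem involute_contractLeft (d : Module.Dual ℝ M) (b : ExteriorAlgebra ℝ M) :
    CliffordAlgebra.involute (Q := 0) (CliffordAlgebra.contractLeft (Q := 0) d b) =
      -CliffordAlgebra.contractLeft (Q := 0) d (CliffordAlgebra.involute (Q := 0) b) := by
  induction b using CliffordAlgebra.left_induction with
  | algebraMap r => simp
  | add x y hx hy => simp only [map_add, hx, hy]; abel
  | ι_mul x m hx =>
    simp only [CliffordAlgebra.contractLeft_ι_mul, map_sub, map_smul, map_mul, hx,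
      CliffordAlgebra.involute_ι, neg_mul, map_neg, mul_neg]
    abel

/-- A generator supercommutes with every element. -/
theorem ι_mul_eq (m : M) (b : ExteriorAlgebra ℝ M) :
    ι ℝ m * b = CliffordAlgebra.involute (Q := 0) b * ι ℝ m := by
  induction b using CliffordAlgebra.left_induction with
  | algebraMap r => simp [Algebra.commutes]
  | add x y hx hy => simp only [map_add, mul_add, add_mul, hx, hy]
  | ι_mul x m' hx =>
    have h : ι ℝ m * ι ℝ m' = -(ι ℝ m' * ι ℝ m) :=
      eq_neg_of_add_eq_zero_left (ι_add_mul_swap m m')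
    change ι ℝ m * (ι ℝ m' * x) = CliffordAlgebra.involute (Q := 0) (ι ℝ m' * x) * ι ℝ m
    rw [← mul_assoc, h, neg_mul, mul_assoc, hx, map_mul]
    change _ = CliffordAlgebra.involute (CliffordAlgebra.ι 0 m') * _ * _
    rw [CliffordAlgebra.involute_ι, neg_mul, neg_mul, mul_assoc]

/-- Supercommutativity of the exterior algebra: `b` is split into its even and odd parts
`(b ± involute b) / 2`. -/
theorem two_smul_mul (b c : ExteriorAlgebra ℝ M) :
    (2 : ℝ) • (b * c) = c * (b + CliffordAlgebra.involute (Q := 0) b) +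
      CliffordAlgebra.involute (Q := 0) c * (b - CliffordAlgebra.involute (Q := 0) b) := by
  induction b using CliffordAlgebra.left_induction with
  | algebraMap r =>
    simp only [AlgHom.commutes, sub_self, mul_zero, add_zero, ← two_smul ℝ, mul_smul_comm,
      Algebra.commutes r c]
  | add x y hx hy =>
    simp only [add_mul, smul_add, map_add, hx, hy, mul_add, mul_sub]
    abel
  | ι_mul x m hx =>
    change (2 : ℝ) • (ι ℝ m * x * c) =
      c * (ι ℝ m * x + CliffordAlgebra.involute (Q := 0) (ι ℝ m * x)) +
        CliffordAlgebra.involute (Q := 0) c *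
          (ι ℝ m * x - CliffordAlgebra.involute (Q := 0) (ι ℝ m * x))
    have h1 : CliffordAlgebra.involute (Q := 0) (ι ℝ m * x) =
        -(ι ℝ m * CliffordAlgebra.involute (Q := 0) x) := by
      rw [map_mul]
      change CliffordAlgebra.involute (CliffordAlgebra.ι 0 m) * _ = _
      rw [CliffordAlgebra.involute_ι, neg_mul]
    rw [h1, mul_assoc, ← mul_smul_comm, hx, mul_add, ← mul_assoc, ← mul_assoc, ι_mul_eq m c,
      ι_mul_eq m (CliffordAlgebra.involute (Q := 0) c), CliffordAlgebra.involute_involute]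
    simp only [mul_add, mul_sub, mul_neg, mul_assoc]
    abel

end ExteriorAlgebra

/-! ### Parity and partial derivatives -/

namespace SuperFun

variable {V V' V'' : Type*} (p : V → ZMod 2) (p' : V' → ZMod 2) (p'' : V'' → ZMod 2)

/-- The ring of superfunctions, as a shortcut for instance search. -/
noncomputable abbrev superRing : Ring (SuperFun p) := inferInstance

/-- The algebra of superfunctions, as a shortcut for instance search. -/
noncomputable abbrev superAlgebra : Algebra ℝ (SuperFun p) := inferInstance

/-- The additive group underlying `superRing`. -/
noncomputable abbrev superAddCommGroup : AddCommGroup (SuperFun p) :=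
  (superRing p).toAddCommGroup

/-- The module underlying `superAlgebra`. -/
noncomputable abbrev superModule : Module ℝ (SuperFun p) := (superAlgebra p).toModule

attribute [local instance] superRing superAlgebra superAddCommGroup superModule

/-- The parity automorphism: it changes the sign of all odd coordinates. -/
noncomputable def inv : SuperFun p →ₐ[ℝ] SuperFun p :=
  Algebra.TensorProduct.map (AlgHom.id ℝ _) (CliffordAlgebra.involute (Q := 0))

/-- The automorphism `F ↦ (-1)^{a |F|} F`. -/
noncomputable def tw (a : ZMod 2) : SuperFun p →ₐ[ℝ] SuperFun p :=
  if a = 0 then AlgHom.id ℝ _ else inv p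

variable {p p' p''}

theorem inv_tmul (f : SmoothCyl {v // p v = 0}) (b : ExteriorAlgebra ℝ ({v // p v ≠ 0} →₀ ℝ)) :
    inv p (f ⊗ₜ b) = f ⊗ₜ CliffordAlgebra.involute (Q := 0) b := rfl

theorem inv_inv (F : SuperFun p) : inv p (inv p F) = F := by
  induction F using TensorProduct.induction_on with
  | zero => simp
  | add x y hx hy => rw [map_add, map_add, hx, hy]
  | tmul f b => rw [inv_tmul, inv_tmul, CliffordAlgebra.involute_involute]

@[simp] theorem tw_zero (F : SuperFun p) : tw p 0 F = F := by simp [tw]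

@[simp] theorem tw_one (F : SuperFun p) : tw p 1 F = inv p F := by simp [tw]

theorem zmod_two_cases (a : ZMod 2) : a = 0 ∨ a = 1 := by
  revert a; decide

theorem tw_tw (a b : ZMod 2) (F : SuperFun p) : tw p a (tw p b F) = tw p (a + b) F := by
  rcases zmod_two_cases a with rfl | rfl <;> rcases zmod_two_cases b with rfl | rfl <;>
    simp [inv_inv, show (1 : ZMod 2) + 1 = 0 from rfl]

@[simp] theorem sgn_zero : sgn 0 = 1 := by simp [sgn]

@[simp] theorem sgn_one : sgn 1 = -1 := by simp [sgn]

theorem sgn_add (a b : ZMod 2) : sgn (a + b) = sgn a * sgn b := by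
  rcases zmod_two_cases a with rfl | rfl <;> rcases zmod_two_cases b with rfl | rfl <;>
    simp [show (1 : ZMod 2) + 1 = 0 from rfl]

@[simp] theorem sgn_mul_self (a : ZMod 2) : sgn a * sgn a = 1 := by
  rcases zmod_two_cases a with rfl | rfl <;> simp

theorem hasParity_iff {a : ZMod 2} {F : SuperFun p} : HasParity p a F ↔ inv p F = sgn a • F :=
  Iff.rfl

theorem HasParity.tw_eq {a : ZMod 2} {F : SuperFun p} (h : HasParity p a F) (b : ZMod 2) :
    tw p b F = sgn (a * b) • F := by
  rcases zmod_two_cases b with rfl | rfl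
  · simp
  · simpa using hasParity_iff.1 h

theorem HasParity.add {a : ZMod 2} {F G : SuperFun p} (hF : HasParity p a F)
    (hG : HasParity p a G) : HasParity p a (F + G) := by
  rw [hasParity_iff] at *
  rw [map_add, hF, hG, smul_add]

theorem HasParity.smul {a : ZMod 2} {F : SuperFun p} (hF : HasParity p a F) (c : ℝ) :
    HasParity p a (c • F) := by
  rw [hasParity_iff] at *
  rw [map_smul, hF, smul_comm]

theorem HasParity.neg {a : ZMod 2} {F : SuperFun p} (hF : HasParity p a F) :
    HasParity p a (-F) := by
  rw [← neg_one_smul ℝ]; exact hF.smul _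

theorem HasParity.sub {a : ZMod 2} {F G : SuperFun p} (hF : HasParity p a F)
    (hG : HasParity p a G) : HasParity p a (F - G) := by
  rw [sub_eq_add_neg]; exact hF.add hG.neg

theorem HasParity.zero {a : ZMod 2} : HasParity p a (0 : SuperFun p) := by
  rw [hasParity_iff, map_zero, smul_zero]

theorem HasParity.one : HasParity p 0 (1 : SuperFun p) := by
  rw [hasParity_iff, map_one, sgn_zero, one_smul]

/-- Supercommutativity, with the first factor split into its even and odd parts. -/
theorem two_smul_mul (F G : SuperFun p) :
    (2 : ℝ) • (F * G) = G * (F + inv p F) + inv p G * (F - inv p F) := by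
  induction F using TensorProduct.induction_on with
  | zero => simp
  | add x y hx hy =>
    simp only [add_mul, smul_add, hx, hy, map_add, mul_add, mul_sub]
    abel
  | tmul f b =>
    induction G using TensorProduct.induction_on with
    | zero => simp
    | add x y hx hy =>
      simp only [mul_add, smul_add, hx, hy, map_add, add_mul]
      abel
    | tmul g c =>
      simp only [inv_tmul, ← TensorProduct.tmul_add, ← TensorProduct.tmul_sub,
        Algebra.TensorProduct.tmul_mul_tmul, ← TensorProduct.tmul_smul]
      rw [ExteriorAlgebra.two_smul_mul, mul_comm f g]

theorem HasParity.supercomm {a : ZMod 2} {F : SuperFun p} (h : HasParity p a F)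
    (G : SuperFun p) : F * G = tw p a G * F := by
  have h2 := two_smul_mul F G
  rw [hasParity_iff] at h
  rw [h] at h2
  have : (2 : ℝ) • (F * G) = (2 : ℝ) • (tw p a G * F) := by
    rw [h2]
    rcases zmod_two_cases a with rfl | rfl
    · rw [sgn_zero, one_smul, tw_zero, sub_self, mul_zero, add_zero, mul_add, two_smul]
    · rw [sgn_one, neg_one_smul, tw_one, add_neg_cancel, mul_zero, zero_add, sub_neg_eq_add,
        mul_add, two_smul]
  exact smul_right_injective _ (two_ne_zero (α := ℝ)) this

theorem hasParity_coord (v : V) : HasParity p (p v) (coord p v) := by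
  rw [hasParity_iff, coord]
  split_ifs with h
  · rw [inv_tmul, map_one, h, sgn_zero, one_smul]
  · have h1 : p v = 1 := (zmod_two_cases _).resolve_left h
    rw [inv_tmul]
    erw [CliffordAlgebra.involute_ι]
    rw [h1, sgn_one, neg_smul, one_smul, TensorProduct.tmul_neg]

theorem pderiv_mul (v : V) (F G : SuperFun p) :
    pderiv p v (F * G) = pderiv p v F * G + tw p (p v) F * pderiv p v G := by
  induction F using TensorProduct.induction_on with
  | zero => simp
  | add x y hx hy =>
    simp only [add_mul, map_add, hx, hy]
    abel
  | tmul f b =>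
    induction G using TensorProduct.induction_on with
    | zero => simp
    | add x y hx hy =>
      simp only [mul_add, hx, hy, map_add]
      abel
    | tmul g c =>
      by_cases h : p v = 0
      · simp [pderiv, h, SmoothCyl.pderiv_mul, TensorProduct.add_tmul]
      · have h1 : p v = 1 := (zmod_two_cases _).resolve_left h
        simp only [pderiv, h, dite_false, Algebra.TensorProduct.tmul_mul_tmul,
          LinearMap.lTensor_tmul, ExteriorAlgebra.contractLeft_mul, TensorProduct.tmul_add]
        have h2 : tw p (p v) = inv p := by simp [tw, h]
        rw [h2, inv_tmul, Algebra.TensorProduct.tmul_mul_tmul]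

theorem pderiv_comm (u v : V) (F : SuperFun p) :
    pderiv p u (pderiv p v F) = sgn (p u * p v) • pderiv p v (pderiv p u F) := by
  induction F using TensorProduct.induction_on with
  | zero => simp
  | add x y hx hy => simp only [map_add, hx, hy, smul_add]
  | tmul f b =>
    by_cases hu : p u = 0 <;> by_cases hv : p v = 0
    · have hs : sgn (p u * p v) = 1 := by simp [hu]
      rw [hs, one_smul]
      simp only [pderiv, hu, hv, dite_true, LinearMap.rTensor_tmul]
      rw [SmoothCyl.pderiv_comm]
    · simp [pderiv, hu, hv]
    · simp [pderiv, hu, hv]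
    · have hu1 : p u = 1 := (zmod_two_cases _).resolve_left hu
      have hv1 : p v = 1 := (zmod_two_cases _).resolve_left hv
      simp only [pderiv, hu, hv, dite_false, LinearMap.lTensor_tmul]
      have hs : sgn (p u * p v) = -1 := by simp [hu1, hv1]
      rw [CliffordAlgebra.contractLeft_comm, hs, neg_smul, one_smul, TensorProduct.tmul_neg]

theorem inv_pderiv (v : V) (F : SuperFun p) :
    inv p (pderiv p v F) = sgn (p v) • pderiv p v (inv p F) := by
  induction F using TensorProduct.induction_on with
  | zero => simp
  | add x y hx hy => simp only [map_add, hx, hy, smul_add]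
  | tmul f b =>
    by_cases hv : p v = 0
    · simp [pderiv, hv, inv_tmul]
    · have hv1 : p v = 1 := (zmod_two_cases _).resolve_left hv
      simp only [pderiv, hv, dite_false, LinearMap.lTensor_tmul, inv_tmul]
      have hs : sgn (p v) = -1 := by simp [hv1]
      rw [hs, ExteriorAlgebra.involute_contractLeft, neg_smul, one_smul, TensorProduct.tmul_neg]

open scoped Classical in
theorem pderiv_coord (u v : V) : pderiv p u (coord p v) = if v = u then 1 else 0 := by
  by_cases hu : p u = 0 <;> by_cases hv : p v = 0
  · simp only [pderiv, coord, hu, hv, dite_true, LinearMap.rTensor_tmul, SmoothCyl.pderiv_proj,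
      Subtype.mk.injEq, eq_comm (a := u)]
    split_ifs
    · rfl
    · rw [TensorProduct.zero_tmul]
  · have : v ≠ u := fun h => hv (h ▸ hu)
    have h1 : SmoothCyl.pderiv (⟨u, hu⟩ : {v // p v = 0}) 1 = 0 :=
      Subtype.ext (cylDeriv_eq_of_notMem (S := ∅) (g := fun _ => 1) _ (fun _ => rfl) (by simp))
    simp [pderiv, coord, hu, hv, this, h1]
  · have : v ≠ u := fun h => hu (h ▸ hv)
    simp [pderiv, coord, hu, hv, this]
  · simp only [pderiv, coord, hu, hv, dite_false, LinearMap.lTensor_tmul]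
    erw [CliffordAlgebra.contractLeft_ι]
    simp only [Finsupp.lapply_apply, Finsupp.single_apply, Subtype.mk.injEq]
    split_ifs
    · rw [map_one]; rfl
    · rw [map_zero, TensorProduct.tmul_zero]

theorem exists_support (F : SuperFun p) : ∃ S : Finset V, ∀ v, pderiv p v F ≠ 0 → v ∈ S :=
  ⟨(finite_pderiv p F).toFinset, fun _ hv => (finite_pderiv p F).mem_toFinset.2 hv⟩

theorem vf_eq_sum (Q : V → SuperFun p) (F : SuperFun p) {S : Finset V}
    (hS : ∀ v, pderiv p v F ≠ 0 → v ∈ S) : vf p Q F = ∑ v ∈ S, Q v * pderiv p v F := by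
  refine finsum_eq_sum_of_support_subset _ fun v hv => hS v fun h => hv ?_
  change Q v * pderiv p v F = 0
  rw [h, mul_zero]

end SuperFun

namespace SuperFun

variable {V V' V'' : Type*} {p : V → ZMod 2} {p' : V' → ZMod 2} {p'' : V'' → ZMod 2}

attribute [local instance] superRing superAlgebra superAddCommGroup superModule

/-! ### Linear substitutions -/

/-- The linear substitution `L` replaces coordinates by combinations of coordinates of the same
parity. -/
def PreservesParity (p : V → ZMod 2) (p' : V' → ZMod 2) (L : V → V' →₀ ℝ) : Prop :=
  ∀ v, ∀ u ∈ (L v).support, p' u = p v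

theorem subst_tmul (L : V → V' →₀ ℝ) (f : SmoothCyl {v // p v = 0})
    (b : ExteriorAlgebra ℝ ({v // p v ≠ 0} →₀ ℝ)) :
    subst p p' L (f ⊗ₜ b) = bodySubst p p' L f ⊗ₜ
      (ExteriorAlgebra.map (Finsupp.linearCombination ℝ
      fun v : {v // p v ≠ 0} => (L v).subtypeDomain (fun u => p' u ≠ 0))) b := rfl

theorem bodySubst_proj (L : V → V' →₀ ℝ) (v : {v // p v = 0}) :
    bodySubst p p' L (SmoothCyl.proj v) =
      ((L v).subtypeDomain (fun u => p' u = 0)).sum fun u c => c • SmoothCyl.proj u := by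
  apply Subtype.ext
  funext z
  change evenSubst p p' L z v = _
  rw [evenSubst, Finsupp.sum, Finsupp.sum, AddSubmonoidClass.coe_finsetSum, Finset.sum_apply]
  rfl

theorem subst_coord {L : V → V' →₀ ℝ} (hL : PreservesParity p p' L) (v : V) :
    subst p p' L (coord p v) = (L v).sum fun u c => c • coord p' u := by
  by_cases hv : p v = 0
  · have h1 : ∀ u ∈ (L v).support, p' u = 0 := fun u hu => (hL v u hu).trans hv
    rw [coord, dif_pos hv, subst_tmul, bodySubst_proj, map_one, Finsupp.sum, TensorProduct.sum_tmul]
    rw [← Finsupp.sum_subtypeDomain_index h1 (h := fun u c => c • coord p' u)]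
    refine Finset.sum_congr rfl fun u _ => ?_
    dsimp only
    rw [coord, dif_pos u.2]
    rfl
  · have h1 : ∀ u ∈ (L v).support, p' u ≠ 0 := fun u hu => by rw [hL v u hu]; exact hv
    rw [coord, dif_neg hv, subst_tmul, map_one, ExteriorAlgebra.map_apply_ι,
      Finsupp.linearCombination_single, one_smul]
    rw [← Finsupp.sum_subtypeDomain_index h1 (h := fun u c => c • coord p' u)]
    conv_lhs => rw [← Finsupp.sum_single (Finsupp.subtypeDomain _ (L v))]
    rw [Finsupp.sum, map_sum, TensorProduct.tmul_sum]
    refine Finset.sum_congr rfl fun u _ => ?_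
    dsimp only
    rw [coord, dif_neg u.2, ← TensorProduct.tmul_smul, ← map_smul, Finsupp.smul_single, smul_eq_mul,
      mul_one]

theorem inv_subst (L : V → V' →₀ ℝ) (F : SuperFun p) :
    inv p' (subst p p' L F) = subst p p' L (inv p F) := by
  induction F using TensorProduct.induction_on with
  | zero => simp only [map_zero]
  | add x y hx hy => simp only [map_add, hx, hy]
  | tmul f b =>
    rw [inv_tmul, subst_tmul, subst_tmul, inv_tmul]
    congr 1
    generalize (Finsupp.linearCombination ℝ
      fun v : {v // p v ≠ 0} => (L v).subtypeDomain (fun u => p' u ≠ 0)) = φ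
    induction b using CliffordAlgebra.left_induction with
    | algebraMap r => simp
    | add x y hx hy => simp only [map_add, hx, hy]
    | ι_mul x m hx =>
      have h : ∀ m, ExteriorAlgebra.map φ (CliffordAlgebra.ι 0 m) = CliffordAlgebra.ι 0 (φ m) :=
        fun m => ExteriorAlgebra.map_apply_ι φ m
      rw [map_mul, map_mul, map_mul, map_mul, hx, h, CliffordAlgebra.involute_ι,
        CliffordAlgebra.involute_ι, map_neg, h]

theorem HasParity.subst {a : ZMod 2} {F : SuperFun p} (h : HasParity p a F) (L : V → V' →₀ ℝ) :
    HasParity p' a (subst p p' L F) := by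
  rw [hasParity_iff] at *
  rw [inv_subst, h, map_smul]

/-- The chain rule for linear substitutions, in the smooth tensor factor. The sum may run over any
finite set that contains the coordinates on which `f` depends. -/
theorem exists_pderiv_bodySubst (L : V → V' →₀ ℝ) (f : SmoothCyl {v // p v = 0}) :
    ∃ S₀ : Finset {v // p v = 0}, ∀ S, S₀ ⊆ S → ∀ u : {u // p' u = 0},
      SmoothCyl.pderiv u (bodySubst p p' L f) =
        ∑ v ∈ S, L v u • bodySubst p p' L (SmoothCyl.pderiv v f) := by
  classical
  -- the decidability instances of `cylDeriv`
  let _ : DecidableEq {u : V' // p' u = 0} := fun a b => Classical.propDecidable (a = b)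
  let _ : DecidableEq {v : V // p v = 0} := fun a b => Classical.propDecidable (a = b)
  obtain ⟨f, S₀, g₀, hg₀, h₀⟩ := f
  refine ⟨S₀, fun S hS u => ?_⟩
  obtain ⟨g, hg, h⟩ := IsSmoothCyl.enlarge hg₀ h₀ S hS
  apply Subtype.ext
  funext z
  change deriv (fun t => f (evenSubst p p' L (Function.update z u t))) (z u) = _
  -- along the coordinate `u`, the substituted coordinates move on a straight line
  have h1 : ∀ t v, evenSubst p p' L (Function.update z u t) v =
      evenSubst p p' L z v + (t - z u) * L v u := fun t v => by
    simp only [evenSubst, Finsupp.sum]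
    by_cases hu : u ∈ ((L v).subtypeDomain (fun u => p' u = 0)).support
    · rw [← Finset.add_sum_erase _ _ hu, ← Finset.add_sum_erase _ _ hu, Function.update_self,
        Finset.sum_congr rfl fun w hw => by
          rw [Function.update_of_ne (Finset.ne_of_mem_erase hw)]]
      simp only [Finsupp.subtypeDomain_apply]
      ring
    · have h2 : L v u = 0 := by
        simpa using hu
      rw [h2, mul_zero, add_zero]
      refine Finset.sum_congr rfl fun w hw => ?_
      rw [Function.update_of_ne]
      rintro rfl
      exact hu hw
  have hline : HasDerivAt (fun (t : ℝ) (v : S) => evenSubst p p' L z v + (t - z u) * L v u)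
      (fun v : S => L v u) (z u) := by
    rw [hasDerivAt_pi]
    intro v
    simpa using (((hasDerivAt_id (z u)).sub_const (z u)).mul_const (L v u)).const_add
      (evenSubst p p' L z v)
  have hfd : HasFDerivAt g (fderiv ℝ g fun v : S => evenSubst p p' L z v)
      (fun v : S => evenSubst p p' L z v + (z u - z u) * L v u) := by
    simp only [sub_self, zero_mul, add_zero]
    exact ((hg.differentiable (by simp)) _).hasFDerivAt
  have hder := (hfd.comp_hasDerivAt (z u) hline).deriv
  have hfun : (fun t => f (evenSubst p p' L (Function.update z u t))) =
      g ∘ fun (t : ℝ) (v : S) => evenSubst p p' L z v + (t - z u) * L v u := by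
    funext t
    rw [h, Function.comp_apply]
    simp only [h1]
  rw [hfun, hder, AddSubmonoidClass.coe_finsetSum, Finset.sum_apply]
  have hexp : (fun v : S => L v u) = ∑ v : S, L v u • (Pi.single v 1 : S → ℝ) := by
    funext w
    simp [Finset.sum_apply, Pi.single_apply]
  rw [hexp, map_sum, ← Finset.sum_coe_sort S]
  refine Finset.sum_congr rfl fun v _ => ?_
  rw [map_smul]
  change _ = L v u • cylDeriv (v : {v // p v = 0}) f (evenSubst p p' L z)
  exact congrArg _ (hasDerivAt_cyl _ hg h v.2 _).deriv.symm

/-- The chain rule for linear substitutions, in the exterior tensor factor. -/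
theorem exists_contractLeft_map {M M' : Type*} (φ : M → M' →₀ ℝ)
    (b : ExteriorAlgebra ℝ (M →₀ ℝ)) :
    ∃ S₀ : Finset M, ∀ S, S₀ ⊆ S → ∀ u : M',
      CliffordAlgebra.contractLeft (Q := 0) (Finsupp.lapply (R := ℝ) u)
        (ExteriorAlgebra.map (Finsupp.linearCombination ℝ φ) b) =
      ∑ v ∈ S, φ v u • ExteriorAlgebra.map (Finsupp.linearCombination ℝ φ)
        (CliffordAlgebra.contractLeft (Q := 0) (Finsupp.lapply (R := ℝ) v) b) := by
  classical
  induction b using CliffordAlgebra.left_induction with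
  | algebraMap r => exact ⟨∅, fun S _ u => by simp⟩
  | add x y hx hy =>
    obtain ⟨S, hS⟩ := hx
    obtain ⟨T, hT⟩ := hy
    refine ⟨S ∪ T, fun U hU u => ?_⟩
    rw [map_add, map_add, hS U (Finset.union_subset_left hU), hT U (Finset.union_subset_right hU),
      ← Finset.sum_add_distrib]
    exact Finset.sum_congr rfl fun v _ => by rw [map_add, map_add, smul_add]
  | ι_mul x m hx =>
    obtain ⟨S, hS⟩ := hx
    refine ⟨S ∪ m.support, fun U hU u => ?_⟩
    have h : ∀ m, ExteriorAlgebra.map (Finsupp.linearCombination ℝ φ) (CliffordAlgebra.ι 0 m) =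
        CliffordAlgebra.ι 0 (Finsupp.linearCombination ℝ φ m) :=
      fun m => ExteriorAlgebra.map_apply_ι _ m
    rw [map_mul, h, CliffordAlgebra.contractLeft_ι_mul, hS U (Finset.union_subset_left hU)]
    simp only [CliffordAlgebra.contractLeft_ι_mul, map_sub, map_smul, map_mul, h, smul_sub,
      Finset.sum_sub_distrib, Finsupp.lapply_apply, smul_smul, ← Finset.sum_smul, Finset.mul_sum,
      mul_smul_comm]
    congr 2
    rw [Finsupp.linearCombination_apply, Finsupp.sum_apply,
      Finsupp.sum_of_support_subset _ (Finset.union_subset_right hU) _ (by simp)]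
    exact Finset.sum_congr rfl fun v _ => by rw [Finsupp.smul_apply, smul_eq_mul, mul_comm]

/-- The chain rule for linear substitutions. -/
theorem pderiv_subst {L : V → V' →₀ ℝ} (hL : PreservesParity p p' L) (F : SuperFun p)
    {S : Finset V} (hS : ∀ v, pderiv p v F ≠ 0 → v ∈ S) (u : V') :
    pderiv p' u (subst p p' L F) = ∑ v ∈ S, L v u • subst p p' L (pderiv p v F) := by
  classical
  suffices H : ∃ S₀ : Finset V, ∀ S, S₀ ⊆ S → ∀ u,
      pderiv p' u (subst p p' L F) = ∑ v ∈ S, L v u • subst p p' L (pderiv p v F) by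
    obtain ⟨S₀, h₀⟩ := H
    rw [h₀ (S₀ ∪ S) Finset.subset_union_left]
    refine (Finset.sum_subset Finset.subset_union_right fun v _ hv => ?_).symm
    rw [not_not.1 (mt (hS v) hv), map_zero, smul_zero]
  clear hS S u
  induction F using TensorProduct.induction_on with
  | zero => exact ⟨∅, fun S _ u => by simp only [map_zero, smul_zero, Finset.sum_const_zero]⟩
  | add x y hx hy =>
    obtain ⟨S, hS⟩ := hx
    obtain ⟨T, hT⟩ := hy
    refine ⟨S ∪ T, fun U hU u => ?_⟩
    rw [map_add, map_add, hS U (Finset.union_subset_left hU), hT U (Finset.union_subset_right hU),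
      ← Finset.sum_add_distrib]
    exact Finset.sum_congr rfl fun v _ => by rw [map_add, map_add, smul_add]
  | tmul f b =>
    obtain ⟨Sf, hf⟩ := exists_pderiv_bodySubst (p' := p') L f
    obtain ⟨Sb, hb⟩ := exists_contractLeft_map
      (fun v : {v // p v ≠ 0} => (L v).subtypeDomain (fun u => p' u ≠ 0)) b
    refine ⟨Sf.map (Function.Embedding.subtype _) ∪ Sb.map (Function.Embedding.subtype _),
      fun S hS u => ?_⟩
    by_cases hu : p' u = 0
    · rw [← Finset.sum_filter_of_ne (p := fun v => p v = 0) fun v _ hv => ?_,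
        ← Finset.sum_subtype_eq_sum_filter]
      · have h1 := hf (S.subtype fun v => p v = 0) (fun v hv => by
          rw [Finset.mem_subtype]
          exact hS (Finset.mem_union_left _ (Finset.mem_map_of_mem _ hv))) ⟨u, hu⟩
        rw [subst_tmul, pderiv, dif_pos hu, LinearMap.rTensor_tmul, h1, TensorProduct.sum_tmul]
        refine Finset.sum_congr rfl fun v _ => ?_
        rw [pderiv, dif_pos v.2, LinearMap.rTensor_tmul, subst_tmul]
        rfl
      · by_contra hv'
        refine hv ?_
        have : L v u = 0 := by
          by_contra h
          exact hv' ((hL v u (Finsupp.mem_support_iff.2 h)).symm.trans hu)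
        rw [this, zero_smul]
    · rw [← Finset.sum_filter_of_ne (p := fun v => p v ≠ 0) fun v _ hv => ?_,
        ← Finset.sum_subtype_eq_sum_filter]
      · have h1 := hb (S.subtype fun v => p v ≠ 0) (fun v hv => by
          rw [Finset.mem_subtype]
          exact hS (Finset.mem_union_right _ (Finset.mem_map_of_mem _ hv))) ⟨u, hu⟩
        rw [subst_tmul, pderiv, dif_neg hu, LinearMap.lTensor_tmul, h1, TensorProduct.tmul_sum]
        refine Finset.sum_congr rfl fun v _ => ?_
        rw [pderiv, dif_neg v.2, LinearMap.lTensor_tmul, subst_tmul, TensorProduct.tmul_smul]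
        rfl
      · intro hv'
        refine hv ?_
        have : L v u = 0 := by
          by_contra h
          exact hu ((hL v u (Finsupp.mem_support_iff.2 h)).trans hv')
        rw [this, zero_smul]

/-- Restriction to even (or odd) coordinates is compatible with the composition of linear
substitutions that preserve parities. -/
theorem linearCombination_subtypeDomain {q : V' → Prop} (L' : V' → V'' →₀ ℝ) {q'' : V'' → Prop}
    (l : V' →₀ ℝ) (hl : ∀ u, ¬ q u → ∀ w, q'' w → l u * L' u w = 0) :
    Finsupp.linearCombination ℝ (fun u : {u // q u} => (L' u).subtypeDomain q'')
      (l.subtypeDomain q) = (Finsupp.linearCombination ℝ L' l).subtypeDomain q'' := by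
  classical
  ext w
  simp only [Finsupp.linearCombination_apply, Finsupp.sum, Finsupp.finsetSum_apply,
    Finsupp.smul_apply, Finsupp.subtypeDomain_apply, smul_eq_mul, Finsupp.support_subtypeDomain]
  rw [Finset.sum_subtype_eq_sum_filter (s := l.support) (p := q)
    (f := fun u => l u * L' u w)]
  refine Finset.sum_filter_of_ne fun u _ hu => ?_
  by_contra h
  exact hu (hl u h w w.2)

theorem evenSubst_eq (L : V → V' →₀ ℝ) (z : {v // p' v = 0} → ℝ) (v : {v // p v = 0}) :
    evenSubst p p' L z v = Finsupp.linearCombination ℝ z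
      ((L v).subtypeDomain (fun u => p' u = 0)) := by
  rw [evenSubst, Finsupp.linearCombination_apply]; rfl

theorem subst_subst {L : V → V' →₀ ℝ} {L' : V' → V'' →₀ ℝ} (hL' : PreservesParity p' p'' L')
    (F : SuperFun p) : subst p' p'' L' (subst p p' L F) =
      subst p p'' (fun v => Finsupp.linearCombination ℝ L' (L v)) F := by
  induction F using TensorProduct.induction_on with
  | zero => simp only [map_zero]
  | add x y hx hy => simp only [map_add, hx, hy]
  | tmul f b =>
    have hz : ∀ u w, p' u ≠ p'' w → L' u w = 0 := fun u w h => by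
      by_contra hne
      exact h (hL' u w (Finsupp.mem_support_iff.2 hne)).symm
    rw [subst_tmul, subst_tmul, subst_tmul]
    congr 1
    · apply Subtype.ext
      funext z
      change f.1 (evenSubst p p' L (evenSubst p' p'' L' z)) = f.1 (evenSubst p p'' _ z)
      refine congrArg f.1 (funext fun v => ?_)
      rw [evenSubst_eq, evenSubst_eq, ← linearCombination_subtypeDomain (q := fun u => p' u = 0)]
      · have h : evenSubst p' p'' L' z = fun u : {u // p' u = 0} => Finsupp.linearCombination ℝ z
          ((L' u).subtypeDomain (fun u => p'' u = 0)) := funext fun u => evenSubst_eq _ _ _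
        rw [h, ← Finsupp.linearCombination_linearCombination]
      · intro u hu w hw
        rw [hz u w fun h => hu (h.trans hw), mul_zero]
    · rw [← AlgHom.comp_apply, ExteriorAlgebra.map_comp_map]
      congr 2
      refine Finsupp.lhom_ext' fun v => LinearMap.ext_ring ?_
      simp only [LinearMap.comp_apply, Finsupp.lsingle_apply, Finsupp.linearCombination_single,
        one_smul]
      refine linearCombination_subtypeDomain L' (L v) fun u hu w hw => ?_
      rw [hz u w fun h => hu (h.trans_ne hw), mul_zero]

theorem subst_single (F : SuperFun p) :
    subst p p (fun v => Finsupp.single v 1) F = F := by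
  induction F using TensorProduct.induction_on with
  | zero => simp only [map_zero]
  | add x y hx hy => simp only [map_add, hx, hy]
  | tmul f b =>
    rw [subst_tmul]
    congr 1
    · apply Subtype.ext
      funext z
      change f.1 (evenSubst p p _ z) = f.1 z
      refine congrArg f.1 (funext fun v => ?_)
      rw [evenSubst_eq]
      have : (Finsupp.single (v : V) (1 : ℝ)).subtypeDomain (fun u => p u = 0) =
          Finsupp.single v 1 := by
        classical
        ext u
        simp only [Finsupp.subtypeDomain_apply, Finsupp.single_apply, Subtype.ext_iff]
      rw [this, Finsupp.linearCombination_single, one_smul]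
    · have : (Finsupp.linearCombination ℝ fun v : {v // p v ≠ 0} =>
          (Finsupp.single (v : V) (1 : ℝ)).subtypeDomain (fun u => p u ≠ 0)) = LinearMap.id := by
        refine Finsupp.lhom_ext' fun v => LinearMap.ext_ring ?_
        simp only [LinearMap.comp_apply, Finsupp.lsingle_apply, Finsupp.linearCombination_single,
          one_smul, LinearMap.id_apply]
        classical
        ext u
        simp only [Finsupp.subtypeDomain_apply, Finsupp.single_apply, Subtype.ext_iff]
      rw [this, ExteriorAlgebra.map_id, AlgHom.id_apply]

end SuperFun

/-! ### Vector fields on superspace -/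

/-- A type synonym of `SuperFun p`, whose only algebraic structures are a ring and a real algebra;
it hides the tensor product from instance search. -/
def SF {V : Type*} (p : V → ZMod 2) : Type _ := SuperFun p

namespace SF

open SuperFun

variable {V V' V'' : Type*} {p : V → ZMod 2} {p' : V' → ZMod 2} {p'' : V'' → ZMod 2}

noncomputable instance : Ring (SF p) := inferInstanceAs (Ring (SuperFun p))

noncomputable instance : Algebra ℝ (SF p) := inferInstanceAs (Algebra ℝ (SuperFun p))

noncomputable instance : AddCommGroup (SF p) := Ring.toAddCommGroup

noncomputable instance : AddCommMonoid (SF p) := AddCommGroup.toAddCommMonoid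

noncomputable instance : Module ℝ (SF p) := Algebra.toModule

variable (p) in
/-- A coordinate. -/
noncomputable def co (v : V) : SF p := coord p v

variable (p) in
/-- A left partial derivative. -/
noncomputable def D (v : V) : Module.End ℝ (SF p) where
  toFun := pderiv p v
  map_add' := map_add (pderiv p v)
  map_smul' := map_smul (pderiv p v)

variable (p) in
/-- The parity automorphism. -/
noncomputable def inv : SF p →ₐ[ℝ] SF p := SuperFun.inv p

variable (p) in
/-- The automorphism `F ↦ (-1)^{a |F|} F`. -/
noncomputable def tw (a : ZMod 2) : SF p →ₐ[ℝ] SF p := SuperFun.tw p a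

/-- `F` has Grassmann parity `a`. -/
def Par (a : ZMod 2) (F : SF p) : Prop := HasParity p a F

theorem par_iff {a : ZMod 2} {F : SF p} : Par a F ↔ inv p F = sgn a • F := Iff.rfl

@[simp] theorem tw_zero (F : SF p) : tw p 0 F = F := SuperFun.tw_zero F

theorem tw_tw (a b : ZMod 2) (F : SF p) : tw p a (tw p b F) = tw p (a + b) F :=
  SuperFun.tw_tw a b F

namespace Par

variable {a b : ZMod 2} {F G : SF p}

theorem tw_eq (h : Par a F) (b : ZMod 2) : tw p b F = sgn (a * b) • F := HasParity.tw_eq h b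

theorem add (hF : Par a F) (hG : Par a G) : Par a (F + G) := HasParity.add hF hG

theorem smul (hF : Par a F) (c : ℝ) : Par a (c • F) := HasParity.smul hF c

theorem sub (hF : Par a F) (hG : Par a G) : Par a (F - G) := HasParity.sub hF hG

theorem zero : Par a (0 : SF p) := HasParity.zero

theorem one : Par 0 (1 : SF p) := HasParity.one

theorem sum {ι : Type*} {s : Finset ι} {F : ι → SF p} (h : ∀ i ∈ s, Par a (F i)) :
    Par a (∑ i ∈ s, F i) := by
  rw [par_iff, map_sum, Finset.smul_sum]
  exact Finset.sum_congr rfl h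

theorem supercomm (h : Par a F) (G : SF p) : F * G = tw p a G * F := HasParity.supercomm h G

end Par

theorem par_co (v : V) : Par (p v) (co p v) := hasParity_coord v

theorem D_mul (v : V) (F G : SF p) : D p v (F * G) = D p v F * G + tw p (p v) F * D p v G :=
  pderiv_mul v F G

theorem D_comm (u v : V) (F : SF p) : D p u (D p v F) = sgn (p u * p v) • D p v (D p u F) :=
  pderiv_comm u v F

theorem inv_D (v : V) (F : SF p) : inv p (D p v F) = sgn (p v) • D p v (inv p F) := inv_pderiv v F

open scoped Classical in
theorem D_co (u v : V) : D p u (co p v) = if v = u then 1 else 0 := pderiv_coord u v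

theorem exists_support (F : SF p) : ∃ S : Finset V, ∀ v, D p v F ≠ 0 → v ∈ S :=
  SuperFun.exists_support F

variable (p) in
/-- The vector field `∑ Q^v ∂/∂v` as a linear operator. -/
noncomputable def vfL (Q : V → SF p) : Module.End ℝ (SF p) where
  toFun := vf p Q
  map_add' F G := by
    classical
    obtain ⟨S, hS⟩ := exists_support F
    obtain ⟨T, hT⟩ := exists_support G
    have hST : ∀ v, D p v (F + G) ≠ 0 → v ∈ S ∪ T := fun v hv => by
      by_contra h
      rw [Finset.mem_union, not_or] at h
      refine hv ?_
      rw [map_add, not_not.1 (mt (hS v) h.1), not_not.1 (mt (hT v) h.2), add_zero]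
    refine (vf_eq_sum Q _ hST).trans (Eq.trans ?_ (congrArg₂ (fun a b : SF p => a + b)
      (vf_eq_sum Q F (S := S ∪ T) fun v hv => Finset.mem_union_left _ (hS v hv))
      (vf_eq_sum Q G (S := S ∪ T) fun v hv => Finset.mem_union_right _ (hT v hv))).symm)
    change ∑ v ∈ S ∪ T, Q v * D p v (F + G) =
      ∑ v ∈ S ∪ T, Q v * D p v F + ∑ v ∈ S ∪ T, Q v * D p v G
    rw [← Finset.sum_add_distrib]
    exact Finset.sum_congr rfl fun v _ => by rw [map_add, mul_add]
  map_smul' c F := by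
    obtain ⟨S, hS⟩ := exists_support F
    have hc : ∀ v, D p v (c • F) ≠ 0 → v ∈ S := fun v hv => hS v fun h => hv
      (by rw [map_smul, h, smul_zero])
    refine (vf_eq_sum Q _ hc).trans (Eq.trans ?_ (congrArg (fun a : SF p => c • a)
      (vf_eq_sum Q F hS)).symm)
    change ∑ v ∈ S, Q v * D p v (c • F) = c • ∑ v ∈ S, Q v * D p v F
    rw [Finset.smul_sum]
    exact Finset.sum_congr rfl fun v _ => by rw [map_smul, mul_smul_comm]

theorem vfL_eq_sum (Q : V → SF p) (F : SF p) {S : Finset V}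
    (hS : ∀ v, D p v F ≠ 0 → v ∈ S) : vfL p Q F = ∑ v ∈ S, Q v * D p v F :=
  vf_eq_sum Q F hS

theorem vfL_co (Q : V → SF p) (v : V) : vfL p Q (co p v) = Q v := by
  classical
  rw [vfL_eq_sum Q _ (S := {v}) fun u hu => ?_]
  · rw [Finset.sum_singleton, D_co, if_pos rfl, mul_one]
  · rw [D_co] at hu
    rw [Finset.mem_singleton]
    by_contra h
    exact hu (if_neg (Ne.symm h))

/-- `X` is a vector field of parity `ε` on the superspace with coordinates `v : V`: it has the
form `∑ X^v ∂/∂v`, where necessarily `X^v = X v`, with components of parity `|v| + ε`. -/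
structure IsVF (ε : ZMod 2) (X : Module.End ℝ (SF p)) : Prop where
  parity : ∀ v, Par (p v + ε) (X (co p v))
  eq_vf : ∀ F, X F = vfL p (fun v => X (co p v)) F

theorem isVF_vfL {ε : ZMod 2} {Q : V → SF p} (hQ : ∀ v, Par (p v + ε) (Q v)) :
    IsVF ε (vfL p Q) where
  parity v := by rw [vfL_co]; exact hQ v
  eq_vf F := by simp only [vfL_co]

namespace IsVF

variable {ε δ : ZMod 2} {X Y : Module.End ℝ (SF p)}

theorem eq_sum (hX : IsVF ε X) (F : SF p) {S : Finset V}
    (hS : ∀ v, D p v F ≠ 0 → v ∈ S) : X F = ∑ v ∈ S, X (co p v) * D p v F := by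
  rw [hX.eq_vf, vfL_eq_sum _ _ hS]

theorem ext (hX : IsVF ε X) (hY : IsVF δ Y) (h : ∀ v, X (co p v) = Y (co p v)) : X = Y := by
  refine LinearMap.ext fun F => ?_
  rw [hX.eq_vf, hY.eq_vf]
  simp only [h]

theorem inv_apply (hX : IsVF ε X) (F : SF p) : inv p (X F) = sgn ε • X (inv p F) := by
  obtain ⟨S, hS⟩ := exists_support F
  rw [hX.eq_sum F hS, hX.eq_sum (inv p F) (S := S) fun v hv => hS v fun h => hv ?_, map_sum,
    Finset.smul_sum]
  · refine Finset.sum_congr rfl fun v _ => ?_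
    rw [map_mul, par_iff.1 (hX.parity v), inv_D, smul_mul_smul_comm, sgn_add,
      mul_right_comm, sgn_mul_self, one_mul]
  · have h2 := inv_D v F
    rw [h, map_zero] at h2
    have h3 := congrArg (fun G => sgn (p v) • G) h2
    simpa only [smul_zero, smul_smul, sgn_mul_self, one_smul] using h3.symm

theorem map_parity (hX : IsVF ε X) {a : ZMod 2} {F : SF p} (hF : Par a F) :
    Par (a + ε) (X F) := by
  rw [par_iff] at *
  rw [hX.inv_apply, hF, map_smul, smul_smul, sgn_add, mul_comm]

/-- The graded Leibniz rule. -/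
theorem leibniz (hX : IsVF ε X) (F G : SF p) :
    X (F * G) = X F * G + tw p ε F * X G := by
  classical
  obtain ⟨S, hS⟩ := exists_support F
  obtain ⟨T, hT⟩ := exists_support G
  have hST : ∀ v, D p v (F * G) ≠ 0 → v ∈ S ∪ T := fun v hv => by
    by_contra h
    rw [Finset.mem_union, not_or] at h
    refine hv ?_
    rw [D_mul, not_not.1 (mt (hS v) h.1), not_not.1 (mt (hT v) h.2), zero_mul, mul_zero,
      add_zero]
  rw [hX.eq_sum F (S := S ∪ T) fun v hv => Finset.mem_union_left _ (hS v hv),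
    hX.eq_sum G (S := S ∪ T) fun v hv => Finset.mem_union_right _ (hT v hv),
    hX.eq_sum (F * G) hST, Finset.sum_mul, Finset.mul_sum, ← Finset.sum_add_distrib]
  refine Finset.sum_congr rfl fun v _ => ?_
  have h : p v + ε + p v = ε :=
    (by decide : ∀ a b : ZMod 2, a + b + a = b) (p v) ε
  rw [D_mul, mul_add, ← mul_assoc, ← mul_assoc, (hX.parity v).supercomm (tw p (p v) F),
    tw_tw, h, mul_assoc (tw p ε F)]

theorem zero : IsVF ε (0 : Module.End ℝ (SF p)) where
  parity v := by rw [LinearMap.zero_apply]; exact Par.zero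
  eq_vf F := by
    obtain ⟨S, hS⟩ := exists_support F
    rw [vfL_eq_sum _ _ hS]
    simp only [LinearMap.zero_apply, zero_mul, Finset.sum_const_zero]

theorem add (hX : IsVF ε X) (hY : IsVF ε Y) : IsVF ε (X + Y) where
  parity v := (hX.parity v).add (hY.parity v)
  eq_vf F := by
    obtain ⟨S, hS⟩ := exists_support F
    rw [vfL_eq_sum _ _ hS, LinearMap.add_apply, hX.eq_sum F hS, hY.eq_sum F hS,
      ← Finset.sum_add_distrib]
    simp only [LinearMap.add_apply, add_mul]

theorem smul (c : ℝ) (hX : IsVF ε X) : IsVF ε (c • X) where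
  parity v := (hX.parity v).smul c
  eq_vf F := by
    obtain ⟨S, hS⟩ := exists_support F
    rw [vfL_eq_sum _ _ hS, LinearMap.smul_apply, hX.eq_sum F hS, Finset.smul_sum]
    simp only [LinearMap.smul_apply, smul_mul_assoc]

theorem neg (hX : IsVF ε X) : IsVF ε (-X) := by
  rw [← neg_one_smul ℝ X]
  exact hX.smul _

theorem sub (hX : IsVF ε X) (hY : IsVF ε Y) : IsVF ε (X - Y) := by
  rw [sub_eq_add_neg]
  exact hX.add hY.neg

/-- The graded commutator of two vector fields is a vector field: the second derivatives cancel
by supercommutativity of the components and of the partial derivatives. -/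
theorem comm (hX : IsVF ε X) (hY : IsVF δ Y) :
    IsVF (ε + δ) (X * Y - sgn (ε * δ) • (Y * X)) where
  parity v := by
    have h1 := hX.map_parity (hY.parity v)
    have h2 := (hY.map_parity (hX.parity v)).smul (sgn (ε * δ))
    rw [add_assoc] at h1 h2
    rw [add_comm δ ε] at h1
    exact h1.sub h2
  eq_vf F := by
    obtain ⟨S, hS⟩ := exists_support F
    have hd : ∀ u v, D p v (D p u F) ≠ 0 → v ∈ S := fun u v hv => hS v fun h => hv
      (by rw [D_comm, h, map_zero, smul_zero])
    -- composition of two vector fields, with its second order part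
    have key : ∀ {ε δ : ZMod 2} {X Y : Module.End ℝ (SF p)}, IsVF ε X → IsVF δ Y →
        X (Y F) = ∑ v ∈ S, X (Y (co p v)) * D p v F +
          ∑ v ∈ S, ∑ u ∈ S, sgn ((p v + δ) * ε) • (Y (co p v) * (X (co p u) *
            D p u (D p v F))) := by
      intro ε δ X Y hX hY
      rw [hY.eq_sum F hS, map_sum, ← Finset.sum_add_distrib]
      refine Finset.sum_congr rfl fun v _ => ?_
      rw [hX.leibniz, (hY.parity v).tw_eq, hX.eq_sum _ (hd v), smul_mul_assoc, Finset.mul_sum,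
        Finset.smul_sum]
    rw [vfL_eq_sum _ _ hS, LinearMap.sub_apply, LinearMap.smul_apply, Module.End.mul_apply,
      Module.End.mul_apply, key hX hY, key hY hX]
    -- the second order parts cancel
    have second : ∑ v ∈ S, ∑ u ∈ S, sgn ((p v + δ) * ε) • (Y (co p v) * (X (co p u) *
            D p u (D p v F))) = sgn (ε * δ) • ∑ v ∈ S, ∑ u ∈ S, sgn ((p v + ε) * δ) •
            (X (co p v) * (Y (co p u) * D p u (D p v F))) := by
      rw [Finset.sum_comm, Finset.smul_sum]
      refine Finset.sum_congr rfl fun u _ => ?_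
      rw [Finset.smul_sum]
      refine Finset.sum_congr rfl fun v _ => ?_
      rw [← mul_assoc, (hY.parity v).supercomm, (hX.parity u).tw_eq, D_comm u v,
        mul_smul_comm, smul_mul_assoc, smul_mul_assoc, mul_assoc, smul_smul, smul_smul,
        smul_smul, ← sgn_add, ← sgn_add, ← sgn_add]
      congr 2
      exact (by decide : ∀ a b ε δ : ZMod 2,
        (a + δ) * ε + b * a + (b + ε) * (a + δ) = ε * δ + (b + ε) * δ) (p v) (p u) ε δ
    rw [second, smul_add, add_sub_add_right_eq_sub, Finset.smul_sum, ← Finset.sum_sub_distrib]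
    refine Finset.sum_congr rfl fun v _ => ?_
    rw [LinearMap.sub_apply, LinearMap.smul_apply, Module.End.mul_apply, Module.End.mul_apply,
      sub_mul, smul_mul_assoc]

theorem comm_even (hX : IsVF 0 X) (hY : IsVF δ Y) : IsVF δ (X * Y - Y * X) := by
  have h := hX.comm hY
  rwa [zero_mul, sgn_zero, one_smul, zero_add] at h

theorem anticomm (hX : IsVF 1 X) (hY : IsVF 1 Y) : IsVF 0 (X * Y + Y * X) := by
  have h := hX.comm hY
  rwa [mul_one, sgn_one, neg_one_smul ℝ (Y * X), sub_neg_eq_add] at h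

theorem sq (hX : IsVF 1 X) : IsVF 0 (X * X) := by
  have h := (hX.anticomm hX).smul 2⁻¹
  rwa [← two_smul ℝ, smul_smul, inv_mul_cancel₀ two_ne_zero, one_smul] at h

end IsVF

variable (p) in
theorem isVF_D (v : V) : IsVF (p v) (D p v) where
  parity u := by
    classical
    rw [D_co]
    split_ifs with h
    · have : p u + p v = 0 := by
        rw [h]; generalize p v = a; revert a; decide
      rw [this]; exact Par.one
    · exact Par.zero
  eq_vf F := by
    classical
    obtain ⟨S, hS⟩ := exists_support F
    rw [vfL_eq_sum _ _ (S := insert v S) fun u hu => Finset.mem_insert_of_mem (hS u hu)]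
    simp only [D_co, ite_mul, one_mul, zero_mul]
    rw [Finset.sum_ite_eq' , if_pos (Finset.mem_insert_self _ _)]

variable (p p') in
/-- The linear substitution `v ↦ ∑ u, L v u • u`. -/
noncomputable def subst (L : V → V' →₀ ℝ) : SF p →ₐ[ℝ] SF p' := SuperFun.subst p p' L

theorem subst_co {L : V → V' →₀ ℝ} (hL : PreservesParity p p' L) (v : V) :
    subst p p' L (co p v) = (L v).sum fun u c => c • co p' u := subst_coord hL v

theorem Par.subst {a : ZMod 2} {F : SF p} (h : Par a F) (L : V → V' →₀ ℝ) :
    Par a (subst p p' L F) := HasParity.subst h L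

theorem D_subst {L : V → V' →₀ ℝ} (hL : PreservesParity p p' L) (F : SF p)
    {S : Finset V} (hS : ∀ v, D p v F ≠ 0 → v ∈ S) (u : V') :
    D p' u (subst p p' L F) = ∑ v ∈ S, L v u • subst p p' L (D p v F) :=
  pderiv_subst hL F hS u

theorem subst_subst {L : V → V' →₀ ℝ} {L' : V' → V'' →₀ ℝ} (hL' : PreservesParity p' p'' L')
    (F : SF p) : subst p' p'' L' (subst p p' L F) =
      subst p p'' (fun v => Finsupp.linearCombination ℝ L' (L v)) F :=
  SuperFun.subst_subst hL' F

theorem subst_single (F : SF p) : subst p p (fun v => Finsupp.single v 1) F = F :=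
  SuperFun.subst_single F

/-- A substitution intertwines two vector fields as soon as it does so on the coordinates. -/
theorem IsVF.intertwine {ε δ : ZMod 2} {X : Module.End ℝ (SF p)} {Y : Module.End ℝ (SF p')}
    (hX : IsVF ε X) (hY : IsVF δ Y) {L : V → V' →₀ ℝ} (hL : PreservesParity p p' L)
    (h : ∀ v, subst p p' L (X (co p v)) = Y (subst p p' L (co p v))) (F : SF p) :
    subst p p' L (X F) = Y (subst p p' L F) := by
  classical
  obtain ⟨S, hS⟩ := exists_support F
  let T : Finset V' := S.biUnion fun v => (L v).support
  have hT : ∀ u, D p' u (subst p p' L F) ≠ 0 → u ∈ T := fun u hu => by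
    by_contra hn
    refine hu ?_
    rw [D_subst hL F hS]
    refine Finset.sum_eq_zero fun v hv => ?_
    have : L v u = 0 := by
      by_contra hne
      exact hn (Finset.mem_biUnion.2 ⟨v, hv, Finsupp.mem_support_iff.2 hne⟩)
    rw [this, zero_smul]
  rw [hX.eq_sum F hS, hY.eq_sum _ hT, map_sum]
  simp only [map_mul, h]
  have h2 : ∀ v ∈ S, Y (subst p p' L (co p v)) = ∑ u ∈ T, L v u • Y (co p' u) := fun v hv => by
    rw [subst_co hL, Finsupp.sum_of_support_subset (s := T) _
      (Finset.subset_biUnion_of_mem (fun v => (L v).support) hv) (fun u c => c • co p' u)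
      fun u _ => zero_smul ℝ _, map_sum]
    simp only [map_smul]
  rw [Finset.sum_congr rfl fun v hv => by rw [h2 v hv, Finset.sum_mul], Finset.sum_comm]
  refine Finset.sum_congr rfl fun u _ => ?_
  rw [D_subst hL F hS, Finset.mul_sum]
  exact Finset.sum_congr rfl fun v _ => by rw [smul_mul_assoc, mul_smul_comm]

end SF

/-! ### Multi-indices and powers of commuting families -/

section MultiIndex

variable {n : ℕ}

theorem multiIndex_induction {P : (Fin n → ℕ) → Prop} (zero : P 0)
    (step : ∀ m μ, P m → P (m + Pi.single μ 1)) (m : Fin n → ℕ) : P m := by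
  induction h : ∑ μ, m μ generalizing m with
  | zero =>
    have : m = 0 := by
      funext μ
      exact (Finset.sum_eq_zero_iff.1 h) μ (Finset.mem_univ μ)
    rw [this]; exact zero
  | succ k ih =>
    obtain ⟨μ, -, hμ⟩ : ∃ μ ∈ Finset.univ, m μ ≠ 0 := by
      by_contra! hcon
      rw [Finset.sum_eq_zero hcon] at h
      omega
    have hm : m = (m - Pi.single μ 1) + Pi.single μ 1 := by
      funext κ
      by_cases hκ : κ = μ
      · subst hκ; simp; omega
      · simp [hκ]
    rw [hm]
    refine step _ _ (ih _ ?_)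
    have h2 : ∑ κ, m κ = ∑ κ, (m - Pi.single μ 1 : Fin n → ℕ) κ + 1 := by
      conv_lhs => rw [hm]
      simp [Finset.sum_add_distrib]
    omega

/-- The product of the powers `T μ ^ m μ`, for a commuting family `T`. -/
def famPow {R : Type*} [Monoid R] (T : Fin n → R) (m : Fin n → ℕ) : R :=
  ((List.finRange n).map fun μ => T μ ^ m μ).prod

variable {R : Type*} [Monoid R] {T : Fin n → R}

@[simp] theorem famPow_zero : famPow T 0 = 1 := by
  simp [famPow]

theorem Commute.famPow {a : R} (h : ∀ μ, Commute a (T μ)) (m : Fin n → ℕ) :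
    Commute a (famPow T m) := by
  refine Commute.list_prod_right _ _ fun x hx => ?_
  obtain ⟨μ, -, rfl⟩ := List.mem_map.1 hx
  exact (h μ).pow_right _

theorem famPow_add_single (hT : ∀ μ κ, Commute (T μ) (T κ)) (m : Fin n → ℕ) (μ : Fin n) :
    famPow T (m + Pi.single μ 1) = T μ * famPow T m := by
  have key : ∀ l : List (Fin n), l.Nodup →
      (l.map fun κ => T κ ^ (m + Pi.single μ 1 : Fin n → ℕ) κ).prod =
      (if μ ∈ l then T μ else 1) * (l.map fun κ => T κ ^ m κ).prod := by
    intro l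
    induction l with
    | nil => simp
    | cons κ l ih =>
      intro hl
      rw [List.nodup_cons] at hl
      rw [List.map_cons, List.prod_cons, ih hl.2, List.map_cons, List.prod_cons]
      by_cases hκ : κ = μ
      · subst hκ
        simp [hl.1, pow_succ', mul_assoc]
      · have h1 : (m + Pi.single μ 1 : Fin n → ℕ) κ = m κ := by simp [hκ]
        have h2 : μ ∈ κ :: l ↔ μ ∈ l := by simp [Ne.symm hκ]
        rw [h1]
        simp only [h2]
        split_ifs
        · rw [← mul_assoc, ← mul_assoc, ((hT μ κ).pow_right (m κ)).eq]
        · rw [one_mul, one_mul]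
  rw [famPow, key _ (List.nodup_finRange n), if_pos (List.mem_finRange μ)]
  rfl

end MultiIndex

/-! ### Evolutionary vector fields -/

/-- Local functions, as elements of `SF`. -/
abbrev LF {F : Type*} (n : ℕ) (par : F → ZMod 2) : Type _ := SF (LocalTheory.jetPar par n)

namespace LF

open SuperFun (sgn sgn_zero sgn_one sgn_add sgn_mul_self zmod_two_cases PreservesParity)
open SF LocalTheory

variable {n : ℕ} {F F' F'' : Type*} (par : F → ZMod 2) (par' : F' → ZMod 2) (par'' : F'' → ZMod 2)

/-- The coordinate `x^μ`. -/
noncomputable def xx (μ : Fin n) : LF n par := co _ (Sum.inl μ)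

/-- The jet coordinate `f_{(m)}`. -/
noncomputable def jt (f : F) (m : Fin n → ℕ) : LF n par := co _ (Sum.inr (f, m))

/-- The total derivative as a linear operator. -/
noncomputable def totL (μ : Fin n) : Module.End ℝ (LF n par) :=
  vfL _ (Sum.elim (fun κ => if κ = μ then 1 else 0) (fun q => jt par q.1 (q.2 + Pi.single μ 1)))

/-- The iterated total derivative as a linear operator. -/
noncomputable def totP (m : Fin n → ℕ) : Module.End ℝ (LF n par) := famPow (totL par) m

/-- The evolutionary vector field with characteristic `Q` as a linear operator. -/
noncomputable def evolL (Q : F → LF n par) : Module.End ℝ (LF n par) :=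
  vfL _ (Sum.elim (fun _ => 0) (fun q => totP par q.2 (Q q.1)))

/-- The Euler vector field with weights `c` as a linear operator. -/
noncomputable def eulerL (c : F → (Fin n → ℕ) → ℤ) : Module.End ℝ (LF n par) :=
  vfL _ (Sum.elim (fun _ => 0) (fun q => (c q.1 q.2 : ℝ) • jt par q.1 q.2))

theorem totP_apply (m : Fin n → ℕ) (G : LF n par) : totP par m G = totIter par m G := by
  unfold totP famPow totIter
  induction List.finRange n with
  | nil => rfl
  | cons μ l ih =>
    rw [List.map_cons, List.prod_cons, Module.End.mul_apply, ih]
    exact Module.End.pow_apply _ _ _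

theorem evolL_apply (Q : F → LF n par) (G : LF n par) : evolL par Q G = evol par Q G := by
  have h : (fun q : F × (Fin n → ℕ) => totP par q.2 (Q q.1)) =
      fun q => totIter par q.2 (Q q.1) := funext fun q => totP_apply par _ _
  unfold evolL
  rw [h]
  rfl

variable {par par' par''}

theorem par_jt (f : F) (m : Fin n → ℕ) : Par (par f) (jt par f m) :=
  par_co (p := jetPar par n) (Sum.inr (f, m))

theorem isVF_totL (μ : Fin n) : IsVF 0 (totL par μ) := by
  refine isVF_vfL ?_
  rintro (κ | ⟨f, m⟩)
  · rw [add_zero]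
    change Par 0 (if κ = μ then 1 else 0)
    split_ifs
    exacts [Par.one, Par.zero]
  · rw [add_zero]
    exact par_jt f _

theorem totL_xx (μ κ : Fin n) : totL par μ (xx par κ) = if κ = μ then 1 else 0 :=
  vfL_co _ _

theorem totL_jt (μ : Fin n) (f : F) (m : Fin n → ℕ) :
    totL par μ (jt par f m) = jt par f (m + Pi.single μ 1) :=
  vfL_co _ _

/-- Vector fields that agree on the jet coordinates agree. -/
theorem ext_jet {ε δ : ZMod 2} {X Y : Module.End ℝ (LF n par)} (hX : IsVF ε X) (hY : IsVF δ Y)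
    (hx : ∀ μ, X (xx par μ) = Y (xx par μ)) (hj : ∀ f m, X (jt par f m) = Y (jt par f m)) :
    X = Y := by
  refine hX.ext hY ?_
  rintro (κ | ⟨f, m⟩)
  exacts [hx κ, hj f m]

theorem map_one_eq_zero {ε : ZMod 2} {X : Module.End ℝ (LF n par)} (hX : IsVF ε X) : X 1 = 0 := by
  have h := hX.leibniz 1 1
  rw [mul_one, mul_one, map_one (tw _ ε), one_mul] at h
  exact left_eq_add.1 h

theorem commute_totL (μ κ : Fin n) : Commute (totL par μ) (totL par κ) := by
  refine sub_eq_zero.1 (ext_jet ((isVF_totL μ).comm_even (isVF_totL κ)) (IsVF.zero (ε := 0)) ?_ ?_)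
  · intro ν
    rw [LinearMap.sub_apply, Module.End.mul_apply, Module.End.mul_apply, totL_xx, totL_xx,
      LinearMap.zero_apply]
    split_ifs <;> simp [map_one_eq_zero (isVF_totL _)]
  · intro f m
    rw [LinearMap.sub_apply, Module.End.mul_apply, Module.End.mul_apply, totL_jt, totL_jt, totL_jt,
      totL_jt, add_right_comm, sub_self, LinearMap.zero_apply]

@[simp] theorem totP_zero : totP par (0 : Fin n → ℕ) = 1 := famPow_zero

theorem totP_add_single (m : Fin n → ℕ) (μ : Fin n) :
    totP par (m + Pi.single μ 1) = totL par μ * totP par m :=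
  famPow_add_single commute_totL m μ

theorem totP_jt (m k : Fin n → ℕ) (f : F) : totP par m (jt par f k) = jt par f (k + m) := by
  induction m using multiIndex_induction with
  | zero => simp
  | step m μ ih => rw [totP_add_single, Module.End.mul_apply, ih, totL_jt, add_assoc]

theorem jt_eq_totP (f : F) (m : Fin n → ℕ) : jt par f m = totP par m (jt par f 0) := by
  rw [totP_jt, zero_add]

theorem par_totP {a : ZMod 2} {G : LF n par} (hG : Par a G) (m : Fin n → ℕ) :
    Par a (totP par m G) := by
  induction m using multiIndex_induction with
  | zero => simpa using hG
  | step m μ ih =>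
    rw [totP_add_single, Module.End.mul_apply]
    simpa using (isVF_totL μ).map_parity ih

theorem commute_totP {X : Module.End ℝ (LF n par)} (hX : ∀ μ, Commute X (totL par μ))
    (m : Fin n → ℕ) : Commute X (totP par m) :=
  Commute.famPow hX m

/-- Vector fields commuting with the total derivatives are determined by their values on `x` and on
the undifferentiated fields. -/
theorem ext_tot {ε δ : ZMod 2} {X Y : Module.End ℝ (LF n par)} (hX : IsVF ε X) (hY : IsVF δ Y)
    (hXt : ∀ μ, Commute X (totL par μ)) (hYt : ∀ μ, Commute Y (totL par μ))
    (hx : ∀ μ, X (xx par μ) = Y (xx par μ)) (hj : ∀ f, X (jt par f 0) = Y (jt par f 0)) :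
    X = Y := by
  refine ext_jet hX hY hx fun f m => ?_
  rw [jt_eq_totP, ← Module.End.mul_apply, (commute_totP hXt m).eq, Module.End.mul_apply, hj,
    ← Module.End.mul_apply, ← (commute_totP hYt m).eq, Module.End.mul_apply]

theorem evolL_xx (Q : F → LF n par) (μ : Fin n) : evolL par Q (xx par μ) = 0 := vfL_co _ _

theorem evolL_jt (Q : F → LF n par) (f : F) (m : Fin n → ℕ) :
    evolL par Q (jt par f m) = totP par m (Q f) := vfL_co _ _

theorem evolL_jt_zero (Q : F → LF n par) (f : F) : evolL par Q (jt par f 0) = Q f := by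
  rw [evolL_jt, totP_zero, Module.End.one_apply]

theorem isVF_evolL {ε : ZMod 2} {Q : F → LF n par} (hQ : ∀ f, Par (par f + ε) (Q f)) :
    IsVF ε (evolL par Q) := by
  refine isVF_vfL ?_
  rintro (κ | ⟨f, m⟩)
  · exact Par.zero
  · exact par_totP (hQ f) m

theorem commute_of_jet {ε : ZMod 2} {X : Module.End ℝ (LF n par)} (hX : IsVF ε X) (μ : Fin n)
    (hx : ∀ κ, totL par μ (X (xx par κ)) = 0)
    (hj : ∀ f m, X (jt par f (m + Pi.single μ 1)) = totL par μ (X (jt par f m))) :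
    Commute X (totL par μ) := by
  refine (sub_eq_zero.1 (ext_jet ((isVF_totL μ).comm_even hX) (IsVF.zero (ε := 0)) ?_ ?_)).symm
  · intro κ
    rw [LinearMap.sub_apply, Module.End.mul_apply, Module.End.mul_apply, hx, totL_xx,
      LinearMap.zero_apply]
    split_ifs <;> simp [map_one_eq_zero hX]
  · intro f m
    rw [LinearMap.sub_apply, Module.End.mul_apply, Module.End.mul_apply, totL_jt, hj, sub_self,
      LinearMap.zero_apply]

theorem commute_evolL {ε : ZMod 2} {Q : F → LF n par} (hQ : ∀ f, Par (par f + ε) (Q f))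
    (μ : Fin n) : Commute (evolL par Q) (totL par μ) := by
  refine commute_of_jet (isVF_evolL hQ) μ (fun κ => ?_) fun f m => ?_
  · rw [evolL_xx, map_zero]
  · rw [evolL_jt, evolL_jt, totP_add_single, Module.End.mul_apply]

theorem isVF_eulerL (c : F → (Fin n → ℕ) → ℤ) : IsVF 0 (eulerL par c) := by
  refine isVF_vfL ?_
  rintro (κ | ⟨f, m⟩)
  · exact Par.zero
  · rw [add_zero]
    exact (par_jt f m).smul _

theorem eulerL_xx (c : F → (Fin n → ℕ) → ℤ) (μ : Fin n) : eulerL par c (xx par μ) = 0 :=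
  vfL_co _ _

theorem eulerL_jt (c : F → (Fin n → ℕ) → ℤ) (f : F) (m : Fin n → ℕ) :
    eulerL par c (jt par f m) = (c f m : ℝ) • jt par f m := vfL_co _ _

theorem commute_eulerL (c : F → ℤ) (μ : Fin n) :
    Commute (eulerL par fun f _ => c f) (totL par μ) := by
  refine commute_of_jet (isVF_eulerL _) μ (fun κ => ?_) fun f m => ?_
  · rw [eulerL_xx, map_zero]
  · rw [eulerL_jt, eulerL_jt, map_smul, totL_jt]

/-! ### Linear combinations and substitutions of fields -/

variable (par) in
/-- Linear combinations of undifferentiated fields. -/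
noncomputable def linL : (F →₀ ℝ) →ₗ[ℝ] LF n par :=
  Finsupp.linearCombination ℝ fun f => jt par f 0

variable (par) in
/-- Linear combinations of field jets. -/
noncomputable def linJ : (F × (Fin n → ℕ) →₀ ℝ) →ₗ[ℝ] LF n par :=
  Finsupp.linearCombination ℝ fun q => jt par q.1 q.2

theorem linL_apply (u : F →₀ ℝ) : linL par u = lin par n u := rfl

@[simp] theorem linL_single (f : F) (c : ℝ) :
    linL (n := n) par (Finsupp.single f c) = c • jt par f 0 :=
  Finsupp.linearCombination_single ..

@[simp] theorem linJ_single (q : F × (Fin n → ℕ)) (c : ℝ) :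
    linJ par (Finsupp.single q c) = c • jt par q.1 q.2 :=
  Finsupp.linearCombination_single ..

theorem par_linL {a : ZMod 2} {u : F →₀ ℝ} (hu : ∀ f ∈ u.support, par f = a) :
    Par a (linL (n := n) par u) := by
  refine Par.sum fun f hf => Par.smul ?_ _
  rw [← hu f hf]
  exact par_jt f 0

theorem totP_linL (m : Fin n → ℕ) (u : F →₀ ℝ) :
    totP par m (linL par u) = linJ par (u.mapDomain fun f => (f, m)) := by
  rw [linJ, Finsupp.linearCombination_mapDomain, linL, Finsupp.linearCombination_apply,
    Finsupp.linearCombination_apply, Finsupp.sum, Finsupp.sum, map_sum]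
  refine Finset.sum_congr rfl fun f _ => ?_
  rw [map_smul, ← jt_eq_totP]
  rfl

theorem evolL_linL (Q : F → LF n par) (u : F →₀ ℝ) :
    evolL par Q (linL par u) = Finsupp.linearCombination ℝ Q u := by
  rw [linL, Finsupp.linearCombination_apply, Finsupp.linearCombination_apply, Finsupp.sum,
    Finsupp.sum, map_sum]
  refine Finset.sum_congr rfl fun f _ => ?_
  rw [map_smul, evolL_jt_zero]

variable (par par') in
/-- Linear substitution of field jets. -/
noncomputable def fsub (L : F → (Fin n → ℕ) → (F' × (Fin n → ℕ) →₀ ℝ)) :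
    LF n par →ₐ[ℝ] LF n par' :=
  SF.subst _ _ (Sum.elim (fun μ => Finsupp.single (Sum.inl μ) 1)
    (fun q => (L q.1 q.2).mapDomain Sum.inr))

variable (par par') in
/-- The linear substitution `L` replaces field jets by combinations of field jets of the same
parity. -/
def FieldParity (L : F → (Fin n → ℕ) → (F' × (Fin n → ℕ) →₀ ℝ)) : Prop :=
  ∀ f m, ∀ q ∈ (L f m).support, par' q.1 = par f

theorem FieldParity.preservesParity {L : F → (Fin n → ℕ) → (F' × (Fin n → ℕ) →₀ ℝ)}
    (hL : FieldParity par par' L) : PreservesParity (jetPar par n) (jetPar par' n)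
      (Sum.elim (fun μ => Finsupp.single (Sum.inl μ) 1)
        (fun q => (L q.1 q.2).mapDomain Sum.inr)) := by
  classical
  rintro (μ | ⟨f, m⟩) u hu
  · have := Finsupp.support_single_subset hu
    rw [Finset.mem_singleton] at this
    rw [this]
    rfl
  · have := Finsupp.mapDomain_support hu
    obtain ⟨q, hq, rfl⟩ := Finset.mem_image.1 this
    exact hL f m q hq

section Substitution

variable {L : F → (Fin n → ℕ) → (F' × (Fin n → ℕ) →₀ ℝ)} (hL : FieldParity par par' L)
include hL

theorem fsub_xx (μ : Fin n) : fsub par par' L (xx par μ) = xx par' μ := by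
  refine (subst_co hL.preservesParity (Sum.inl μ)).trans ?_
  rw [Sum.elim_inl, Finsupp.sum_single_index (h := fun u c => c • co (jetPar par' n) u)
    (zero_smul ℝ _), one_smul]
  rfl

theorem fsub_jt (f : F) (m : Fin n → ℕ) : fsub par par' L (jt par f m) = linJ par' (L f m) := by
  refine (subst_co hL.preservesParity (Sum.inr (f, m))).trans ?_
  rw [Sum.elim_inr]
  exact Finsupp.linearCombination_mapDomain ℝ (v' := fun u => co (jetPar par' n) u)
    Sum.inr (L f m)

/-- A substitution of fields intertwines two vector fields as soon as it does so on the
coordinates. -/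
theorem fsub_intertwine {ε δ : ZMod 2} {X : Module.End ℝ (LF n par)}
    {Y : Module.End ℝ (LF n par')} (hX : IsVF ε X) (hY : IsVF δ Y)
    (hx : ∀ μ, fsub par par' L (X (xx par μ)) = Y (xx par' μ))
    (hj : ∀ f m, fsub par par' L (X (jt par f m)) = Y (linJ par' (L f m))) (G : LF n par) :
    fsub par par' L (X G) = Y (fsub par par' L G) := by
  refine hX.intertwine hY hL.preservesParity ?_ G
  rintro (μ | ⟨f, m⟩)
  · exact (hx μ).trans (congrArg Y (fsub_xx hL μ).symm)
  · exact (hj f m).trans (congrArg Y (fsub_jt hL f m).symm)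

theorem fsub_totL (hs : ∀ f m μ, totL par' μ (linJ par' (L f m)) =
      linJ par' (L f (m + Pi.single μ 1))) (μ : Fin n) (G : LF n par) :
    fsub par par' L (totL par μ G) = totL par' μ (fsub par par' L G) := by
  refine fsub_intertwine hL (isVF_totL μ) (isVF_totL μ) (fun κ => ?_) (fun f m => ?_) G
  · rw [totL_xx, totL_xx]
    split_ifs
    exacts [map_one _, map_zero _]
  · rw [totL_jt, fsub_jt hL, hs]

end Substitution

theorem fsub_fsub {L : F → (Fin n → ℕ) → (F' × (Fin n → ℕ) →₀ ℝ)}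
    {L' : F' → (Fin n → ℕ) → (F'' × (Fin n → ℕ) →₀ ℝ)} (hL' : FieldParity par' par'' L')
    (G : LF n par) : fsub par' par'' L' (fsub par par' L G) =
      fsub par par'' (fun f m => Finsupp.linearCombination ℝ (fun q => L' q.1 q.2) (L f m)) G := by
  refine (subst_subst hL'.preservesParity G).trans ?_
  unfold fsub
  congr 1
  congr 1
  funext v
  rcases v with μ | ⟨f, m⟩
  · simp
  · simp only [Sum.elim_inr]
    rw [Finsupp.linearCombination_mapDomain, ← Finsupp.lmapDomain_apply _ ℝ,
      ← LinearMap.comp_apply]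
    congr 1
    refine Finsupp.lhom_ext' fun q => LinearMap.ext_ring ?_
    simp

theorem fsub_single (G : LF n par) : fsub par par (fun f m => Finsupp.single (f, m) 1) G = G := by
  have h : (Sum.elim (fun μ => Finsupp.single (Sum.inl μ) 1)
      (fun q => (Finsupp.single (q.1, q.2) 1).mapDomain Sum.inr) : Jet n F → Jet n F →₀ ℝ) =
      fun v => Finsupp.single v 1 := by
    funext v
    rcases v with μ | ⟨f, m⟩
    · rfl
    · simp
  unfold fsub
  rw [h]
  exact subst_single G

end LF

/-! ### The Koszul operators on the span of the fields -/

namespace Parent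

open SuperFun (sgn sgn_zero sgn_one sgn_add sgn_mul_self zmod_two_cases PreservesParity)
open LocalTheory

variable {n : ℕ} {I : Type*} (par : I → ZMod 2)

/-- The real span of the fields `Ψ^A_{(l)[N]}`. -/
abbrev FieldSpan (n : ℕ) (I : Type*) : Type _ := PField n I →₀ ℝ

theorem eps_insert (i j : Fin n) {N : Finset (Fin n)} (hj : j ∉ N) :
    eps i (insert j N) = (if j < i then -1 else 1) * eps i N := by
  unfold eps
  rw [Finset.filter_insert]
  split_ifs with h
  · rw [Finset.card_insert_of_notMem fun hm => hj (Finset.mem_filter.1 hm).1, pow_succ']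
  · rw [one_mul]

theorem eps_erase (i j : Fin n) {N : Finset (Fin n)} (hj : j ∈ N) :
    eps i (N.erase j) = (if j < i then -1 else 1) * eps i N := by
  have h := eps_insert i j (Finset.notMem_erase j N)
  rw [Finset.insert_erase hj] at h
  rw [h, ← mul_assoc]
  split_ifs <;> simp

theorem eps_mul_self (i : Fin n) (N : Finset (Fin n)) : eps i N * eps i N = 1 := by
  unfold eps
  rw [← mul_pow]
  simp

theorem sign_swap {i j : Fin n} (h : i ≠ j) :
    (if i < j then (-1 : ℝ) else 1) = -(if j < i then -1 else 1) := by
  rcases lt_or_gt_of_ne h with h | h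
  · rw [if_pos h, if_neg h.not_gt]
  · rw [if_pos h, if_neg (not_lt.2 h.le), neg_neg]

/-- Contraction of a skew index: `Ψ^a_{(l)[N]}` is mapped to the signed `Ψ^a_{(l)[N∖i]}` or to zero. -/
noncomputable def contr (i : Fin n) : Module.End ℝ (FieldSpan n I) :=
  Finsupp.linearCombination ℝ fun f => if i ∈ f.2.2 then
    Finsupp.single (f.1, f.2.1, f.2.2.erase i) (eps i f.2.2) else 0

/-- Insertion of a skew index, the adjoint of `contr`. -/
noncomputable def wedge (i : Fin n) : Module.End ℝ (FieldSpan n I) :=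
  Finsupp.linearCombination ℝ fun f => if i ∈ f.2.2 then 0 else
    Finsupp.single (f.1, f.2.1, insert i f.2.2) (eps i f.2.2)

/-- Insertion of a symmetric index. -/
noncomputable def raise (i : Fin n) : Module.End ℝ (FieldSpan n I) :=
  Finsupp.linearCombination ℝ fun f => Finsupp.single (f.1, f.2.1 + Pi.single i 1, f.2.2) 1

/-- Removal of a symmetric index, with its multiplicity. The truncated difference `l - i` for
`l i = 0` comes with the coefficient zero. -/
noncomputable def lower (i : Fin n) : Module.End ℝ (FieldSpan n I) :=
  Finsupp.linearCombination ℝ fun f =>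
    Finsupp.single (f.1, f.2.1 - Pi.single i 1, f.2.2) (f.2.1 i : ℝ)

/-- Multiplication of `Ψ^A_{(l)[N]}` with the sign `(-1)^{|A|}`. -/
noncomputable def signA : Module.End ℝ (FieldSpan n I) :=
  Finsupp.linearCombination ℝ fun f => Finsupp.single f (sgn (par f.1))

variable (i j : Fin n) (a : I) (l : Fin n → ℕ) (N : Finset (Fin n)) (c : ℝ)

/-- The basis vector `Ψ^a_{(l)[N]}`. -/
noncomputable def fld (a : I) (l : Fin n → ℕ) (N : Finset (Fin n)) : FieldSpan n I :=
  Finsupp.single (a, l, N) 1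

theorem single_eq_smul_fld (f : PField n I) : Finsupp.single f c = c • fld f.1 f.2.1 f.2.2 := by
  rw [fld, Finsupp.smul_single, smul_eq_mul, mul_one]

theorem contr_fld : contr i (fld a l N) = if i ∈ N then eps i N • fld a l (N.erase i) else 0 := by
  rw [fld, contr, Finsupp.linearCombination_single, one_smul, single_eq_smul_fld]

theorem wedge_fld : wedge i (fld a l N) = if i ∈ N then 0 else eps i N • fld a l (insert i N) := by
  rw [fld, wedge, Finsupp.linearCombination_single, one_smul, single_eq_smul_fld]

theorem raise_fld : raise i (fld a l N) = fld a (l + Pi.single i 1) N := by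
  rw [fld, raise, Finsupp.linearCombination_single, one_smul, single_eq_smul_fld, one_smul]

theorem lower_fld : lower i (fld a l N) = (l i : ℝ) • fld a (l - Pi.single i 1) N := by
  rw [fld, lower, Finsupp.linearCombination_single, one_smul, single_eq_smul_fld]

theorem signA_fld : signA par (fld a l N) = sgn (par a) • fld a l N := by
  rw [fld, signA, Finsupp.linearCombination_single, one_smul, single_eq_smul_fld]; rfl

theorem end_ext {W : Type*} [AddCommMonoid W] [Module ℝ W] {X Y : FieldSpan n I →ₗ[ℝ] W}
    (h : ∀ a l N, X (fld a l N) = Y (fld a l N)) : X = Y :=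
  Finsupp.lhom_ext' fun f => LinearMap.ext_ring (h f.1 f.2.1 f.2.2)

theorem contr_mul_wedge_add (i j : Fin n) :
    contr i * wedge j + wedge j * contr i = if i = j then (1 : Module.End ℝ (FieldSpan n I))
      else 0 := by
  refine end_ext fun a l N => ?_
  rw [LinearMap.add_apply, Module.End.mul_apply, Module.End.mul_apply, wedge_fld, contr_fld]
  by_cases hij : i = j
  · subst hij
    rw [if_pos rfl, Module.End.one_apply]
    by_cases hi : i ∈ N
    · rw [if_pos hi, if_pos hi, map_zero, zero_add, map_smul, wedge_fld,
        if_neg (Finset.notMem_erase i N), eps_erase i i hi, if_neg (lt_irrefl i), one_mul,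
        smul_smul, eps_mul_self, one_smul, Finset.insert_erase hi]
    · rw [if_neg hi, if_neg hi, map_zero, add_zero, map_smul, contr_fld,
        if_pos (Finset.mem_insert_self i N), eps_insert i i hi, if_neg (lt_irrefl i), one_mul,
        smul_smul, eps_mul_self, one_smul, Finset.erase_insert hi]
  · rw [if_neg hij, LinearMap.zero_apply]
    by_cases hi : i ∈ N <;> by_cases hj : j ∈ N
    · rw [if_pos hi, if_pos hj, map_zero, zero_add, map_smul, wedge_fld,
        if_pos (Finset.mem_erase.2 ⟨Ne.symm hij, hj⟩), smul_zero]
    · rw [if_pos hi, if_neg hj, map_smul, map_smul, contr_fld, wedge_fld,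
        if_pos (Finset.mem_insert_of_mem hi), if_neg fun h => hj (Finset.mem_of_mem_erase h),
        eps_insert i j hj, eps_erase j i hi, Finset.erase_insert_of_ne (Ne.symm hij),
        sign_swap hij, smul_smul, smul_smul, ← add_smul]
      convert zero_smul ℝ _ using 2
      ring
    · rw [if_neg hi, if_pos hj, map_zero, map_zero, add_zero]
    · rw [if_neg hi, if_neg hj, map_zero, add_zero, map_smul, contr_fld,
        if_neg (by rw [Finset.mem_insert, not_or]; exact ⟨hij, hi⟩), smul_zero]

theorem wedge_mul_wedge (i j : Fin n) :
    wedge i * wedge j = -(wedge j * wedge i : Module.End ℝ (FieldSpan n I)) := by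
  refine end_ext fun a l N => ?_
  rw [LinearMap.neg_apply, Module.End.mul_apply, Module.End.mul_apply, wedge_fld, wedge_fld]
  by_cases hi : i ∈ N <;> by_cases hj : j ∈ N
  · rw [if_pos hi, if_pos hj, map_zero, map_zero, neg_zero]
  · rw [if_neg hj, if_pos hi, map_zero, map_smul, wedge_fld, if_pos (Finset.mem_insert_of_mem hi),
      smul_zero, neg_zero]
  · rw [if_pos hj, if_neg hi, map_zero, map_smul, wedge_fld, if_pos (Finset.mem_insert_of_mem hj),
      smul_zero, neg_zero]
  · rw [if_neg hi, if_neg hj, map_smul, map_smul, wedge_fld, wedge_fld]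
    by_cases hij : i = j
    · subst hij
      rw [if_pos (Finset.mem_insert_self i N), smul_zero, neg_zero]
    · rw [if_neg (by rw [Finset.mem_insert, not_or]; exact ⟨hij, hi⟩),
        if_neg (by rw [Finset.mem_insert, not_or]; exact ⟨Ne.symm hij, hj⟩), eps_insert i j hj,
        eps_insert j i hi, Finset.insert_comm, sign_swap hij, smul_smul, smul_smul, ← neg_smul]
      congr 1
      ring

theorem contr_mul_contr (i j : Fin n) :
    contr i * contr j = -(contr j * contr i : Module.End ℝ (FieldSpan n I)) := by
  refine end_ext fun a l N => ?_
  rw [LinearMap.neg_apply, Module.End.mul_apply, Module.End.mul_apply, contr_fld, contr_fld]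
  by_cases hi : i ∈ N <;> by_cases hj : j ∈ N
  · rw [if_pos hi, if_pos hj, map_smul, map_smul, contr_fld, contr_fld]
    by_cases hij : i = j
    · subst hij
      rw [if_neg (Finset.notMem_erase i N), smul_zero, neg_zero]
    · rw [if_pos (Finset.mem_erase.2 ⟨hij, hi⟩), if_pos (Finset.mem_erase.2 ⟨Ne.symm hij, hj⟩),
        eps_erase i j hj, eps_erase j i hi, Finset.erase_right_comm, sign_swap hij, smul_smul,
        smul_smul, ← neg_smul]
      congr 1
      ring
  · rw [if_neg hj, if_pos hi, map_zero, map_smul, contr_fld,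
      if_neg fun h => hj (Finset.mem_of_mem_erase h), smul_zero, neg_zero]
  · rw [if_pos hj, if_neg hi, map_zero, map_smul, contr_fld,
      if_neg fun h => hi (Finset.mem_of_mem_erase h), smul_zero, neg_zero]
  · rw [if_neg hi, if_neg hj, map_zero, map_zero, neg_zero]

theorem lower_mul_raise (i j : Fin n) :
    lower j * raise i = raise i * lower j +
      if i = j then (1 : Module.End ℝ (FieldSpan n I)) else 0 := by
  refine end_ext fun a l N => ?_
  rw [LinearMap.add_apply, Module.End.mul_apply, Module.End.mul_apply, raise_fld, lower_fld,
    lower_fld, map_smul, raise_fld]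
  by_cases hij : i = j
  · subst hij
    have h : l + Pi.single i 1 - Pi.single i 1 = l := by
      funext k; simp
    rw [if_pos rfl, h, Module.End.one_apply]
    rcases Nat.eq_zero_or_pos (l i) with h0 | h0
    · simp [h0]
    · have h2 : l - Pi.single i 1 + Pi.single i 1 = l := by
        funext k
        by_cases hk : k = i
        · subst hk; simp; omega
        · simp [hk]
      rw [h2, Pi.add_apply, Pi.single_eq_same, Nat.cast_add, Nat.cast_one, add_smul, one_smul]
  · rw [if_neg hij, LinearMap.zero_apply, add_zero, Pi.add_apply,
      Pi.single_eq_of_ne (Ne.symm hij), add_zero]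
    rcases Nat.eq_zero_or_pos (l j) with h0 | h0
    · simp [h0]
    · congr 2
      funext k
      by_cases hk : k = i
      · subst hk; simp [hij]
      · simp [hk]

theorem commute_lower_lower : Commute (lower i : Module.End ℝ (FieldSpan n I)) (lower j) := by
  refine end_ext fun a l N => ?_
  rw [Module.End.mul_apply, Module.End.mul_apply, lower_fld, lower_fld, map_smul, map_smul,
    lower_fld, lower_fld, smul_smul, smul_smul, tsub_right_comm]
  by_cases hij : i = j
  · subst hij; rfl
  · rw [Pi.sub_apply, Pi.sub_apply, Pi.single_eq_of_ne hij, Pi.single_eq_of_ne (Ne.symm hij)]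
    rw [Nat.sub_zero, Nat.sub_zero, mul_comm]

theorem commute_raise_raise : Commute (raise i : Module.End ℝ (FieldSpan n I)) (raise j) := by
  refine end_ext fun a l N => ?_
  rw [Module.End.mul_apply, Module.End.mul_apply, raise_fld, raise_fld, raise_fld, raise_fld,
    add_right_comm]

theorem commute_wedge_lower : Commute (wedge i : Module.End ℝ (FieldSpan n I)) (lower j) := by
  refine end_ext fun a l N => ?_
  rw [Module.End.mul_apply, Module.End.mul_apply, lower_fld, wedge_fld, map_smul, wedge_fld]
  split_ifs
  · rw [smul_zero, map_zero]
  · rw [map_smul, lower_fld, smul_comm]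

theorem commute_contr_lower : Commute (contr i : Module.End ℝ (FieldSpan n I)) (lower j) := by
  refine end_ext fun a l N => ?_
  rw [Module.End.mul_apply, Module.End.mul_apply, lower_fld, contr_fld, map_smul, contr_fld]
  split_ifs
  · rw [map_smul, lower_fld, smul_comm]
  · rw [smul_zero, map_zero]

theorem commute_wedge_raise : Commute (wedge i : Module.End ℝ (FieldSpan n I)) (raise j) := by
  refine end_ext fun a l N => ?_
  rw [Module.End.mul_apply, Module.End.mul_apply, raise_fld, wedge_fld, wedge_fld]
  split_ifs
  · rw [map_zero]
  · rw [map_smul, raise_fld]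

theorem commute_contr_raise : Commute (contr i : Module.End ℝ (FieldSpan n I)) (raise j) := by
  refine end_ext fun a l N => ?_
  rw [Module.End.mul_apply, Module.End.mul_apply, raise_fld, contr_fld, contr_fld]
  split_ifs
  · rw [map_smul, raise_fld]
  · rw [map_zero]

theorem commute_signA_wedge : Commute (signA par) (wedge i) := by
  refine end_ext fun a l N => ?_
  rw [Module.End.mul_apply, Module.End.mul_apply, signA_fld, map_smul, wedge_fld]
  split_ifs
  · rw [smul_zero, map_zero]
  · rw [map_smul, signA_fld, smul_comm]

theorem commute_signA_contr : Commute (signA par) (contr i) := by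
  refine end_ext fun a l N => ?_
  rw [Module.End.mul_apply, Module.End.mul_apply, signA_fld, map_smul, contr_fld]
  split_ifs
  · rw [map_smul, signA_fld, smul_comm]
  · rw [smul_zero, map_zero]

theorem commute_signA_lower : Commute (signA par) (lower i) := by
  refine end_ext fun a l N => ?_
  rw [Module.End.mul_apply, Module.End.mul_apply, signA_fld, map_smul, lower_fld, map_smul,
    signA_fld, smul_comm]

theorem commute_signA_raise : Commute (signA par) (raise i) := by
  refine end_ext fun a l N => ?_
  rw [Module.End.mul_apply, Module.End.mul_apply, signA_fld, map_smul, raise_fld, signA_fld]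

theorem signA_mul_self : signA par * signA par = (1 : Module.End ℝ (FieldSpan n I)) := by
  refine end_ext fun a l N => ?_
  rw [Module.End.mul_apply, signA_fld, map_smul, signA_fld, smul_smul, sgn_mul_self, one_smul,
    Module.End.one_apply]

/-- `σ^F` on the span of the fields. -/
noncomputable def sigmaL : Module.End ℝ (FieldSpan n I) := Finsupp.linearCombination ℝ (sigmaRow par)

/-- `ρ^F` on the span of the fields. -/
noncomputable def rhoL : Module.End ℝ (FieldSpan n I) := Finsupp.linearCombination ℝ (rhoRow par)

theorem sigmaL_eq_sum : sigmaL par = ∑ i : Fin n, signA par * raise i * contr i := by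
  refine end_ext fun a l N => ?_
  rw [sigmaL, fld, Finsupp.linearCombination_single, one_smul, ← fld, LinearMap.sum_apply, sigmaRow]
  simp only [Module.End.mul_apply, contr_fld]
  rw [← Finset.sum_filter_add_sum_filter_not Finset.univ (fun i => i ∈ N)]
  simp only [Finset.filter_univ_mem]
  rw [Finset.sum_eq_zero (s := Finset.univ.filter fun i => i ∉ N), add_zero]
  · refine Finset.sum_congr rfl fun i hi => ?_
    rw [if_pos hi, map_smul, map_smul, raise_fld, signA_fld, smul_smul, single_eq_smul_fld,
      mul_comm]
  · intro i hi
    rw [if_neg (Finset.mem_filter.1 hi).2, map_zero, map_zero]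

theorem rhoL_eq_sum : rhoL par = ∑ i : Fin n, signA par * lower i * wedge i := by
  refine end_ext fun a l N => ?_
  rw [rhoL, fld, Finsupp.linearCombination_single, one_smul, ← fld, LinearMap.sum_apply, rhoRow]
  simp only [Module.End.mul_apply, wedge_fld]
  rw [← Finset.sum_add_sum_compl N, Finset.sum_eq_zero (s := N), zero_add]
  · refine Finset.sum_congr rfl fun i hi => ?_
    rw [if_neg (Finset.mem_compl.1 hi), map_smul, map_smul, lower_fld, map_smul, signA_fld,
      smul_smul, smul_smul, single_eq_smul_fld]
    congr 1
    ring
  · intro i hi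
    rw [if_pos hi, map_zero, map_zero]

theorem thetaRow_eq (ν : Fin n) (f : PField n I) :
    thetaRow par ν f = signA par (wedge ν (Finsupp.single f 1)) := by
  obtain ⟨a, l, N⟩ := f
  change _ = signA par (wedge ν (fld a l N))
  rw [thetaRow, wedge_fld]
  split_ifs
  · rw [map_zero]
  · rw [map_smul, signA_fld, single_eq_smul_fld, smul_smul, mul_comm]

/-- A double sum of antisymmetric terms vanishes. -/
theorem sum_antisymm {W : Type*} [AddCommGroup W] [Module ℝ W] {A : Fin n → Fin n → W}
    (h : ∀ i j, A i j = -A j i) : ∑ i, ∑ j, A i j = 0 := by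
  have h1 : ∑ i, ∑ j, A i j = -∑ i, ∑ j, A i j := by
    conv_lhs => rw [Finset.sum_comm]
    rw [← Finset.sum_neg_distrib]
    refine Finset.sum_congr rfl fun i _ => ?_
    rw [← Finset.sum_neg_distrib]
    exact Finset.sum_congr rfl fun j _ => h j i
  have h2 : (2 : ℝ) • ∑ i, ∑ j, A i j = 0 := by
    rw [two_smul]
    nth_rewrite 1 [h1]
    exact neg_add_cancel _
  simpa using h2

theorem rhoL_mul_rhoL : rhoL par * rhoL par = (0 : Module.End ℝ (FieldSpan n I)) := by
  rw [rhoL_eq_sum, Finset.sum_mul]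
  simp only [Finset.mul_sum]
  refine sum_antisymm (W := Module.End ℝ (FieldSpan n I)) fun i j => ?_
  have key : ∀ i j : Fin n, signA par * lower i * wedge i * (signA par * lower j * wedge j) =
      lower i * lower j * (wedge i * wedge j : Module.End ℝ (FieldSpan n I)) := fun i j => by
    calc _ = signA par * lower i * (wedge i * signA par) * lower j * wedge j := by noncomm_ring
      _ = signA par * (lower i * signA par) * (wedge i * lower j) * wedge j := by
        rw [← (commute_signA_wedge par i).eq]; noncomm_ring
      _ = (signA par * signA par) * lower i * lower j * (wedge i * wedge j) := by
        rw [← (commute_signA_lower par i).eq, (commute_wedge_lower i j).eq]; noncomm_ring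
      _ = _ := by rw [signA_mul_self, one_mul]
  rw [key, key, wedge_mul_wedge, (commute_lower_lower i j).eq]
  refine LinearMap.ext fun u => ?_
  rw [Module.End.mul_apply, LinearMap.neg_apply, LinearMap.neg_apply, map_neg]
  rfl

/-- The homotopy formula for `σ^F` and `ρ^F`: in terms of bosonic operators `raise`, `lower` and
fermionic ones `wedge`, `contr`, the anticommutator is the total number operator. -/
theorem homotopy : sigmaL par * rhoL par + rhoL par * sigmaL par =
    ∑ i : Fin n, (raise i * lower i + wedge i * contr i : Module.End ℝ (FieldSpan n I)) := by
  rw [rhoL_eq_sum, sigmaL_eq_sum, Finset.sum_mul, Finset.sum_mul]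
  simp only [Finset.mul_sum]
  rw [Finset.sum_comm (f := fun i j : Fin n => signA par * lower i * wedge i *
    (signA par * raise j * contr j)), ← Finset.sum_add_distrib]
  refine Finset.sum_congr rfl fun i _ => ?_
  rw [← Finset.sum_add_distrib]
  have key1 : ∀ j : Fin n, signA par * raise i * contr i * (signA par * lower j * wedge j) =
      raise i * lower j * (contr i * wedge j : Module.End ℝ (FieldSpan n I)) := fun j => by
    calc _ = signA par * raise i * (contr i * signA par) * lower j * wedge j := by noncomm_ring
      _ = signA par * (raise i * signA par) * (contr i * lower j) * wedge j := by
        rw [← (commute_signA_contr par i).eq]; noncomm_ring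
      _ = (signA par * signA par) * raise i * lower j * (contr i * wedge j) := by
        rw [← (commute_signA_raise par i).eq, (commute_contr_lower i j).eq]; noncomm_ring
      _ = _ := by rw [signA_mul_self, one_mul]
  have key2 : ∀ j : Fin n, signA par * lower j * wedge j * (signA par * raise i * contr i) =
      lower j * raise i * (wedge j * contr i : Module.End ℝ (FieldSpan n I)) := fun j => by
    calc _ = signA par * lower j * (wedge j * signA par) * raise i * contr i := by noncomm_ring
      _ = signA par * (lower j * signA par) * (wedge j * raise i) * contr i := by
        rw [← (commute_signA_wedge par j).eq]; noncomm_ring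
      _ = (signA par * signA par) * lower j * raise i * (wedge j * contr i) := by
        rw [← (commute_signA_lower par j).eq, (commute_wedge_raise j i).eq]; noncomm_ring
      _ = _ := by rw [signA_mul_self, one_mul]
  have key : ∀ j : Fin n, signA par * raise i * contr i * (signA par * lower j * wedge j) +
      signA par * lower j * wedge j * (signA par * raise i * contr i) =
      if i = j then (raise i * lower i + wedge i * contr i : Module.End ℝ (FieldSpan n I))
        else 0 := fun j => by
    rw [key1, key2, lower_mul_raise, add_mul, ← add_assoc, ← mul_add, contr_mul_wedge_add]
    split_ifs with h
    · subst h; rw [mul_one, one_mul]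
    · rw [mul_zero, zero_mul, add_zero]
  rw [Finset.sum_congr rfl fun j _ => key j, Finset.sum_ite_eq, if_pos (Finset.mem_univ i)]

/-- The anticommutator of `σ^F` and `ρ^F` counts the symmetric and the skew indices. -/
theorem homotopy_fld : sigmaL par (rhoL par (fld a l N)) + rhoL par (sigmaL par (fld a l N)) =
    ((len l + N.card : ℕ) : ℝ) • fld a l N := by
  have h := LinearMap.congr_fun (homotopy par) (fld a l N)
  rw [LinearMap.add_apply, Module.End.mul_apply, Module.End.mul_apply, LinearMap.sum_apply] at h
  rw [h]
  have h1 : ∀ i : Fin n, (raise i * lower i + wedge i * contr i : Module.End ℝ (FieldSpan n I))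
      (fld a l N) = ((l i : ℝ) + if i ∈ N then 1 else 0) • fld a l N := fun i => by
    rw [LinearMap.add_apply, Module.End.mul_apply, Module.End.mul_apply, lower_fld, contr_fld,
      map_smul, raise_fld, add_smul]
    congr 1
    · rcases Nat.eq_zero_or_pos (l i) with h0 | h0
      · simp [h0]
      · congr 2
        funext k
        by_cases hk : k = i
        · subst hk; simp; omega
        · simp [hk]
    · split_ifs with hi
      · rw [map_smul, wedge_fld, if_neg (Finset.notMem_erase i N), eps_erase i i hi,
          if_neg (lt_irrefl i), one_mul, smul_smul, eps_mul_self, Finset.insert_erase hi]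
      · rw [map_zero, zero_smul]
  rw [Finset.sum_congr rfl fun i _ => h1 i, ← Finset.sum_smul, Finset.sum_add_distrib]
  congr 1
  simp [len]

end Parent

/-! ### The vector fields of the parent theory -/

namespace Parent

open SuperFun (sgn sgn_zero sgn_one sgn_add sgn_mul_self zmod_two_cases PreservesParity)
open LocalTheory LF SF

/-- The product of the `θ i`, `i ∈ N`, in increasing order. -/
def skewProd {n : ℕ} {R : Type*} [Monoid R] (θ : Fin n → R) (N : Finset (Fin n)) : R :=
  ((List.finRange n).map fun i => if i ∈ N then θ i else 1).prod

section SkewProd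

variable {n : ℕ} {R : Type*} [Ring R] [Algebra ℝ R] {θ : Fin n → R}

@[simp] theorem skewProd_empty {R : Type*} [Monoid R] {θ : Fin n → R} : skewProd θ ∅ = 1 := by
  simp [skewProd]

/-- Anticommuting `θ ν` to its place in the ordered product gives the sign `eps ν N`. -/
theorem mul_skewProd (hθ : ∀ i j, θ i * θ j = -(θ j * θ i)) {ν : Fin n} {N : Finset (Fin n)}
    (hν : ν ∉ N) : θ ν * skewProd θ N = eps ν N • skewProd θ (insert ν N) := by
  have key : ∀ l : List (Fin n), l.Pairwise (· < ·) → ν ∈ l →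
      θ ν * (l.map fun i => if i ∈ N then θ i else 1).prod =
      (l.map fun i => if i ∈ N ∧ i < ν then (-1 : ℝ) else 1).prod •
        (l.map fun i => if i ∈ insert ν N then θ i else 1).prod := by
    intro l
    induction l with
    | nil => intro _ h; simp at h
    | cons i l ih =>
      intro hl hmem
      rw [List.pairwise_cons] at hl
      simp only [List.map_cons, List.prod_cons]
      by_cases hi : i = ν
      · subst hi
        have h1 : (l.map fun j => if j ∈ N ∧ j < i then (-1 : ℝ) else 1).prod = 1 := by
          refine List.prod_eq_one fun x hx => ?_
          obtain ⟨j, hj, rfl⟩ := List.mem_map.1 hx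
          rw [if_neg fun h => (hl.1 j hj).not_gt h.2]
        have h2 : (l.map fun j => if j ∈ insert i N then θ j else 1) =
            l.map fun j => if j ∈ N then θ j else 1 := by
          refine List.map_congr_left fun j hj => ?_
          have : j ≠ i := (hl.1 j hj).ne'
          simp [this]
        rw [h1, h2, if_neg hν, if_neg fun h => hν h.1, if_pos (Finset.mem_insert_self i N), one_mul,
          mul_one, one_smul]
      · have hνl : ν ∈ l := (List.mem_cons.1 hmem).resolve_left fun h => hi h.symm
        have hlt : i < ν := hl.1 ν hνl
        have hins : i ∈ insert ν N ↔ i ∈ N := by simp [hi]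
        simp only [hins]
        by_cases hiN : i ∈ N
        · rw [if_pos hiN, if_pos ⟨hiN, hlt⟩, ← mul_assoc, hθ ν i, neg_mul, mul_assoc,
            ih hl.2 hνl, neg_one_mul, neg_smul, mul_smul_comm]
        · rw [if_neg hiN, if_neg fun h => hiN h.1, one_mul, one_mul, one_mul, ih hl.2 hνl]
  rw [skewProd, key _ (List.pairwise_lt_finRange n) (List.mem_finRange ν)]
  congr 1
  rw [← Fin.prod_univ_def, Finset.prod_ite, Finset.prod_const, Finset.prod_const_one, mul_one, eps]
  congr 2
  ext i
  simp

theorem skewProd_insert (hθ : ∀ i j, θ i * θ j = -(θ j * θ i)) {ν : Fin n} {N : Finset (Fin n)}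
    (hν : ν ∉ N) : skewProd θ (insert ν N) = eps ν N • (θ ν * skewProd θ N) := by
  rw [mul_skewProd hθ hν, smul_smul, eps_mul_self, one_smul]

theorem commute_skewProd {R : Type*} [Monoid R] {θ : Fin n → R} {a : R}
    (h : ∀ i, Commute a (θ i)) (N : Finset (Fin n)) : Commute a (skewProd θ N) := by
  refine Commute.list_prod_right _ _ fun x hx => ?_
  obtain ⟨i, -, rfl⟩ := List.mem_map.1 hx
  split_ifs
  exacts [h i, Commute.one_right a]

end SkewProd

/-- Local functions of the parent theory, as elements of `SF`. -/
abbrev PF {I : Type*} (n : ℕ) (par : I → ZMod 2) : Type _ := LF n (ppar par n)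

variable {n : ℕ} {I : Type*} (par : I → ZMod 2)

/-- `σ^F` as a linear operator. -/
noncomputable def sigE : Module.End ℝ (PF n par) :=
  evolL (ppar par n) fun f => linL (ppar par n) (sigmaRow par f)

/-- `d^F` as a linear operator. -/
noncomputable def dE : Module.End ℝ (PF n par) :=
  evolL (ppar par n) fun f => ∑ i ∈ f.2.2, (sgn (par f.1) * eps i f.2.2) •
    jt (ppar par n) (f.1, f.2.1, f.2.2.erase i) (Pi.single i 1)

/-- `∂^F/∂θ^ν` as a linear operator. -/
noncomputable def thE (ν : Fin n) : Module.End ℝ (PF n par) :=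
  evolL (ppar par n) fun f => linL (ppar par n) (thetaRow par ν f)

/-- `∂^F/∂y^κ` as a linear operator. -/
noncomputable def yE (κ : Fin n) : Module.End ℝ (PF n par) :=
  evolL (ppar par n) fun f => jt (ppar par n) (f.1, f.2.1 + Pi.single κ 1, f.2.2) 0

/-- `∂/∂x^κ + ∂^F/∂y^κ` as a linear operator. -/
noncomputable def yT (κ : Fin n) : Module.End ℝ (PF n par) :=
  D (jetPar (ppar par n) n) (Sum.inl κ) + yE par κ

/-- The vector field `∂_i - (∂/∂x^i + ∂^F/∂y^i)`. -/
noncomputable def xyE (i : Fin n) : Module.End ℝ (PF n par) := totL (ppar par n) i - yT par i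

/-- `d^F - σ^F`. -/
noncomputable def dsE : Module.End ℝ (PF n par) := dE par - sigE par

variable {par}

theorem ppar_erase {i : Fin n} (a : I) (l l' : Fin n → ℕ) {N : Finset (Fin n)} (hi : i ∈ N) :
    ppar par n (a, l', N.erase i) = ppar par n (a, l, N) + 1 := by
  have h : N.card = (N.erase i).card + 1 := (Finset.card_erase_add_one hi).symm
  simp only [ppar, h, Nat.cast_add, Nat.cast_one]
  rw [← add_assoc, add_assoc _ 1 1, show (1 : ZMod 2) + 1 = 0 from rfl, add_zero]

theorem ppar_insert {i : Fin n} (a : I) (l l' : Fin n → ℕ) {N : Finset (Fin n)} (hi : i ∉ N) :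
    ppar par n (a, l', insert i N) = ppar par n (a, l, N) + 1 := by
  simp only [ppar, Finset.card_insert_of_notMem hi, Nat.cast_add, Nat.cast_one, add_assoc]

theorem ppar_empty (a : I) (l : Fin n → ℕ) : ppar par n (a, l, ∅) = par a := by
  simp [ppar]

theorem linL_fld (a : I) (l : Fin n → ℕ) (N : Finset (Fin n)) :
    linL (n := n) (ppar par n) (fld a l N) = jt (ppar par n) (a, l, N) 0 := by
  rw [fld, linL_single, one_smul]

theorem sigE_jt (a : I) (l : Fin n → ℕ) (N : Finset (Fin n)) :
    sigE par (jt (ppar par n) (a, l, N) 0) = ∑ i ∈ N, (sgn (par a) * eps i N) •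
      jt (ppar par n) (a, l + Pi.single i 1, N.erase i) 0 := by
  rw [sigE, evolL_jt_zero, sigmaRow, map_sum]
  exact Finset.sum_congr rfl fun i _ => linL_single _ _

theorem dE_jt (a : I) (l : Fin n → ℕ) (N : Finset (Fin n)) :
    dE par (jt (ppar par n) (a, l, N) 0) = ∑ i ∈ N, (sgn (par a) * eps i N) •
      jt (ppar par n) (a, l, N.erase i) (Pi.single i 1) := by
  rw [dE, evolL_jt_zero]

theorem thE_jt (ν : Fin n) (a : I) (l : Fin n → ℕ) (N : Finset (Fin n)) :
    thE par ν (jt (ppar par n) (a, l, N) 0) = if ν ∈ N then 0 else (sgn (par a) * eps ν N) •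
      jt (ppar par n) (a, l, insert ν N) 0 := by
  rw [thE, evolL_jt_zero, thetaRow]
  split_ifs
  · rw [map_zero]
  · rw [linL_single]

theorem yE_jt (κ : Fin n) (f : PField n I) (m : Fin n → ℕ) :
    yE par κ (jt (ppar par n) f m) = jt (ppar par n) (f.1, f.2.1 + Pi.single κ 1, f.2.2) m := by
  rw [yE, evolL_jt, ← jt_eq_totP]

open scoped Classical in
theorem D_xx (κ μ : Fin n) : D (jetPar (ppar par n) n) (Sum.inl κ) (xx (ppar par n) μ) =
    if μ = κ then 1 else 0 := by
  rw [xx, D_co]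
  simp only [Sum.inl.injEq]

theorem D_jt (κ : Fin n) (f : PField n I) (m : Fin n → ℕ) :
    D (jetPar (ppar par n) n) (Sum.inl κ) (jt (ppar par n) f m) = 0 := by
  rw [jt, D_co, if_neg (by simp)]

theorem yT_jt (κ : Fin n) (f : PField n I) (m : Fin n → ℕ) :
    yT par κ (jt (ppar par n) f m) = jt (ppar par n) (f.1, f.2.1 + Pi.single κ 1, f.2.2) m := by
  rw [yT, LinearMap.add_apply, D_jt, yE_jt, zero_add]

theorem sigE_xx (μ : Fin n) : sigE par (xx (ppar par n) μ) = 0 := evolL_xx _ _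

theorem dE_xx (μ : Fin n) : dE par (xx (ppar par n) μ) = 0 := evolL_xx _ _

theorem dsE_xx (μ : Fin n) : dsE par (xx (ppar par n) μ) = 0 := by
  rw [dsE, LinearMap.sub_apply, sigE_xx, dE_xx, sub_zero]

theorem thE_xx (ν μ : Fin n) : thE par ν (xx (ppar par n) μ) = 0 := evolL_xx _ _

theorem yT_xx (κ μ : Fin n) : yT par κ (xx (ppar par n) μ) = if μ = κ then 1 else 0 := by
  rw [yT, LinearMap.add_apply, D_xx, yE, evolL_xx, add_zero]

theorem par_sigE (f : PField n I) :
    Par (ppar par n f + 1) (linL (n := n) (ppar par n) (sigmaRow par f)) := by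
  obtain ⟨a, l, N⟩ := f
  rw [sigmaRow, map_sum]
  refine Par.sum fun i hi => ?_
  rw [linL_single, ← ppar_erase a l (l + Pi.single i 1) hi]
  exact (par_jt _ _).smul _

theorem par_dE (f : PField n I) :
    Par (ppar par n f + 1) (∑ i ∈ f.2.2, (sgn (par f.1) * eps i f.2.2) •
      jt (ppar par n) (f.1, f.2.1, f.2.2.erase i) (Pi.single i 1)) := by
  obtain ⟨a, l, N⟩ := f
  refine Par.sum fun i hi => ?_
  rw [← ppar_erase a l l hi]
  exact (par_jt _ _).smul _

theorem par_thE (ν : Fin n) (f : PField n I) :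
    Par (ppar par n f + 1) (linL (n := n) (ppar par n) (thetaRow par ν f)) := by
  obtain ⟨a, l, N⟩ := f
  rw [thetaRow]
  split_ifs with h
  · rw [map_zero]; exact Par.zero
  · rw [linL_single, ← ppar_insert a l l h]
    exact (par_jt _ _).smul _

theorem par_yE (κ : Fin n) (f : PField n I) : Par (ppar par n f + 0)
    (jt (n := n) (ppar par n) (f.1, f.2.1 + Pi.single κ 1, f.2.2) 0) := by
  rw [add_zero]
  exact par_jt (par := ppar par n) (f.1, f.2.1 + Pi.single κ 1, f.2.2) 0

theorem isVF_sigE : IsVF 1 (sigE (n := n) par) := isVF_evolL par_sigE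

theorem isVF_dE : IsVF 1 (dE (n := n) par) := isVF_evolL par_dE

theorem isVF_dsE : IsVF 1 (dsE (n := n) par) := isVF_dE.sub isVF_sigE

theorem isVF_thE (ν : Fin n) : IsVF 1 (thE par ν) := isVF_evolL (par_thE ν)

theorem isVF_yE (κ : Fin n) : IsVF 0 (yE par κ) := isVF_evolL (par_yE κ)

theorem isVF_D_inl (κ : Fin n) : IsVF 0 (D (jetPar (ppar par n) n) (Sum.inl κ)) :=
  isVF_D (jetPar (ppar par n) n) (Sum.inl κ)

theorem isVF_yT (κ : Fin n) : IsVF 0 (yT par κ) := (isVF_D_inl κ).add (isVF_yE κ)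

theorem commute_sigE_totL (μ : Fin n) : Commute (sigE par) (totL (ppar par n) μ) :=
  commute_evolL par_sigE μ

theorem commute_dE_totL (μ : Fin n) : Commute (dE par) (totL (ppar par n) μ) :=
  commute_evolL par_dE μ

theorem commute_dsE_totL (μ : Fin n) : Commute (dsE par) (totL (ppar par n) μ) :=
  (commute_dE_totL μ).sub_left (commute_sigE_totL μ)

theorem commute_thE_totL (ν μ : Fin n) : Commute (thE par ν) (totL (ppar par n) μ) :=
  commute_evolL (par_thE ν) μ

theorem commute_D_totL (κ μ : Fin n) :
    Commute (D (jetPar (ppar par n) n) (Sum.inl κ)) (totL (ppar par n) μ) := by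
  refine commute_of_jet (isVF_D_inl κ) μ (fun ν => ?_) fun f m => ?_
  · rw [D_xx]
    split_ifs
    exacts [map_one_eq_zero (isVF_totL μ), map_zero _]
  · rw [D_jt, D_jt, map_zero]

theorem commute_yT_totL (κ μ : Fin n) : Commute (yT par κ) (totL (ppar par n) μ) :=
  (commute_D_totL κ μ).add_left (commute_evolL (par_yE κ) μ)

/-! ### Action on linear combinations of fields -/

theorem sigE_linL (u : FieldSpan n I) :
    sigE par (linL (ppar par n) u) = linL (ppar par n) (sigmaL par u) := by
  rw [sigE, evolL_linL, sigmaL, Finsupp.linearCombination_apply, Finsupp.linearCombination_apply,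
    Finsupp.sum, Finsupp.sum, map_sum]
  exact Finset.sum_congr rfl fun f _ => (map_smul _ _ _).symm

theorem thE_linL (ν : Fin n) (u : FieldSpan n I) :
    thE par ν (linL (ppar par n) u) = linL (ppar par n) (signA par (wedge ν u)) := by
  refine LinearMap.congr_fun (f := thE par ν ∘ₗ linL (ppar par n))
    (g := linL (ppar par n) ∘ₗ signA par ∘ₗ wedge ν) (end_ext fun a l N => ?_) u
  rw [LinearMap.comp_apply, LinearMap.comp_apply, LinearMap.comp_apply, linL_fld, thE,
    evolL_jt_zero, thetaRow_eq]
  rfl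

theorem yT_linL (κ : Fin n) (u : FieldSpan n I) :
    yT par κ (linL (ppar par n) u) = linL (ppar par n) (raise κ u) := by
  refine LinearMap.congr_fun (f := yT par κ ∘ₗ linL (ppar par n))
    (g := linL (ppar par n) ∘ₗ raise κ) (end_ext fun a l N => ?_) u
  rw [LinearMap.comp_apply, LinearMap.comp_apply, linL_fld, yT_jt, raise_fld, linL_fld]

theorem dE_linL (u : FieldSpan n I) : dE par (linL (ppar par n) u) =
    ∑ i, totL (ppar par n) i (linL (ppar par n) (signA par (contr i u))) := by
  have h := LinearMap.congr_fun (f := dE par ∘ₗ linL (ppar par n))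
    (g := ∑ i, totL (ppar par n) i ∘ₗ linL (ppar par n) ∘ₗ (signA par * contr i))
    (end_ext fun a l N => ?_) u
  · rw [LinearMap.sum_apply] at h
    exact h
  rw [LinearMap.comp_apply, LinearMap.sum_apply, linL_fld, dE_jt]
  simp only [LinearMap.comp_apply, Module.End.mul_apply, contr_fld]
  rw [← Finset.sum_filter_add_sum_filter_not Finset.univ (fun i => i ∈ N)]
  simp only [Finset.filter_univ_mem]
  rw [Finset.sum_eq_zero (s := Finset.univ.filter fun i => i ∉ N), add_zero]
  · refine Finset.sum_congr rfl fun i hi => ?_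
    rw [if_pos hi, map_smul, map_smul, map_smul, signA_fld, map_smul, map_smul, linL_fld, totL_jt,
      zero_add, smul_smul, mul_comm]
  · intro i hi
    rw [if_neg (Finset.mem_filter.1 hi).2, map_zero, map_zero, map_zero]

/-- On undifferentiated fields `d^F - σ^F` is, up to signs, the sum of the `∂_i - (∂/∂x^i + ∂^F/∂y^i)`
after contraction of the skew index `i`. -/
theorem dsE_linL (u : FieldSpan n I) : dsE par (linL (ppar par n) u) =
    ∑ i, xyE par i (linL (ppar par n) (signA par (contr i u))) := by
  rw [dsE, LinearMap.sub_apply, dE_linL, sigE_linL, sigmaL_eq_sum, LinearMap.sum_apply, map_sum,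
    ← Finset.sum_sub_distrib]
  refine Finset.sum_congr rfl fun i _ => ?_
  rw [xyE, LinearMap.sub_apply, yT_linL, (commute_signA_raise par i).eq]
  rfl

/-- Vector fields commuting with the total derivatives are determined by their values on `x` and on
the linear combinations of fields. -/
theorem ext_linL {ε δ : ZMod 2} {X Y : Module.End ℝ (PF n par)} (hX : IsVF ε X) (hY : IsVF δ Y)
    (hXt : ∀ μ, Commute X (totL (ppar par n) μ)) (hYt : ∀ μ, Commute Y (totL (ppar par n) μ))
    (hx : ∀ μ, X (xx _ μ) = Y (xx _ μ))
    (hu : ∀ u, X (linL (ppar par n) u) = Y (linL (ppar par n) u)) : X = Y := by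
  refine ext_tot hX hY hXt hYt hx fun f => ?_
  rw [← linL_fld]
  exact hu _

theorem commute_zero_totL (μ : Fin n) :
    Commute (0 : Module.End ℝ (PF n par)) (totL (ppar par n) μ) := Commute.zero_left _

theorem commute_yT_yT (κ μ : Fin n) : Commute (yT par κ) (yT par μ) := by
  refine sub_eq_zero.1 (ext_linL ((isVF_yT κ).comm_even (isVF_yT μ)) (IsVF.zero (ε := 0))
    (fun ν => ?_) commute_zero_totL (fun ν => ?_) fun u => ?_)
  · exact ((commute_yT_totL κ ν).mul_left (commute_yT_totL μ ν)).sub_left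
      ((commute_yT_totL μ ν).mul_left (commute_yT_totL κ ν))
  · rw [LinearMap.sub_apply, Module.End.mul_apply, Module.End.mul_apply, yT_xx, yT_xx]
    split_ifs <;> simp [map_one_eq_zero (isVF_yT _)]
  · rw [LinearMap.sub_apply, Module.End.mul_apply, Module.End.mul_apply, yT_linL, yT_linL, yT_linL,
      yT_linL, ← Module.End.mul_apply, (commute_raise_raise κ μ).eq, Module.End.mul_apply, sub_self,
      LinearMap.zero_apply]

theorem commute_yT_thE (κ ν : Fin n) : Commute (yT par κ) (thE par ν) := by
  refine sub_eq_zero.1 (ext_linL ((isVF_yT κ).comm_even (isVF_thE ν)) (IsVF.zero (ε := 0))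
    (fun μ => ?_) commute_zero_totL (fun μ => ?_) fun u => ?_)
  · exact ((commute_yT_totL κ μ).mul_left (commute_thE_totL ν μ)).sub_left
      ((commute_thE_totL ν μ).mul_left (commute_yT_totL κ μ))
  · rw [LinearMap.sub_apply, Module.End.mul_apply, Module.End.mul_apply, yT_xx, thE_xx]
    split_ifs <;> simp [map_one_eq_zero (isVF_thE ν)]
  · rw [LinearMap.sub_apply, Module.End.mul_apply, Module.End.mul_apply, thE_linL, yT_linL, yT_linL,
      thE_linL, ← Module.End.mul_apply (raise κ), ← (commute_signA_raise par κ).eq,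
      Module.End.mul_apply, ← Module.End.mul_apply (raise κ), ← (commute_wedge_raise ν κ).eq,
      Module.End.mul_apply, sub_self, LinearMap.zero_apply]

theorem thE_mul_thE (μ ν : Fin n) : thE par μ * thE par ν = -(thE par ν * thE par μ) := by
  refine eq_neg_of_add_eq_zero_left (ext_linL ((isVF_thE μ).anticomm (isVF_thE ν))
    (IsVF.zero (ε := 0)) (fun κ => ?_) commute_zero_totL (fun κ => ?_) fun u => ?_)
  · exact ((commute_thE_totL μ κ).mul_left (commute_thE_totL ν κ)).add_left
      ((commute_thE_totL ν κ).mul_left (commute_thE_totL μ κ))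
  · rw [LinearMap.add_apply, Module.End.mul_apply, Module.End.mul_apply, thE_xx, thE_xx, map_zero,
      map_zero, add_zero, LinearMap.zero_apply]
  · have key : ∀ i j : Fin n, signA par (wedge i (signA par (wedge j u))) =
        wedge i (wedge j u) := fun i j => by
      rw [← Module.End.mul_apply (wedge i) (signA par), ← (commute_signA_wedge par i).eq,
        Module.End.mul_apply, ← Module.End.mul_apply (signA par) (signA par), signA_mul_self,
        Module.End.one_apply]
    rw [LinearMap.add_apply, Module.End.mul_apply, Module.End.mul_apply, thE_linL, thE_linL,
      thE_linL, thE_linL, key, key, ← Module.End.mul_apply (wedge μ), wedge_mul_wedge,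
      LinearMap.neg_apply, Module.End.mul_apply, map_neg, neg_add_cancel, LinearMap.zero_apply]

/-- `d^F - σ^F` commutes with `∂/∂x^κ + ∂^F/∂y^κ`. -/
theorem commute_dsE_yT (κ : Fin n) : Commute (dsE par) (yT par κ) := by
  refine (sub_eq_zero.1 (ext_linL ((isVF_yT κ).comm_even isVF_dsE) (IsVF.zero (ε := 0))
    (fun μ => ?_) commute_zero_totL (fun μ => ?_) fun u => ?_)).symm
  · exact ((commute_yT_totL κ μ).mul_left (commute_dsE_totL μ)).sub_left
      ((commute_dsE_totL μ).mul_left (commute_yT_totL κ μ))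
  · rw [LinearMap.sub_apply, Module.End.mul_apply, Module.End.mul_apply, yT_xx, dsE_xx]
    split_ifs <;> simp [map_one_eq_zero isVF_dsE]
  · rw [LinearMap.sub_apply, Module.End.mul_apply, Module.End.mul_apply, yT_linL, dsE_linL,
      dsE_linL, map_sum, ← Finset.sum_sub_distrib, LinearMap.zero_apply]
    refine Finset.sum_eq_zero fun i _ => ?_
    have hc : Commute (yT par κ) (xyE par i) :=
      (commute_yT_totL κ i).sub_right (commute_yT_yT κ i)
    rw [← Module.End.mul_apply (yT par κ), hc.eq, Module.End.mul_apply, yT_linL,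
      ← Module.End.mul_apply (raise κ), ← (commute_signA_raise par κ).eq, Module.End.mul_apply,
      ← Module.End.mul_apply (raise κ), ← (commute_contr_raise i κ).eq, Module.End.mul_apply,
      sub_self]

theorem signA_mul_signA_mul {X Y : Module.End ℝ (FieldSpan n I)} (hX : Commute (signA par) X)
    (u : FieldSpan n I) : signA par (X (signA par (Y u))) = X (Y u) := by
  rw [← Module.End.mul_apply X (signA par), ← hX.eq, Module.End.mul_apply,
    ← Module.End.mul_apply (signA par) (signA par), signA_mul_self, Module.End.one_apply]

theorem dsE_mul_self : dsE par * dsE par = (0 : Module.End ℝ (PF n par)) := by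
  refine ext_linL isVF_dsE.sq (IsVF.zero (ε := 0)) (fun μ => ?_) commute_zero_totL (fun μ => ?_)
    fun u => ?_
  · exact (commute_dsE_totL μ).mul_left (commute_dsE_totL μ)
  · rw [Module.End.mul_apply, dsE_xx, map_zero, LinearMap.zero_apply]
  · have hc : ∀ i : Fin n, Commute (dsE par) (xyE par i) := fun i =>
      (commute_dsE_totL i).sub_right (commute_dsE_yT i)
    rw [Module.End.mul_apply, dsE_linL, map_sum, LinearMap.zero_apply]
    have h1 : ∀ i : Fin n, dsE par (xyE par i
        (linL (ppar par n) (signA par (contr i u)))) =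
        ∑ j, xyE par i (xyE par j
          (linL (ppar par n) (contr j (contr i u)))) := fun i => by
      rw [← Module.End.mul_apply (dsE par), (hc i).eq, Module.End.mul_apply, dsE_linL, map_sum]
      refine Finset.sum_congr rfl fun j _ => ?_
      rw [signA_mul_signA_mul (commute_signA_contr par j)]
    rw [Finset.sum_congr rfl fun i _ => h1 i]
    refine sum_antisymm fun i j => ?_
    have hT : Commute (xyE par i) (xyE par j) :=
      ((commute_totL i j).sub_right (commute_yT_totL j i).symm).sub_left
        ((commute_yT_totL i j).sub_right (commute_yT_yT i j))
    rw [← Module.End.mul_apply (xyE par i), hT.eq, Module.End.mul_apply,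
      ← Module.End.mul_apply (contr j), contr_mul_contr, LinearMap.neg_apply, map_neg, map_neg,
      map_neg, Module.End.mul_apply]

/-- The graded commutator of `d^F - σ^F` with `∂^F/∂θ^ν` is `∂_ν - (∂/∂x^ν + ∂^F/∂y^ν)`, which
commutes with `s̄`. -/
theorem dsE_thE (ν : Fin n) :
    dsE par * thE par ν + thE par ν * dsE par = xyE par ν := by
  refine ext_linL (isVF_dsE.anticomm (isVF_thE ν)) ((isVF_totL ν).sub (isVF_yT ν)) (fun μ => ?_)
    (fun μ => ?_) (fun μ => ?_) fun u => ?_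
  · exact ((commute_dsE_totL μ).mul_left (commute_thE_totL ν μ)).add_left
      ((commute_thE_totL ν μ).mul_left (commute_dsE_totL μ))
  · exact (commute_totL ν μ).sub_left (commute_yT_totL ν μ)
  · rw [LinearMap.add_apply, Module.End.mul_apply, Module.End.mul_apply, thE_xx, dsE_xx, map_zero,
      map_zero, xyE, LinearMap.sub_apply, totL_xx, yT_xx, sub_self, add_zero]
  · have hc : ∀ i, Commute (thE par ν) (xyE par i) := fun i =>
      (commute_thE_totL ν i).sub_right (commute_yT_thE i ν).symm
    rw [LinearMap.add_apply, Module.End.mul_apply, Module.End.mul_apply, thE_linL, dsE_linL,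
      dsE_linL, map_sum, ← Finset.sum_add_distrib]
    have h1 : ∀ i : Fin n, xyE par i (linL (ppar par n)
        (signA par (contr i (signA par (wedge ν u))))) +
        thE par ν (xyE par i (linL (ppar par n) (signA par (contr i u)))) =
        if i = ν then xyE par ν (linL (ppar par n) u) else 0 := fun i => by
      rw [← Module.End.mul_apply (thE par ν), (hc i).eq, Module.End.mul_apply, thE_linL,
        signA_mul_signA_mul (commute_signA_contr par i),
        signA_mul_signA_mul (commute_signA_wedge par ν), ← map_add, ← map_add,
        ← Module.End.mul_apply (contr i), ← Module.End.mul_apply (wedge ν), ← LinearMap.add_apply,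
        contr_mul_wedge_add]
      split_ifs with h
      · subst h; rfl
      · rw [LinearMap.zero_apply, map_zero, map_zero]
    rw [Finset.sum_congr rfl fun i _ => h1 i, Finset.sum_ite_eq', if_pos (Finset.mem_univ ν)]

end Parent

/-! ### The extension of the original differential -/

namespace Parent

open SuperFun (sgn sgn_zero sgn_one sgn_add sgn_mul_self zmod_two_cases PreservesParity)
open LocalTheory LF SF

variable {n : ℕ} {I : Type*} {par : I → ZMod 2}

variable (par) in
/-- Replacement of the `x`-derivatives of the original fields by `y`-derivatives. -/
noncomputable def toYL (n : ℕ) : LF n par →ₐ[ℝ] PF n par :=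
  fsub par (ppar par n) fun a m => Finsupp.single ((a, m, ∅), 0) 1

theorem fieldParity_toY :
    FieldParity (n := n) par (ppar par n) fun a m => Finsupp.single ((a, m, ∅), 0) 1 := by
  intro a m q hq
  rw [Finset.mem_singleton.1 (Finsupp.support_single_subset hq)]
  exact ppar_empty a m

theorem toYL_jt (a : I) (m : Fin n → ℕ) : toYL par n (jt par a m) = jt (ppar par n) (a, m, ∅) 0 := by
  refine (fsub_jt fieldParity_toY a m).trans ?_
  rw [linJ_single, one_smul]

theorem par_toYL {b : ZMod 2} {G : LF n par} (h : Par b G) : Par b (toYL par n G) := h.subst _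

theorem toYL_intertwine {ε δ : ZMod 2} {X : Module.End ℝ (LF n par)} {Y : Module.End ℝ (PF n par)}
    (hX : IsVF ε X) (hY : IsVF δ Y) (hx : ∀ μ, toYL par n (X (xx par μ)) = Y (xx (ppar par n) μ))
    (hj : ∀ a m, toYL par n (X (jt par a m)) = Y (jt (ppar par n) (a, m, ∅) 0)) (G : LF n par) :
    toYL par n (X G) = Y (toYL par n G) := by
  refine fsub_intertwine fieldParity_toY hX hY hx (fun a m => ?_) G
  rw [linJ_single, one_smul]
  exact hj a m

theorem toYL_totL (μ : Fin n) (G : LF n par) :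
    toYL par n (totL par μ G) = yT par μ (toYL par n G) := by
  refine toYL_intertwine (isVF_totL μ) (isVF_yT μ) (fun κ => ?_) (fun a m => ?_) G
  · rw [totL_xx, yT_xx]
    split_ifs
    exacts [map_one _, map_zero _]
  · rw [totL_jt, toYL_jt, yT_jt]

/-- `d^F - σ^F` annihilates the fields without skew indices and their functions. -/
theorem dsE_toYL (G : LF n par) : dsE par (toYL par n G) = 0 := by
  have h := toYL_intertwine (IsVF.zero (ε := 0)) isVF_dsE (X := 0) (Y := dsE par) (fun κ => ?_)
    (fun a m => ?_) G
  · rw [← h, LinearMap.zero_apply, map_zero]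
  · rw [dsE_xx, LinearMap.zero_apply, map_zero]
  · rw [LinearMap.zero_apply, map_zero, dsE, LinearMap.sub_apply, dE_jt, sigE_jt, Finset.sum_empty,
      Finset.sum_empty, sub_zero]

/-- The iterated operators `∂/∂x + ∂^F/∂y`. -/
noncomputable def yP (par : I → ZMod 2) (l : Fin n → ℕ) : Module.End ℝ (PF n par) :=
  famPow (yT par) l

theorem yP_add_single (l : Fin n → ℕ) (κ : Fin n) :
    yP par (l + Pi.single κ 1) = yT par κ * yP par l :=
  famPow_add_single commute_yT_yT l κ

@[simp] theorem yP_zero : yP par (0 : Fin n → ℕ) = 1 := famPow_zero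

theorem toYL_totP (m : Fin n → ℕ) (G : LF n par) :
    toYL par n (totP par m G) = yP par m (toYL par n G) := by
  induction m using multiIndex_induction with
  | zero => simp
  | step m μ ih =>
    rw [totP_add_single, Module.End.mul_apply, toYL_totL, ih, yP_add_single, Module.End.mul_apply]

theorem jt_insert {ν : Fin n} (a : I) (l : Fin n → ℕ) {N : Finset (Fin n)} (hν : ν ∉ N) :
    jt (ppar par n) (a, l, insert ν N) 0 =
      (sgn (par a) * eps ν N) • thE par ν (jt (ppar par n) (a, l, N) 0) := by
  rw [thE_jt, if_neg hν, smul_smul, mul_mul_mul_comm, sgn_mul_self, eps_mul_self, one_mul,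
    one_smul]

/-- An operator that commutes with `∂_μ` and `∂/∂x + ∂^F/∂y`, and with `∂^F/∂θ` up to a constant
factor, is determined on the jet coordinates by its values on the original fields. -/
theorem apply_jt_eq {X Y : Module.End ℝ (PF n par)} (c : ℝ)
    (hXt : ∀ μ G, X (totL (ppar par n) μ G) = totL (ppar par n) μ (X G))
    (hYt : ∀ μ G, Y (totL (ppar par n) μ G) = totL (ppar par n) μ (Y G))
    (hXθ : ∀ ν G, X (thE par ν G) = c • thE par ν (X G))
    (hYθ : ∀ ν G, Y (thE par ν G) = c • thE par ν (Y G))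
    (hXy : ∀ κ G, X (yT par κ G) = yT par κ (X G)) (hYy : ∀ κ G, Y (yT par κ G) = yT par κ (Y G))
    (hj : ∀ a, X (jt (ppar par n) (a, 0, ∅) 0) = Y (jt (ppar par n) (a, 0, ∅) 0))
    (f : PField n I) (m : Fin n → ℕ) : X (jt (ppar par n) f m) = Y (jt (ppar par n) f m) := by
  obtain ⟨a, l, N⟩ := f
  induction m using multiIndex_induction with
  | step m μ ih => rw [← totL_jt, hXt, hYt, ih]
  | zero =>
    induction N using Finset.induction with
    | insert ν N hν ih => rw [jt_insert a l hν, map_smul, map_smul, hXθ, hYθ, ih]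
    | empty =>
      induction l using multiIndex_induction with
      | zero => exact hj a
      | step l κ ih =>
        have h := yT_jt (par := par) κ (a, l, ∅) 0
        dsimp only at h
        rw [← h, hXy, hYy, ih]

/-- The components `s̄ Ψ^a_{(l)[N]}`: the operators that create the indices are applied to `S^a`. Each
`∂^F/∂θ` creates its index with the sign `(-1)^{|a|}` and anticommutes with `s̄`, which accounts for
the factor `-(-1)^{|a|}` per skew index. -/
noncomputable def sbChar (S : I → LF n par) (f : PField n I) : PF n par :=
  (-sgn (par f.1)) ^ f.2.2.card • skewProd (thE par) f.2.2 (yP par f.2.1 (toYL par n (S f.1)))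

/-- The vector field `s̄`. -/
noncomputable def sbE (S : I → LF n par) : Module.End ℝ (PF n par) :=
  evolL (ppar par n) (sbChar S)

section SBar

variable {S : I → LF n par}

theorem sbChar_base (a : I) : sbChar S (a, 0, ∅) = toYL par n (S a) := by
  simp [sbChar]

theorem sbChar_empty (a : I) (l : Fin n → ℕ) :
    sbChar S (a, l, ∅) = yP par l (toYL par n (S a)) := by
  simp [sbChar]

theorem sbChar_add_single (a : I) (l : Fin n → ℕ) (N : Finset (Fin n)) (κ : Fin n) :
    sbChar S (a, l + Pi.single κ 1, N) = yT par κ (sbChar S (a, l, N)) := by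
  have hc : Commute (yT par κ) (skewProd (thE par) N) :=
    commute_skewProd (fun ν => commute_yT_thE κ ν) N
  simp only [sbChar]
  rw [map_smul, yP_add_single, Module.End.mul_apply]
  congr 1
  exact (LinearMap.congr_fun hc.eq _).symm

theorem thE_sbChar {ν : Fin n} (a : I) (l : Fin n → ℕ) {N : Finset (Fin n)} (hν : ν ∉ N) :
    thE par ν (sbChar S (a, l, N)) = (-(sgn (par a) * eps ν N)) • sbChar S (a, l, insert ν N) := by
  simp only [sbChar]
  rw [map_smul, ← Module.End.mul_apply (thE par ν), mul_skewProd thE_mul_thE hν,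
    Finset.card_insert_of_notMem hν, LinearMap.smul_apply, smul_smul, smul_smul]
  congr 1
  have h := sgn_mul_self (par a)
  generalize sgn (par a) = s at *
  rw [pow_succ]
  linear_combination (-eps ν N * (-s) ^ N.card) * h

theorem thE_sbChar_of_mem {ν : Fin n} (a : I) (l : Fin n → ℕ) {N : Finset (Fin n)} (hν : ν ∈ N) :
    thE par ν (sbChar S (a, l, N)) = 0 := by
  have h0 : thE par ν * thE par ν = 0 := by
    have h := thE_mul_thE (par := par) ν ν
    rwa [eq_neg_iff_add_eq_zero, ← two_smul ℝ, smul_eq_zero_iff_right two_ne_zero] at h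
  rw [← Finset.insert_erase hν]
  simp only [sbChar]
  rw [map_smul, ← Module.End.mul_apply (thE par ν),
    skewProd_insert thE_mul_thE (Finset.notMem_erase ν N), mul_smul_comm, ← mul_assoc, h0, zero_mul,
    smul_zero, LinearMap.zero_apply, smul_zero]

theorem par_yP {b : ZMod 2} {G : PF n par} (hG : Par b G) (l : Fin n → ℕ) :
    Par b (yP par l G) := by
  induction l using multiIndex_induction with
  | zero => simpa using hG
  | step m μ ih =>
    rw [yP_add_single, Module.End.mul_apply]
    simpa using (isVF_yT μ).map_parity ih

/-- A vector field that commutes with `∂_μ`, `∂/∂x + ∂^F/∂y` and, up to a constant factor, with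
`∂^F/∂θ`, and that annihilates `x` and the original fields, is zero. -/
theorem eq_zero_of_commute {ε : ZMod 2} {X : Module.End ℝ (PF n par)} (hX : IsVF ε X) (c : ℝ)
    (ht : ∀ μ, Commute X (totL (ppar par n) μ)) (hθ : ∀ ν, X * thE par ν = c • (thE par ν * X))
    (hy : ∀ κ, Commute X (yT par κ)) (hx : ∀ μ, X (xx (ppar par n) μ) = 0)
    (hj : ∀ a, X (jt (ppar par n) (a, 0, ∅) 0) = 0) : X = 0 := by
  refine ext_jet hX (IsVF.zero (ε := 0)) hx fun f m => ?_
  refine apply_jt_eq c (fun μ => LinearMap.congr_fun (ht μ).eq) (fun μ G => ?_)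
    (fun ν => LinearMap.congr_fun (hθ ν)) (fun ν G => ?_) (fun κ => LinearMap.congr_fun (hy κ).eq)
    (fun κ G => ?_) hj f m
  · rw [LinearMap.zero_apply, LinearMap.zero_apply, map_zero]
  · rw [LinearMap.zero_apply, LinearMap.zero_apply, map_zero, smul_zero]
  · rw [LinearMap.zero_apply, LinearMap.zero_apply, map_zero]

variable (hpar : ∀ a, Par (par a + 1) (S a))
include hpar

theorem par_sbChar (f : PField n I) : Par (ppar par n f + 1) (sbChar S f) := by
  obtain ⟨a, l, N⟩ := f
  refine Par.smul ?_ _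
  dsimp only
  induction N using Finset.induction with
  | empty =>
    rw [skewProd_empty, ppar_empty]
    exact par_yP (par_toYL (hpar a)) l
  | insert ν N hν ih =>
    rw [skewProd_insert thE_mul_thE hν, LinearMap.smul_apply, Module.End.mul_apply]
    have h := ((isVF_thE ν).map_parity ih).smul (eps ν N)
    rwa [ppar_insert a l l hν]

theorem isVF_sbE : IsVF 1 (sbE S) := isVF_evolL (par_sbChar hpar)

theorem commute_sbE_totL (μ : Fin n) : Commute (sbE S) (totL (ppar par n) μ) :=
  commute_evolL (par_sbChar hpar) μ

theorem commute_sbE_yT (κ : Fin n) : Commute (sbE S) (yT par κ) := by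
  refine (sub_eq_zero.1 (ext_tot ((isVF_yT κ).comm_even (isVF_sbE hpar)) (IsVF.zero (ε := 0))
    (fun μ => ?_) commute_zero_totL (fun μ => ?_) ?_)).symm
  · exact ((commute_yT_totL κ μ).mul_left (commute_sbE_totL hpar μ)).sub_left
      ((commute_sbE_totL hpar μ).mul_left (commute_yT_totL κ μ))
  · rw [LinearMap.sub_apply, Module.End.mul_apply, Module.End.mul_apply, yT_xx, sbE, evolL_xx]
    split_ifs <;> simp [← sbE.eq_def, map_one_eq_zero (isVF_sbE hpar)]
  · rintro ⟨a, l, N⟩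
    rw [LinearMap.sub_apply, Module.End.mul_apply, Module.End.mul_apply, yT_jt, sbE, evolL_jt_zero,
      evolL_jt_zero, sbChar_add_single, sub_self, LinearMap.zero_apply]

theorem sbE_mul_thE (ν : Fin n) : sbE S * thE par ν = -(thE par ν * sbE S) := by
  refine eq_neg_of_add_eq_zero_left (ext_tot ((isVF_sbE hpar).anticomm (isVF_thE ν))
    (IsVF.zero (ε := 0)) (fun μ => ?_) commute_zero_totL (fun μ => ?_) ?_)
  · exact ((commute_sbE_totL hpar μ).mul_left (commute_thE_totL ν μ)).add_left
      ((commute_thE_totL ν μ).mul_left (commute_sbE_totL hpar μ))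
  · rw [LinearMap.add_apply, Module.End.mul_apply, Module.End.mul_apply, thE_xx, sbE, evolL_xx,
      map_zero, map_zero, add_zero, LinearMap.zero_apply]
  · rintro ⟨a, l, N⟩
    rw [LinearMap.add_apply, Module.End.mul_apply, Module.End.mul_apply, thE_jt, sbE, evolL_jt_zero,
      LinearMap.zero_apply]
    split_ifs with hν
    · rw [map_zero, thE_sbChar_of_mem a l hν, add_zero]
    · rw [map_smul, evolL_jt_zero, thE_sbChar a l hν, neg_smul, add_neg_cancel]

theorem sbE_toYL (G : LF n par) : sbE S (toYL par n G) = toYL par n (evolL par S G) := by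
  refine (toYL_intertwine (isVF_evolL hpar) (isVF_sbE hpar) (fun μ => ?_) (fun a m => ?_) G).symm
  · rw [evolL_xx, sbE, evolL_xx, map_zero]
  · rw [evolL_jt, sbE, evolL_jt_zero, sbChar_empty, toYL_totP]

variable (hnil : ∀ a, evolL par S (S a) = 0)

include hnil in
theorem sbE_mul_self : sbE S * sbE S = 0 := by
  refine eq_zero_of_commute (isVF_sbE hpar).sq 1
    (fun μ => (commute_sbE_totL hpar μ).mul_left (commute_sbE_totL hpar μ)) (fun ν => ?_)
    (fun κ => (commute_sbE_yT hpar κ).mul_left (commute_sbE_yT hpar κ)) (fun μ => ?_) fun a => ?_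
  · rw [one_smul, mul_assoc, sbE_mul_thE hpar, mul_neg, ← mul_assoc, sbE_mul_thE hpar, neg_mul,
      neg_neg, mul_assoc]
  · rw [Module.End.mul_apply, sbE, evolL_xx, map_zero]
  · have h : sbE S (jt (ppar par n) (a, 0, ∅) 0) = toYL par n (S a) := by
      rw [sbE, evolL_jt_zero, sbChar_base]
    rw [Module.End.mul_apply, h, sbE_toYL hpar, hnil, map_zero]

theorem sbE_dsE : dsE par * sbE S + sbE S * dsE par = 0 := by
  refine eq_zero_of_commute (isVF_dsE.anticomm (isVF_sbE hpar)) 1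
    (fun μ => ((commute_dsE_totL μ).mul_left (commute_sbE_totL hpar μ)).add_left
      ((commute_sbE_totL hpar μ).mul_left (commute_dsE_totL μ))) (fun ν => ?_)
    (fun κ => ((commute_dsE_yT κ).mul_left (commute_sbE_yT hpar κ)).add_left
      ((commute_sbE_yT hpar κ).mul_left (commute_dsE_yT κ))) (fun μ => ?_) fun a => ?_
  · -- the graded Jacobi identity
    have h1 : dsE par * thE par ν = xyE par ν - thE par ν * dsE par :=
      eq_sub_of_add_eq (dsE_thE ν)
    have h2 : sbE S * xyE par ν = xyE par ν * sbE S :=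
      ((commute_sbE_totL hpar ν).sub_right (commute_sbE_yT hpar ν)).eq
    have h3 := sbE_mul_thE hpar ν
    rw [one_smul]
    generalize dsE par = D, sbE S = s, thE par ν = θ, xyE par ν = x at *
    rw [add_mul, mul_assoc, mul_assoc, h3, h1, mul_neg, ← mul_assoc D, h1, mul_sub, h2,
      ← mul_assoc s, h3]
    noncomm_ring
  · rw [LinearMap.add_apply, Module.End.mul_apply, Module.End.mul_apply, dsE_xx, sbE, evolL_xx,
      map_zero, map_zero, add_zero]
  · have h : sbE S (jt (ppar par n) (a, 0, ∅) 0) = toYL par n (S a) := by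
      rw [sbE, evolL_jt_zero, sbChar_base]
    rw [LinearMap.add_apply, Module.End.mul_apply, Module.End.mul_apply, h, dsE_toYL,
      ← toYL_jt, dsE_toYL, map_zero, add_zero]

/-- The parent differential `s^P`. -/
noncomputable def spE (S : I → LF n par) : Module.End ℝ (PF n par) := dsE par + sbE S

theorem isVF_spE : IsVF 1 (spE S) := isVF_dsE.add (isVF_sbE hpar)

theorem commute_spE_totL (μ : Fin n) : Commute (spE S) (totL (ppar par n) μ) :=
  (commute_dsE_totL μ).add_left (commute_sbE_totL hpar μ)

include hnil in
theorem spE_mul_self : spE S * spE S = 0 := by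
  have h1 := dsE_mul_self (n := n) (par := par)
  have h2 := sbE_mul_self hpar hnil
  have h3 := sbE_dsE hpar
  calc spE S * spE S = dsE par * dsE par + (dsE par * sbE S + sbE S * dsE par) +
        sbE S * sbE S := by rw [spE]; noncomm_ring
    _ = 0 := by rw [h1, h2, h3]; simp

end SBar

end Parent

/-! ### Existence and uniqueness of the extension -/

namespace Parent

open SuperFun (sgn sgn_zero sgn_one sgn_add sgn_mul_self zmod_two_cases PreservesParity)
open LocalTheory LF SF

variable {n : ℕ} {I : Type*} {par : I → ZMod 2}

theorem sigE_apply (G : PF n par) : sigE par G = sigmaF par G := evolL_apply _ _ _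

theorem dE_apply (G : PF n par) : dE par G = dF par G := evolL_apply _ _ _

theorem thE_apply (ν : Fin n) (G : PF n par) : thE par ν G = thetaF par ν G := evolL_apply _ _ _

theorem yE_apply (κ : Fin n) (G : PF n par) : yE par κ G = yF par κ G := evolL_apply _ _ _

theorem yT_apply (κ : Fin n) (G : PF n par) : yT par κ G = yTot par κ G := by
  rw [yT, LinearMap.add_apply, yE_apply]
  rfl

/-- The components of `s̄` with respect to the jet coordinates. -/
noncomputable def sbQ (S : I → LF n par) : Jet n (PField n I) → PF n par :=
  Sum.elim (fun _ => 0) (fun q => totP (ppar par n) q.2 (sbChar S q.1))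

theorem sP_sbQ (S : I → LF n par) (G : PF n par) : sP par (sbQ S) G = spE S G := by
  rw [spE, dsE, LinearMap.add_apply, LinearMap.sub_apply, dE_apply, sigE_apply]
  rfl

section

variable {S : I → LF n par} (hpar : ∀ a, Par (par a + 1) (S a))
include hpar

theorem isSBar_sbQ : IsSBar par S (sbQ S) where
  x_zero _ := rfl
  base a := by
    change totP (ppar par n) 0 (sbChar S (a, 0, ∅)) = toYL par n (S a)
    rw [totP_zero, sbChar_base]
    rfl
  comm_tot μ G := LinearMap.congr_fun (commute_sbE_totL hpar μ).eq G
  comm_theta ν G := (congrArg (sbE S) (thE_apply ν G)).symm.trans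
    ((LinearMap.congr_fun (sbE_mul_thE hpar ν) G).trans (congrArg Neg.neg (thE_apply ν (sbE S G))))
  comm_y κ G := (congrArg (sbE S) (yT_apply κ G)).symm.trans
    ((LinearMap.congr_fun (commute_sbE_yT hpar κ).eq G).trans (yT_apply κ (sbE S G)))

theorem eq_sbQ_of_isSBar {Q : Jet n (PField n I) → PF n par} (hQ : IsSBar par S Q) :
    Q = sbQ S := by
  funext v
  rcases v with μ | ⟨f, m⟩
  · exact hQ.x_zero μ
  · have h := apply_jt_eq (X := vfL (jetPar (ppar par n) n) Q) (Y := sbE S) (-1) hQ.comm_tot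
      (fun μ => LinearMap.congr_fun (commute_sbE_totL hpar μ).eq) (fun ν G => ?_) (fun ν G => ?_)
      (fun κ G => ?_) (fun κ => LinearMap.congr_fun (commute_sbE_yT hpar κ).eq) (fun a => ?_) f m
    · have h1 := vfL_co Q (Sum.inr (f, m))
      have h2 := vfL_co (sbQ S) (Sum.inr (f, m))
      exact h1.symm.trans (h.trans h2)
    · rw [neg_one_smul]
      exact (congrArg (vfL _ Q) (thE_apply ν G)).trans ((hQ.comm_theta ν G).trans
        (congrArg Neg.neg (thE_apply ν (vfL _ Q G)).symm))
    · rw [neg_one_smul]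
      exact LinearMap.congr_fun (sbE_mul_thE hpar ν) G
    · exact (congrArg (vfL _ Q) (yT_apply κ G)).trans ((hQ.comm_y κ G).trans
        (yT_apply κ (vfL _ Q G)).symm)
    · rw [sbE, evolL_jt_zero, sbChar_base]
      exact (vfL_co Q (Sum.inr ((a, 0, ∅), 0))).trans (hQ.base a)

end

/-! ### Restriction to the surface -/

theorem fieldParity_restrict : FieldParity (n := n) (ppar par n) par fun f m =>
    if f.2.2 = ∅ then Finsupp.single (f.1, f.2.1 + m) 1 else 0 := by
  rintro ⟨a, l, N⟩ m q hq
  dsimp only at hq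
  split_ifs at hq with h
  · rw [Finset.mem_singleton.1 (Finsupp.support_single_subset hq), h, ppar_empty]
  · simp at hq

theorem fieldParity_incl : FieldParity (n := n) par (ppar par n) fun a m =>
    Finsupp.single ((a, 0, ∅), m) 1 := by
  intro a m q hq
  rw [Finset.mem_singleton.1 (Finsupp.support_single_subset hq), ppar_empty]

variable (par) in
/-- Restriction to the surface. -/
noncomputable def resL (n : ℕ) : PF n par →ₐ[ℝ] LF n par :=
  fsub (ppar par n) par fun f m => if f.2.2 = ∅ then Finsupp.single (f.1, f.2.1 + m) 1 else 0

variable (par) in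
/-- The original fields as fields of the parent theory. -/
noncomputable def incL (n : ℕ) : LF n par →ₐ[ℝ] PF n par :=
  fsub par (ppar par n) fun a m => Finsupp.single ((a, 0, ∅), m) 1

theorem resL_jt (f : PField n I) (m : Fin n → ℕ) : resL par n (jt (ppar par n) f m) =
    if f.2.2 = ∅ then jt par f.1 (f.2.1 + m) else 0 := by
  refine (fsub_jt fieldParity_restrict f m).trans ?_
  split_ifs
  · rw [linJ_single, one_smul]
  · rw [map_zero]

theorem incL_jt (a : I) (m : Fin n → ℕ) :
    incL par n (jt par a m) = jt (ppar par n) (a, 0, ∅) m := by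
  refine (fsub_jt fieldParity_incl a m).trans ?_
  rw [linJ_single, one_smul]

theorem resL_intertwine {ε δ : ZMod 2} {X : Module.End ℝ (PF n par)} {Y : Module.End ℝ (LF n par)}
    (hX : IsVF ε X) (hY : IsVF δ Y) (hx : ∀ μ, resL par n (X (xx (ppar par n) μ)) = Y (xx par μ))
    (hj : ∀ f m, resL par n (X (jt (ppar par n) f m)) = Y (resL par n (jt (ppar par n) f m)))
    (G : PF n par) : resL par n (X G) = Y (resL par n G) := by
  refine fsub_intertwine fieldParity_restrict hX hY hx (fun f m => ?_) G
  rw [← fsub_jt fieldParity_restrict]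
  exact hj f m

theorem resL_totL (μ : Fin n) (G : PF n par) :
    resL par n (totL (ppar par n) μ G) = totL par μ (resL par n G) := by
  refine resL_intertwine (isVF_totL μ) (isVF_totL μ) (fun κ => ?_) (fun f m => ?_) G
  · rw [totL_xx, totL_xx]
    split_ifs
    exacts [map_one _, map_zero _]
  · rw [totL_jt, resL_jt, resL_jt]
    split_ifs
    · rw [totL_jt, add_assoc]
    · rw [map_zero]

theorem resL_totP (m : Fin n → ℕ) (G : PF n par) :
    resL par n (totP (ppar par n) m G) = totP par m (resL par n G) := by
  induction m using multiIndex_induction with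
  | zero => simp
  | step m μ ih =>
    rw [totP_add_single, Module.End.mul_apply, resL_totL, ih, totP_add_single,
      Module.End.mul_apply]

theorem resL_yT (κ : Fin n) (G : PF n par) :
    resL par n (yT par κ G) = totL par κ (resL par n G) := by
  refine resL_intertwine (isVF_yT κ) (isVF_totL κ) (fun μ => ?_) (fun f m => ?_) G
  · rw [yT_xx, totL_xx]
    split_ifs
    exacts [map_one _, map_zero _]
  · rw [yT_jt, resL_jt, resL_jt]
    split_ifs
    · rw [totL_jt, add_right_comm]
    · rw [map_zero]

theorem resL_yP (l : Fin n → ℕ) (G : PF n par) :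
    resL par n (yP par l G) = totP par l (resL par n G) := by
  induction l using multiIndex_induction with
  | zero => simp
  | step l μ ih =>
    rw [yP_add_single, Module.End.mul_apply, resL_yT, ih, totP_add_single, Module.End.mul_apply]

theorem resL_thE (ν : Fin n) (G : PF n par) : resL par n (thE par ν G) = 0 := by
  refine (resL_intertwine (Y := 0) (isVF_thE ν) (IsVF.zero (ε := 0)) (fun μ => ?_)
    (fun f m => ?_) G).trans (LinearMap.zero_apply _)
  · rw [thE_xx, map_zero, LinearMap.zero_apply]
  · obtain ⟨a, l, N⟩ := f
    rw [jt_eq_totP, ← Module.End.mul_apply, (commute_totP (commute_thE_totL ν) m).eq,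
      Module.End.mul_apply, resL_totP, thE_jt, LinearMap.zero_apply]
    split_ifs
    · rw [map_zero, map_zero]
    · rw [map_smul, resL_jt, if_neg (Finset.insert_ne_empty ν N), smul_zero, map_zero]

/-- `d^F - σ^F` vanishes on the surface, where the `y`-derivatives are `x`-derivatives. -/
theorem resL_dsE (G : PF n par) : resL par n (dsE par G) = 0 := by
  refine (resL_intertwine (Y := 0) isVF_dsE (IsVF.zero (ε := 0)) (fun μ => ?_)
    (fun f m => ?_) G).trans (LinearMap.zero_apply _)
  · rw [dsE_xx, map_zero, LinearMap.zero_apply]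
  · obtain ⟨a, l, N⟩ := f
    rw [jt_eq_totP, ← Module.End.mul_apply, (commute_totP commute_dsE_totL m).eq,
      Module.End.mul_apply, resL_totP, dsE, LinearMap.sub_apply, dE_jt, sigE_jt,
      ← Finset.sum_sub_distrib, LinearMap.zero_apply, map_sum, Finset.sum_eq_zero, map_zero]
    intro i _
    rw [map_sub, map_smul, map_smul, resL_jt, resL_jt, add_zero, sub_self]

theorem resL_toYL (G : LF n par) : resL par n (toYL par n G) = G := by
  refine (fsub_fsub fieldParity_restrict G).trans ?_
  simp only [Finsupp.linearCombination_single, if_true, add_zero, one_smul]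
  exact fsub_single G

theorem resL_incL (G : LF n par) : resL par n (incL par n G) = G := by
  refine (fsub_fsub fieldParity_restrict G).trans ?_
  simp only [Finsupp.linearCombination_single, if_true, zero_add, one_smul]
  exact fsub_single G

theorem resL_sbChar (S : I → LF n par) (a : I) (l : Fin n → ℕ) (N : Finset (Fin n)) :
    resL par n (sbChar S (a, l, N)) = if N = ∅ then totP par l (S a) else 0 := by
  split_ifs with h
  · rw [h, sbChar_empty, resL_yP, resL_toYL]
  · obtain ⟨ν, hν⟩ := Finset.nonempty_of_ne_empty h
    rw [← Finset.insert_erase hν, sbChar, skewProd_insert thE_mul_thE (Finset.notMem_erase ν N),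
      map_smul, LinearMap.smul_apply, map_smul, Module.End.mul_apply, resL_thE, smul_zero,
      smul_zero]

/-- Restriction to the surface carries the parent differential to the original one. -/
theorem resL_spE {S : I → LF n par} (hpar : ∀ a, Par (par a + 1) (S a)) (G : PF n par) :
    resL par n (spE S G) = evolL par S (resL par n G) := by
  rw [spE, LinearMap.add_apply, map_add, resL_dsE, zero_add]
  refine resL_intertwine (isVF_sbE hpar) (isVF_evolL hpar) (fun μ => ?_) (fun f m => ?_) G
  · rw [sbE, evolL_xx, evolL_xx, map_zero]
  · obtain ⟨a, l, N⟩ := f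
    rw [sbE, evolL_jt, resL_totP, resL_sbChar, resL_jt]
    dsimp only
    split_ifs
    · rw [← totP_jt, ← Module.End.mul_apply (evolL par S),
        (commute_totP (commute_evolL hpar) m).eq, Module.End.mul_apply, evolL_jt]
    · rw [map_zero, map_zero]

end Parent

/-! ### Gradings -/

section Eigen

variable {M : Type*} [AddCommGroup M] [Module ℝ M]

/-- The sum of the eigenspaces of `E` for integral eigenvalues that are at least `g`. -/
def geSpan (E : Module.End ℝ M) (g : ℤ) : Submodule ℝ M :=
  Submodule.span ℝ {G | ∃ j : ℤ, g ≤ j ∧ E G = (j : ℝ) • G}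

variable {E : Module.End ℝ M} {g h : ℤ}

theorem mem_geSpan {G : M} {j : ℤ} (hj : g ≤ j) (hG : E G = (j : ℝ) • G) : G ∈ geSpan E g :=
  Submodule.subset_span ⟨j, hj, hG⟩

theorem geSpan_mono (hgh : g ≤ h) : geSpan E h ≤ geSpan E g :=
  Submodule.span_mono fun _ ⟨j, hj, hG⟩ => ⟨j, hgh.trans hj, hG⟩

/-- An operator of weight `k` shifts eigenvalues by `k`. -/
theorem eigen_shift {X : Module.End ℝ M} {k : ℤ}
    (hX : ∀ G, E (X G) = X (E G) + (k : ℝ) • X G) {G H : M} (hG : E G = (g : ℝ) • G)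
    (hH : X G = H) : E H = ((g + k : ℤ) : ℝ) • H := by
  rw [← hH, hX, hG, map_smul, ← add_smul, Int.cast_add]

/-- An operator of weight `k` shifts the filtration by `k`. -/
theorem map_mem_geSpan {X : Module.End ℝ M} {k : ℤ}
    (hX : ∀ G, E (X G) = X (E G) + (k : ℝ) • X G) {G : M} (hG : G ∈ geSpan E g) :
    X G ∈ geSpan E (g + k) := by
  induction hG using Submodule.span_induction with
  | mem G hG =>
    obtain ⟨j, hj, hG⟩ := hG
    exact mem_geSpan (by linarith) (eigen_shift hX hG rfl)
  | zero => rw [map_zero]; exact zero_mem _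
  | add G H _ _ hG hH => rw [map_add]; exact add_mem hG hH
  | smul c G _ hG => rw [map_smul]; exact Submodule.smul_mem _ c hG

theorem commute_aeval {A B : Module.End ℝ M} (h : Commute A B) (p : Polynomial ℝ) :
    Commute (Polynomial.aeval A p) B := by
  induction p using Polynomial.induction_on' with
  | add p q hp hq => rw [map_add]; exact hp.add_left hq
  | monomial k a =>
    rw [Polynomial.aeval_monomial]
    exact Commute.mul_left (Algebra.commutes a B) (h.pow_left k)

/-- A sum of eigenvectors of `A` that is an eigenvector of an operator `B` commuting with `A` is a
sum of common eigenvectors: the components are obtained by applying Lagrange polynomials in `A`. -/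
theorem mem_span_common_eigen {A B : Module.End ℝ M} (hAB : Commute A B) {b : ℝ} {T : ℕ} {G : M}
    (hG : G ∈ Submodule.span ℝ {G | ∃ j : ℕ, j ≤ T ∧ A G = (j : ℝ) • G}) (hB : B G = b • G) :
    G ∈ Submodule.span ℝ {G | ∃ j : ℕ, j ≤ T ∧ A G = (j : ℝ) • G ∧ B G = b • G} := by
  classical
  let s : Finset ℕ := Finset.range (T + 1)
  let v : ℕ → ℝ := fun j => j
  have hv : Set.InjOn v s := fun i _ j _ h => Nat.cast_injective h
  have h1 : G = ∑ j ∈ s, Polynomial.aeval A (Lagrange.basis s v j) G := by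
    rw [← LinearMap.sum_apply, ← map_sum, Lagrange.sum_basis hv ⟨0, by simp [s]⟩, map_one,
      Module.End.one_apply]
  rw [h1]
  refine Submodule.sum_mem _ fun j hj => Submodule.subset_span
    ⟨j, Nat.lt_succ_iff.1 (Finset.mem_range.1 hj), ?_, ?_⟩
  · clear hB h1
    induction hG using Submodule.span_induction with
    | mem x hx =>
      obtain ⟨i, hi, hx⟩ := hx
      rw [Module.End.aeval_apply_of_mem_apply_eq_smul hx, map_smul, hx]
      by_cases hij : i = j
      · rw [hij, smul_comm]
      · have h0 : (Lagrange.basis s v j).eval (i : ℝ) = 0 :=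
          Lagrange.eval_basis_of_ne (v := v) (Ne.symm hij)
            (Finset.mem_range.2 (Nat.lt_succ_iff.2 hi))
        rw [h0, zero_smul, zero_smul, smul_zero]
    | zero => simp
    | add x y _ _ hx hy => rw [map_add, map_add, hx, hy, smul_add]
    | smul c x _ hx => rw [map_smul, map_smul, hx, smul_comm]
  · rw [← Module.End.mul_apply B, ← (commute_aeval hAB _).eq, Module.End.mul_apply, hB, map_smul]

end Eigen

namespace LF

open SF LocalTheory

variable {n : ℕ} {F : Type*} {par : F → ZMod 2}

theorem commute_eulerL_eulerL (c d : F → (Fin n → ℕ) → ℤ) :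
    Commute (eulerL par c) (eulerL par d) := by
  refine sub_eq_zero.1 (ext_jet ((isVF_eulerL c).comm_even (isVF_eulerL d)) (IsVF.zero (ε := 0))
    (fun μ => ?_) fun f m => ?_)
  · rw [LinearMap.sub_apply, Module.End.mul_apply, Module.End.mul_apply, eulerL_xx, eulerL_xx,
      map_zero, map_zero, sub_self, LinearMap.zero_apply]
  · rw [LinearMap.sub_apply, Module.End.mul_apply, Module.End.mul_apply, eulerL_jt, eulerL_jt,
      map_smul, map_smul, eulerL_jt, eulerL_jt, smul_comm, sub_self, LinearMap.zero_apply]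

/-- A vector field commuting with the total derivatives has weight `k` as soon as this holds for its
characteristic. -/
theorem eulerL_shift {ε : ZMod 2} {X : Module.End ℝ (LF n par)} (hX : IsVF ε X)
    (ht : ∀ μ, Commute X (totL par μ)) (hx : ∀ μ, X (xx par μ) = 0) (c : F → ℤ) (k : ℤ)
    (hj : ∀ f, eulerL par (fun f _ => c f) (X (jt par f 0)) = ((c f + k : ℤ) : ℝ) • X (jt par f 0))
    (G : LF n par) : eulerL par (fun f _ => c f) (X G) =
      X (eulerL par (fun f _ => c f) G) + (k : ℝ) • X G := by
  have h : eulerL par (fun f _ => c f) * X - X * eulerL par (fun f _ => c f) = (k : ℝ) • X := by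
    refine ext_tot ((isVF_eulerL _).comm_even hX) (hX.smul _) (fun μ => ?_)
      (fun μ => (ht μ).smul_left _) (fun μ => ?_) fun f => ?_
    · exact ((commute_eulerL c μ).mul_left (ht μ)).sub_left ((ht μ).mul_left (commute_eulerL c μ))
    · rw [LinearMap.sub_apply, Module.End.mul_apply, Module.End.mul_apply, LinearMap.smul_apply, hx,
        eulerL_xx, map_zero, map_zero, smul_zero, sub_zero]
    · rw [LinearMap.sub_apply, Module.End.mul_apply, Module.End.mul_apply, LinearMap.smul_apply, hj,
        eulerL_jt, map_smul, ← sub_smul]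
      congr 1
      push_cast
      ring
  rw [← sub_eq_iff_eq_add']
  exact LinearMap.congr_fun h G

/-- The partial derivative along a coordinate has the opposite weight of the coordinate. -/
theorem eulerL_D_jt (c : F → (Fin n → ℕ) → ℤ) (f : F) (m : Fin n → ℕ) (G : LF n par) :
    eulerL par c (D _ (Sum.inr (f, m)) G) =
      D _ (Sum.inr (f, m)) (eulerL par c G) + ((-c f m : ℤ) : ℝ) • D _ (Sum.inr (f, m)) G := by
  classical
  have h : eulerL par c * D _ (Sum.inr (f, m)) - D _ (Sum.inr (f, m)) * eulerL par c =
      ((-c f m : ℤ) : ℝ) • D _ (Sum.inr (f, m)) := by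
    refine ext_jet ((isVF_eulerL c).comm_even (isVF_D _ _)) ((isVF_D _ _).smul _) (fun μ => ?_)
      fun f' m' => ?_
    · rw [LinearMap.sub_apply, Module.End.mul_apply, Module.End.mul_apply, LinearMap.smul_apply,
        eulerL_xx, xx, D_co, if_neg Sum.inl_ne_inr, map_zero, map_zero, smul_zero, sub_zero]
    · rw [LinearMap.sub_apply, Module.End.mul_apply, Module.End.mul_apply, LinearMap.smul_apply,
        eulerL_jt, map_smul, jt, D_co]
      by_cases hv : (Sum.inr (f', m') : Jet n F) = Sum.inr (f, m)
      · rw [if_pos hv, map_one_eq_zero (isVF_eulerL c)]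
        obtain ⟨rfl, rfl⟩ := Prod.mk.inj (Sum.inr.inj hv)
        rw [zero_sub, Int.cast_neg, neg_smul]
      · rw [if_neg hv, map_zero, smul_zero, smul_zero, sub_zero]
  rw [← sub_eq_iff_eq_add']
  exact LinearMap.congr_fun h G

theorem mul_mem_geSpan {E : Module.End ℝ (LF n par)} (hE : IsVF 0 E) {g h : ℤ} {G H : LF n par}
    (hG : G ∈ geSpan E g) (hH : H ∈ geSpan E h) : G * H ∈ geSpan E (g + h) := by
  induction hG using Submodule.span_induction with
  | zero => rw [zero_mul]; exact zero_mem _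
  | add G G' _ _ hG hG' => rw [add_mul]; exact add_mem hG hG'
  | smul c G _ hG => rw [smul_mul_assoc]; exact Submodule.smul_mem _ c hG
  | mem G hG =>
    obtain ⟨i, hi, hG⟩ := hG
    induction hH using Submodule.span_induction with
    | zero => rw [mul_zero]; exact zero_mem _
    | add H H' _ _ hH hH' => rw [mul_add]; exact add_mem hH hH'
    | smul c H _ hH => rw [mul_smul_comm]; exact Submodule.smul_mem _ c hH
    | mem H hH =>
      obtain ⟨j, hj, hH⟩ := hH
      refine mem_geSpan (j := i + j) (add_le_add hi hj) ?_
      rw [hE.leibniz, tw_zero, hG, hH, smul_mul_assoc, mul_smul_comm, ← add_smul, Int.cast_add]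

end LF

namespace Parent

open SuperFun (sgn sgn_zero sgn_one sgn_add sgn_mul_self zmod_two_cases PreservesParity)
open LocalTheory LF SF

variable {n : ℕ} {I : Type*} {par : I → ZMod 2} (gh : I → ℤ)

variable (par) in
/-- The ghost number operator of the parent theory. -/
noncomputable def ghE : Module.End ℝ (PF n par) := eulerL (ppar par n) fun f _ => pgh gh n f

variable (par) in
/-- The degree operator as a linear operator. -/
noncomputable def degE (T : ℕ) : Module.End ℝ (PF n par) :=
  eulerL (ppar par n) fun f _ => -(len f.2.1 : ℤ) + T * gh f.1

theorem len_add_single (l : Fin n → ℕ) (i : Fin n) : len (l + Pi.single i 1) = len l + 1 := by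
  simp [len, Finset.sum_add_distrib]

theorem pgh_erase {i : Fin n} (a : I) (l l' : Fin n → ℕ) {N : Finset (Fin n)} (hi : i ∈ N) :
    pgh gh n (a, l', N.erase i) = pgh gh n (a, l, N) + 1 := by
  have h : N.card = (N.erase i).card + 1 := (Finset.card_erase_add_one hi).symm
  simp only [pgh, h]
  push_cast
  ring

theorem pgh_insert {i : Fin n} (a : I) (l l' : Fin n → ℕ) {N : Finset (Fin n)} (hi : i ∉ N) :
    pgh gh n (a, l', insert i N) = pgh gh n (a, l, N) + (-1) := by
  simp only [pgh, Finset.card_insert_of_notMem hi]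
  push_cast
  ring

theorem ghE_dsE (G : PF n par) :
    ghE par gh (dsE par G) = dsE par (ghE par gh G) + ((1 : ℤ) : ℝ) • dsE par G := by
  refine eulerL_shift isVF_dsE commute_dsE_totL dsE_xx (pgh gh n) 1 ?_ G
  rintro ⟨a, l, N⟩
  rw [dsE, LinearMap.sub_apply, dE_jt, sigE_jt, ← Finset.sum_sub_distrib, map_sum, Finset.smul_sum]
  refine Finset.sum_congr rfl fun i hi => ?_
  rw [map_sub, map_smul, map_smul, eulerL_jt, eulerL_jt, pgh_erase gh a l _ hi,
    pgh_erase gh a l _ hi, smul_sub, smul_comm, smul_comm (sgn (par a) * eps i N)]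

theorem ghE_thE (ν : Fin n) (G : PF n par) :
    ghE par gh (thE par ν G) = thE par ν (ghE par gh G) + ((-1 : ℤ) : ℝ) • thE par ν G := by
  refine eulerL_shift (isVF_thE ν) (commute_thE_totL ν) (thE_xx ν) (pgh gh n) (-1) ?_ G
  rintro ⟨a, l, N⟩
  rw [thE_jt]
  split_ifs with hν
  · rw [map_zero, smul_zero]
  · rw [map_smul, eulerL_jt, pgh_insert gh a l _ hν, smul_comm]

theorem commute_yT_ghE (κ : Fin n) : Commute (yT par κ) (ghE par gh) := by
  refine (sub_eq_zero.1 (ext_tot ((isVF_eulerL _).comm_even (isVF_yT κ)) (IsVF.zero (ε := 0))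
    (fun μ => ?_) commute_zero_totL (fun μ => ?_) ?_)).symm
  · exact ((commute_eulerL _ μ).mul_left (commute_yT_totL κ μ)).sub_left
      ((commute_yT_totL κ μ).mul_left (commute_eulerL _ μ))
  · rw [LinearMap.sub_apply, Module.End.mul_apply, Module.End.mul_apply, yT_xx, eulerL_xx]
    split_ifs <;> simp [map_one_eq_zero (isVF_eulerL _)]
  · rintro ⟨a, l, N⟩
    rw [LinearMap.sub_apply, Module.End.mul_apply, Module.End.mul_apply, yT_jt, eulerL_jt,
      eulerL_jt, map_smul, yT_jt, LinearMap.zero_apply]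
    exact sub_self _

theorem ghE_toYL (G : LF n par) :
    ghE par gh (toYL par n G) = toYL par n (eulerL par (fun a _ => gh a) G) := by
  refine (toYL_intertwine (isVF_eulerL _) (isVF_eulerL _) (fun μ => ?_) (fun a m => ?_) G).symm
  · rw [eulerL_xx, eulerL_xx, map_zero]
  · rw [eulerL_jt, eulerL_jt, map_smul, toYL_jt]
    simp [pgh]

section

variable {S : I → LF n par} (hpar : ∀ a, Par (par a + 1) (S a)) {gh}
  (hgh : ∀ a, eulerL par (fun b _ => gh b) (S a) = ((gh a + 1 : ℤ) : ℝ) • S a)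

include hgh in
theorem ghE_sbChar (f : PField n I) :
    ghE par gh (sbChar S f) = ((pgh gh n f + 1 : ℤ) : ℝ) • sbChar S f := by
  obtain ⟨a, l, N⟩ := f
  induction N using Finset.induction with
  | empty =>
    have h1 : Commute (ghE par gh) (yP par l) :=
      Commute.famPow (fun κ => (commute_yT_ghE gh κ).symm) l
    rw [sbChar_empty, ← Module.End.mul_apply, h1.eq, Module.End.mul_apply, ghE_toYL, hgh, map_smul,
      map_smul]
    simp [pgh]
  | insert ν N hν ih =>
    have h := thE_sbChar (S := S) a l hν
    have h2 : sbChar S (a, l, insert ν N) =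
        (-(sgn (par a) * eps ν N)) • thE par ν (sbChar S (a, l, N)) := by
      rw [h, smul_smul, neg_mul_neg, mul_mul_mul_comm, sgn_mul_self, eps_mul_self, one_mul,
        one_smul]
    rw [h2, map_smul, ghE_thE, ih, map_smul, ← add_smul, pgh_insert gh a l l hν, smul_comm]
    congr 2
    push_cast
    ring

include hpar hgh in
theorem ghE_spE (G : PF n par) :
    ghE par gh (spE S G) = spE S (ghE par gh G) + ((1 : ℤ) : ℝ) • spE S G := by
  have h : ghE par gh (sbE S G) = sbE S (ghE par gh G) + ((1 : ℤ) : ℝ) • sbE S G := by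
    refine eulerL_shift (isVF_sbE hpar) (commute_sbE_totL hpar) (fun μ => evolL_xx _ _) (pgh gh n)
      1 (fun f => ?_) G
    rw [sbE, evolL_jt_zero]
    exact ghE_sbChar hgh f
  rw [spE, LinearMap.add_apply, map_add, h, ghE_dsE, LinearMap.add_apply, smul_add]
  abel

end

theorem degE_sigE (T : ℕ) (G : PF n par) :
    degE par gh T (sigE par G) = sigE par (degE par gh T G) + ((-1 : ℤ) : ℝ) • sigE par G := by
  refine eulerL_shift isVF_sigE commute_sigE_totL sigE_xx
    (fun f => -(len f.2.1 : ℤ) + T * gh f.1) (-1) ?_ G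
  rintro ⟨a, l, N⟩
  rw [sigE_jt, map_sum, Finset.smul_sum]
  refine Finset.sum_congr rfl fun i hi => ?_
  rw [map_smul, eulerL_jt, smul_comm, len_add_single]
  congr 2
  push_cast
  ring

theorem degE_dE (T : ℕ) (G : PF n par) :
    degE par gh T (dE par G) = dE par (degE par gh T G) + ((0 : ℤ) : ℝ) • dE par G := by
  refine eulerL_shift isVF_dE commute_dE_totL dE_xx
    (fun f => -(len f.2.1 : ℤ) + T * gh f.1) 0 ?_ G
  rintro ⟨a, l, N⟩
  rw [dE_jt, map_sum, Finset.smul_sum]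
  refine Finset.sum_congr rfl fun i hi => ?_
  rw [map_smul, eulerL_jt, smul_comm, add_zero]

theorem degE_thE (T : ℕ) (ν : Fin n) (G : PF n par) :
    degE par gh T (thE par ν G) = thE par ν (degE par gh T G) + ((0 : ℤ) : ℝ) • thE par ν G := by
  refine eulerL_shift (isVF_thE ν) (commute_thE_totL ν) (thE_xx ν)
    (fun f => -(len f.2.1 : ℤ) + T * gh f.1) 0 ?_ G
  rintro ⟨a, l, N⟩
  rw [thE_jt]
  split_ifs with hν
  · rw [map_zero, smul_zero]
  · rw [map_smul, eulerL_jt, smul_comm, add_zero]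

theorem degE_yE (T : ℕ) (κ : Fin n) (G : PF n par) :
    degE par gh T (yE par κ G) = yE par κ (degE par gh T G) + ((-1 : ℤ) : ℝ) • yE par κ G := by
  refine eulerL_shift (isVF_yE κ) (commute_evolL (par_yE κ)) (fun μ => evolL_xx _ _)
    (fun f => -(len f.2.1 : ℤ) + T * gh f.1) (-1) ?_ G
  rintro ⟨a, l, N⟩
  rw [yE_jt, eulerL_jt, len_add_single]
  congr 2
  push_cast
  ring

theorem degE_D_inl (T : ℕ) (κ : Fin n) (G : PF n par) :
    degE par gh T (D (jetPar (ppar par n) n) (Sum.inl κ) G) =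
      D (jetPar (ppar par n) n) (Sum.inl κ) (degE par gh T G) +
        ((0 : ℤ) : ℝ) • D (jetPar (ppar par n) n) (Sum.inl κ) G := by
  have h : degE par gh T * D (jetPar (ppar par n) n) (Sum.inl κ) -
      D (jetPar (ppar par n) n) (Sum.inl κ) * degE par gh T = 0 := by
    refine ext_jet ((isVF_eulerL _).comm_even (isVF_D_inl κ)) (IsVF.zero (ε := 0)) (fun μ => ?_)
      fun f m => ?_
    · rw [LinearMap.sub_apply, Module.End.mul_apply, Module.End.mul_apply, D_xx,
        degE, eulerL_xx]
      split_ifs <;> simp [map_one_eq_zero (isVF_eulerL _)]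
    · rw [LinearMap.sub_apply, Module.End.mul_apply, Module.End.mul_apply, degE, eulerL_jt, map_smul,
        D_jt, map_zero, smul_zero, sub_self, LinearMap.zero_apply]
  rw [Int.cast_zero, zero_smul, add_zero]
  exact LinearMap.congr_fun (sub_eq_zero.1 h) G

theorem yT_mem_geSpan (T : ℕ) {g : ℤ} (κ : Fin n) {G : PF n par}
    (hG : G ∈ geSpan (degE par gh T) g) : yT par κ G ∈ geSpan (degE par gh T) (g + (-1)) := by
  rw [yT, LinearMap.add_apply]
  exact add_mem (geSpan_mono (by linarith) (map_mem_geSpan (degE_D_inl gh T κ) hG))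
    (map_mem_geSpan (degE_yE gh T κ) hG)

theorem yP_mem_geSpan (T : ℕ) {g : ℤ} {G : PF n par}
    (hG : G ∈ geSpan (degE par gh T) g) (l : Fin n → ℕ) :
    yP par l G ∈ geSpan (degE par gh T) (-(len l : ℤ) + g) := by
  induction l using multiIndex_induction with
  | zero => simpa [len] using hG
  | step l κ ih =>
    rw [yP_add_single, Module.End.mul_apply, len_add_single]
    refine geSpan_mono ?_ (yT_mem_geSpan gh T κ ih)
    push_cast
    linarith

theorem degE_toYL (T : ℕ) (G : LF n par) : degE par gh T (toYL par n G) =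
    (T : ℝ) • toYL par n (eulerL par (fun a _ => gh a) G) -
      toYL par n (eulerL par (fun _ m => (len m : ℤ)) G) := by
  have h := toYL_intertwine (n := n) (par := par)
    (((isVF_eulerL fun a _ => gh a).smul (T : ℝ)).sub (isVF_eulerL fun _ m => (len m : ℤ)))
    (isVF_eulerL fun f _ => -(len f.2.1 : ℤ) + T * gh f.1) (fun μ => ?_) (fun a m => ?_) G
  · rw [degE, ← h, LinearMap.sub_apply, LinearMap.smul_apply, map_sub, map_smul]
  · rw [LinearMap.sub_apply, LinearMap.smul_apply, eulerL_xx, eulerL_xx, eulerL_xx, smul_zero,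
      sub_zero, map_zero]
  · rw [LinearMap.sub_apply, LinearMap.smul_apply, eulerL_jt, eulerL_jt, eulerL_jt, smul_smul,
      ← sub_smul, map_smul, toYL_jt]
    congr 1
    push_cast
    ring

theorem totP_mem_geSpan {T : ℕ} {g : ℤ} {G : PF n par} (hG : G ∈ geSpan (degE par gh T) g)
    (m : Fin n → ℕ) : totP (ppar par n) m G ∈ geSpan (degE par gh T) g := by
  have hc : Commute (degE par gh T) (totP (ppar par n) m) := commute_totP (commute_eulerL _) m
  rw [← add_zero g]
  refine map_mem_geSpan (fun H => ?_) hG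
  rw [Int.cast_zero, zero_smul, add_zero]
  exact LinearMap.congr_fun hc.eq H

theorem D_jt_mem_geSpan {T : ℕ} {g : ℤ} {G : PF n par} (hG : G ∈ geSpan (degE par gh T) g)
    (f : PField n I) (m : Fin n → ℕ) : D (jetPar (ppar par n) n) (Sum.inr (f, m)) G ∈
      geSpan (degE par gh T) (g + -(-(len f.2.1 : ℤ) + T * gh f.1)) :=
  map_mem_geSpan (fun H => eulerL_D_jt (fun f _ => -(len f.2.1 : ℤ) + T * gh f.1) f m H) hG

section

variable {S : I → LF n par} (hpar : ∀ a, Par (par a + 1) (S a)) {gh} {T : ℕ}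
  (hgh : ∀ a, eulerL par (fun b _ => gh b) (S a) = ((gh a + 1 : ℤ) : ℝ) • S a)
  (hT : ∀ a, S a ∈ Submodule.span ℝ {G : LF n par |
    ∃ j : ℕ, j ≤ T ∧ eulerL par (fun _ m => (len m : ℤ)) G = (j : ℝ) • G})
include hgh hT

/-- A term of `S^a` with `j ≤ T` derivatives and ghost number `gh a + 1` becomes a term of degree
`T (gh a + 1) - j ≥ T gh a`. -/
theorem toYL_mem_geSpan (a : I) : toYL par n (S a) ∈ geSpan (degE par gh T) (T * gh a) := by
  have h := mem_span_common_eigen (A := eulerL par fun _ m => (len m : ℤ))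
    (B := eulerL par fun b _ => gh b) (commute_eulerL_eulerL _ _) (hT a) (hgh a)
  generalize S a = G at h
  induction h using Submodule.span_induction with
  | zero => rw [map_zero]; exact zero_mem _
  | add G H _ _ hG hH => rw [map_add]; exact add_mem hG hH
  | smul c G _ hG => rw [map_smul]; exact Submodule.smul_mem _ c hG
  | mem G hG =>
    obtain ⟨j, hj, h1, h2⟩ := hG
    refine mem_geSpan (j := T * (gh a + 1) - j) ?_ ?_
    · have : (j : ℤ) ≤ T := by exact_mod_cast hj
      linarith
    · rw [degE_toYL, h1, h2, map_smul, map_smul, smul_smul, ← sub_smul]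
      push_cast
      rfl

theorem sbChar_mem_geSpan (f : PField n I) :
    sbChar S f ∈ geSpan (degE par gh T) (-(len f.2.1 : ℤ) + T * gh f.1) := by
  obtain ⟨a, l, N⟩ := f
  induction N using Finset.induction with
  | empty =>
    rw [sbChar_empty]
    exact yP_mem_geSpan gh T (toYL_mem_geSpan hgh hT a) l
  | insert ν N hν ih =>
    have h2 : sbChar S (a, l, insert ν N) =
        (-(sgn (par a) * eps ν N)) • thE par ν (sbChar S (a, l, N)) := by
      rw [thE_sbChar (S := S) a l hν, smul_smul, neg_mul_neg, mul_mul_mul_comm, sgn_mul_self,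
        eps_mul_self, one_mul, one_smul]
    rw [h2]
    refine Submodule.smul_mem _ _ (geSpan_mono ?_ (map_mem_geSpan (degE_thE gh T ν) ih))
    dsimp only
    linarith

include hpar in
/-- `s̄` has only components of nonnegative degree: in `∑ (s̄ v) ∂/∂v`, the component `s̄ v` has at
least the degree of `v`. -/
theorem sbE_mem_geSpan {g : ℤ} {G : PF n par} (hG : degE par gh T G = (g : ℝ) • G) :
    sbE S G ∈ geSpan (degE par gh T) g := by
  obtain ⟨V, hV⟩ := exists_support G
  rw [(isVF_sbE hpar).eq_sum G hV]
  refine Submodule.sum_mem _ fun v _ => ?_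
  obtain κ | ⟨f, m⟩ := v
  · have h : sbE S (xx (ppar par n) κ) = 0 := evolL_xx _ _
    rw [← xx, h, zero_mul]
    exact zero_mem _
  · have h1 : sbE S (jt (ppar par n) f m) ∈
        geSpan (degE par gh T) (-(len f.2.1 : ℤ) + T * gh f.1) := by
      rw [sbE, evolL_jt]
      exact totP_mem_geSpan gh (sbChar_mem_geSpan hgh hT f) m
    have h2 := D_jt_mem_geSpan gh (mem_geSpan le_rfl hG) f m
    exact geSpan_mono (by linarith) (mul_mem_geSpan (isVF_eulerL _) h1 h2)

end

end Parent

namespace LF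

open SF LocalTheory

variable {n : ℕ} {F F' : Type*} {par : F → ZMod 2} {par' : F' → ZMod 2}

/-! ### Linear changes of fields -/

open SuperFun (sgn sgn_zero sgn_one sgn_add sgn_mul_self zmod_two_cases)

theorem sgn_injective {a b : ZMod 2} (h : sgn a = sgn b) : a = b := by
  rcases zmod_two_cases a with rfl | rfl <;> rcases zmod_two_cases b with rfl | rfl
  · rfl
  · rw [sgn_zero, sgn_one] at h; norm_num at h
  · rw [sgn_zero, sgn_one] at h; norm_num at h
  · rfl

/-- The inverse of a parity-preserving linear bijection preserves parities: the bijection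
intertwines the operators that multiply the basis vectors with the signs of their parities. -/
theorem parity_symm (e : (F' →₀ ℝ) ≃ₗ[ℝ] (F →₀ ℝ))
    (he : ∀ f', ∀ f ∈ (e (Finsupp.single f' 1)).support, par f = par' f') (f : F) :
    ∀ f' ∈ (e.symm (Finsupp.single f 1)).support, par' f' = par f := by
  let τ : (F →₀ ℝ) →ₗ[ℝ] (F →₀ ℝ) :=
    Finsupp.linearCombination ℝ fun f => Finsupp.single f (sgn (par f))
  let τ' : (F' →₀ ℝ) →ₗ[ℝ] (F' →₀ ℝ) :=
    Finsupp.linearCombination ℝ fun f => Finsupp.single f (sgn (par' f))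
  have hτ : ∀ u f, τ u f = sgn (par f) * u f := fun u f => by
    refine LinearMap.congr_fun (f := Finsupp.lapply f ∘ₗ τ) (g := sgn (par f) • Finsupp.lapply f)
      (Finsupp.lhom_ext' fun f' => LinearMap.ext_ring ?_) u
    classical
    simp only [LinearMap.comp_apply, τ, Finsupp.lsingle_apply, Finsupp.linearCombination_single,
      one_smul, Finsupp.lapply_apply, LinearMap.smul_apply, Finsupp.single_apply, smul_eq_mul]
    split_ifs with h
    · rw [h, mul_one]
    · rw [mul_zero]
  have hτ' : ∀ u f, τ' u f = sgn (par' f) * u f := fun u f => by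
    refine LinearMap.congr_fun (f := Finsupp.lapply f ∘ₗ τ') (g := sgn (par' f) • Finsupp.lapply f)
      (Finsupp.lhom_ext' fun f' => LinearMap.ext_ring ?_) u
    classical
    simp only [LinearMap.comp_apply, τ', Finsupp.lsingle_apply, Finsupp.linearCombination_single,
      one_smul, Finsupp.lapply_apply, LinearMap.smul_apply, Finsupp.single_apply, smul_eq_mul]
    split_ifs with h
    · rw [h, mul_one]
    · rw [mul_zero]
  have hcomm : e.toLinearMap ∘ₗ τ' = τ ∘ₗ e.toLinearMap := by
    refine Finsupp.lhom_ext' fun f' => LinearMap.ext_ring (Finsupp.ext fun f => ?_)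
    simp only [LinearMap.comp_apply, Finsupp.lsingle_apply, LinearEquiv.coe_coe]
    rw [hτ]
    have h1 : τ' (Finsupp.single f' 1) = sgn (par' f') • Finsupp.single f' 1 := by
      simp [τ']
    rw [h1, map_smul, Finsupp.smul_apply, smul_eq_mul]
    by_cases hf : f ∈ (e (Finsupp.single f' 1)).support
    · rw [he f' f hf]
    · rw [Finsupp.notMem_support_iff.1 hf, mul_zero, mul_zero]
  intro f' hf'
  set y := e.symm (Finsupp.single f 1) with hy
  have h2 : τ' y = sgn (par f) • y := by
    apply e.injective
    have h3 := LinearMap.congr_fun hcomm y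
    simp only [LinearMap.comp_apply, LinearEquiv.coe_coe] at h3
    rw [h3, map_smul, hy, LinearEquiv.apply_symm_apply]
    simp [τ]
  have h4 := DFunLike.congr_fun h2 f'
  rw [hτ', Finsupp.smul_apply, smul_eq_mul] at h4
  exact sgn_injective (mul_right_cancel₀ (Finsupp.mem_support_iff.1 hf') h4)

theorem fieldParity_row {r : F' → F →₀ ℝ} (hr : ∀ f', ∀ f ∈ (r f').support, par f = par' f') :
    FieldParity (n := n) par' par fun f' m => (r f').mapDomain fun f => (f, m) := by
  classical
  intro f' m q hq
  obtain ⟨f, hf, rfl⟩ := Finset.mem_image.1 (Finsupp.mapDomain_support hq)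
  exact hr f' f hf

theorem fsub_row_fsub_row {r : F' → F →₀ ℝ} {r' : F → F' →₀ ℝ}
    (hr' : ∀ f, ∀ f' ∈ (r' f).support, par' f' = par f)
    (h : ∀ f', Finsupp.linearCombination ℝ r' (r f') = Finsupp.single f' 1) (G : LF n par') :
    fsub par par' (fun f m => (r' f).mapDomain fun f' => (f', m))
      (fsub par' par (fun f' m => (r f').mapDomain fun f => (f, m)) G) = G := by
  rw [fsub_fsub (fieldParity_row hr')]
  have h1 : ∀ (f' : F') (m : Fin n → ℕ), Finsupp.linearCombination ℝ
      (fun q : F × (Fin n → ℕ) => (r' q.1).mapDomain fun f' => (f', q.2))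
        ((r f').mapDomain fun f => (f, m)) = Finsupp.single (f', m) 1 := fun f' m => by
    rw [Finsupp.linearCombination_mapDomain]
    have h2 := congrArg (Finsupp.lmapDomain ℝ ℝ fun f' => (f', m)) (h f')
    rw [Finsupp.lmapDomain_apply, Finsupp.lmapDomain_apply, Finsupp.mapDomain_single] at h2
    rw [← h2, ← Finsupp.lmapDomain_apply _ ℝ, ← LinearMap.comp_apply]
    congr 1
    refine Finsupp.lhom_ext' fun q => LinearMap.ext_ring ?_
    simp
  simp only [h1]
  exact fsub_single G

/-- A parity-preserving linear bijection between the spans of two sets of fields is an invertible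
change of fields. -/
theorem exists_fieldChange {r : F' → F →₀ ℝ} (hr : ∀ f', ∀ f ∈ (r f').support, par f = par' f')
    (hb : Function.Bijective (Finsupp.linearCombination ℝ r)) :
    ∃ Φ : LocalFun n par' ≃ₐ[ℝ] LocalFun n par,
      IsFieldChange par par' (fun f' => lin par n (r f')) Φ ∧
      ∀ G : LF n par', Φ G = fsub par' par (fun f' m => (r f').mapDomain fun f => (f, m)) G := by
  let e : (F' →₀ ℝ) ≃ₗ[ℝ] (F →₀ ℝ) := LinearEquiv.ofBijective _ hb
  have he1 : ∀ f', e (Finsupp.single f' 1) = r f' := fun f' => by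
    simp [e, LinearEquiv.ofBijective_apply]
  let r' : F → F' →₀ ℝ := fun f => e.symm (Finsupp.single f 1)
  have hr' : ∀ f, ∀ f' ∈ (r' f).support, par' f' = par f :=
    parity_symm e fun f' f hf => hr f' f (by rwa [he1] at hf)
  have hl' : Finsupp.linearCombination ℝ r' = e.symm.toLinearMap :=
    Finsupp.lhom_ext' fun f => LinearMap.ext_ring (by simp [r'])
  have h1 : ∀ f', Finsupp.linearCombination ℝ r' (r f') = Finsupp.single f' 1 := fun f' => by
    rw [hl', ← he1, LinearEquiv.coe_coe, LinearEquiv.symm_apply_apply]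
  have h2 : ∀ f, Finsupp.linearCombination ℝ r (r' f) = Finsupp.single f 1 := fun f =>
    LinearEquiv.apply_symm_apply e _
  let Φ : LF n par' ≃ₐ[ℝ] LF n par := AlgEquiv.ofAlgHom
    (fsub par' par fun f' m => (r f').mapDomain fun f => (f, m))
    (fsub par par' fun f m => (r' f).mapDomain fun f' => (f', m))
    (AlgHom.ext fun G => fsub_row_fsub_row hr h2 G) (AlgHom.ext fun G => fsub_row_fsub_row hr' h1 G)
  refine ⟨Φ, ⟨fun f' => par_linL (hr f'), fun μ => fsub_xx (fieldParity_row hr) μ,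
    fun μ G => fsub_totL (fieldParity_row hr) (fun f' m κ => ?_) μ G, fun f' => ?_⟩, fun G => rfl⟩
  · rw [← totP_linL, ← totP_linL, totP_add_single, Module.End.mul_apply]
  · refine (fsub_jt (fieldParity_row hr) f' 0).trans ?_
    rw [← totP_linL, totP_zero, Module.End.one_apply, linL_apply]

end LF

/-! ### The adapted basis of the span of the fields -/

namespace Parent

open SuperFun (sgn sgn_zero sgn_one sgn_add sgn_mul_self zmod_two_cases PreservesParity)
open LocalTheory LF SF

variable {n : ℕ} {I : Type*} {par : I → ZMod 2}

theorem homotopy_apply (u : FieldSpan n I) (f : PField n I) :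
    sigmaL par (rhoL par u) f + rhoL par (sigmaL par u) f =
      ((len f.2.1 + f.2.2.card : ℕ) : ℝ) * u f := by
  refine LinearMap.congr_fun (f := Finsupp.lapply f ∘ₗ (sigmaL par ∘ₗ rhoL par) +
      Finsupp.lapply f ∘ₗ (rhoL par ∘ₗ sigmaL par))
    (g := ((len f.2.1 + f.2.2.card : ℕ) : ℝ) • Finsupp.lapply f) (end_ext fun a l N => ?_) u
  have h := DFunLike.congr_fun (homotopy_fld par a l N) f
  rw [Finsupp.add_apply, Finsupp.smul_apply] at h
  refine h.trans ?_
  rw [LinearMap.smul_apply, Finsupp.lapply_apply]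
  by_cases hf : (a, l, N) = f
  · rw [← hf]
  · rw [fld, Finsupp.single_eq_of_ne (Ne.symm hf), smul_zero, smul_zero]

variable (par) in
/-- The span of the fields of parity `p`. -/
noncomputable def homog (n : ℕ) (p : ZMod 2) : Submodule ℝ (FieldSpan n I) :=
  Finsupp.supported ℝ ℝ {f | ppar par n f = p}

theorem mem_homog {p : ZMod 2} {u : FieldSpan n I} :
    u ∈ homog par n p ↔ ∀ f ∈ u.support, ppar par n f = p :=
  Finsupp.mem_supported ..

theorem sigmaRow_mem_homog (f : PField n I) :
    sigmaRow par f ∈ homog par n (ppar par n f + 1) := by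
  obtain ⟨a, l, N⟩ := f
  exact Submodule.sum_mem _ fun i hi => Finsupp.single_mem_supported ℝ _ (ppar_erase a l _ hi)

theorem rhoRow_mem_homog (f : PField n I) :
    rhoRow par f ∈ homog par n (ppar par n f + 1) := by
  obtain ⟨a, l, N⟩ := f
  exact Submodule.sum_mem _ fun i hi =>
    Finsupp.single_mem_supported ℝ _ (ppar_insert a l _ (Finset.mem_compl.1 hi))

theorem sigmaL_mem_homog {p : ZMod 2} {u : FieldSpan n I} (hu : u ∈ homog par n p) :
    sigmaL par u ∈ homog par n (p + 1) := by
  rw [sigmaL, Finsupp.linearCombination_apply]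
  refine Submodule.sum_mem _ fun f hf => Submodule.smul_mem _ _ ?_
  rw [← mem_homog.1 hu f hf]
  exact sigmaRow_mem_homog f

/-- The span of the fields that carry skew indices. -/
noncomputable def skewSpan (n : ℕ) (I : Type*) : Submodule ℝ (FieldSpan n I) :=
  Finsupp.supported ℝ ℝ {f | f.2.2.Nonempty}

theorem range_rhoL_le : LinearMap.range (rhoL (n := n) par) ≤ skewSpan n I := by
  rw [rhoL, Finsupp.range_linearCombination, Submodule.span_le]
  rintro _ ⟨⟨a, l, N⟩, rfl⟩
  exact Submodule.sum_mem _ fun i _ => Finsupp.single_mem_supported ℝ _ (Finset.insert_nonempty i N)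

theorem rhoL_rhoL (u : FieldSpan n I) : rhoL par (rhoL par u) = 0 :=
  LinearMap.congr_fun (rhoL_mul_rhoL par) u

theorem rhoL_base (a : I) : rhoL par (fld a (0 : Fin n → ℕ) ∅) = 0 := by
  rw [rhoL, fld, Finsupp.linearCombination_single, one_smul, rhoRow]
  refine Finset.sum_eq_zero fun i _ => ?_
  simp

/-- `σ^F` is injective on the image of `ρ^F`. -/
theorem eq_zero_of_rhoL_sigmaL {u : FieldSpan n I} (hu : u ∈ LinearMap.range (rhoL par))
    (h : rhoL par (sigmaL par u) = 0) : u = 0 := by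
  have hs := range_rhoL_le hu
  obtain ⟨v, rfl⟩ := hu
  refine Finsupp.ext fun f => ?_
  have h1 := homotopy_apply (par := par) (rhoL par v) f
  rw [h, rhoL_rhoL, map_zero, Finsupp.zero_apply, add_zero] at h1
  by_contra hf
  have h2 : f.2.2.Nonempty := Finsupp.mem_supported _ _ |>.1 hs (Finsupp.mem_support_iff.2 hf)
  have h3 := h2.card_pos
  rcases mul_eq_zero.1 h1.symm with h4 | h4
  · rw [Nat.cast_eq_zero] at h4
    omega
  · exact hf h4

variable {W : Set (FieldSpan n I)} {pw : W → ZMod 2}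

variable (par W) in
/-- The new fields `Ψ^a`, `w`, `c σ^F w` as linear combinations of the old ones. The values `c = 1`
and `c = -1` belong to `v = σ^F w` and to the pairs for `-σ^F`. -/
noncomputable def newRow (c : ℝ) : I ⊕ W ⊕ W → FieldSpan n I :=
  Sum.elim (fun a => fld a 0 ∅) (Sum.elim (fun w => w.1) fun w => c • sigmaL par w.1)

theorem newRow_parity (hW : IsRhoBasis par W pw) (c : ℝ) (u : I ⊕ W ⊕ W) :
    ∀ f ∈ (newRow par W c u).support, ppar par n f = splitPar par pw u := by
  rcases u with a | w | w
  · intro f hf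
    rw [Finset.mem_singleton.1 (Finsupp.support_single_subset hf)]
    exact ppar_empty a 0
  · exact hW.2.2 w
  · exact mem_homog.1 (Submodule.smul_mem _ c (sigmaL_mem_homog (mem_homog.2 (hW.2.2 w))))

theorem linearCombination_newRow (c : ℝ) (y : I ⊕ W ⊕ W →₀ ℝ) :
    ∃ (x : I →₀ ℝ) (z t : W →₀ ℝ), y = x.mapDomain Sum.inl +
      (z.mapDomain (Sum.inr ∘ Sum.inl) + t.mapDomain (Sum.inr ∘ Sum.inr)) ∧
      Finsupp.linearCombination ℝ (newRow par W c) y =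
        Finsupp.linearCombination ℝ (fun a => fld a 0 ∅) x +
        (Finsupp.linearCombination ℝ (Subtype.val : W → FieldSpan n I) z +
          c • sigmaL par (Finsupp.linearCombination ℝ (Subtype.val : W → FieldSpan n I) t)) := by
  induction y using Finsupp.induction_linear with
  | zero => exact ⟨0, 0, 0, by simp, by simp⟩
  | add y y' hy hy' =>
    obtain ⟨x, z, t, h1, h2⟩ := hy
    obtain ⟨x', z', t', h1', h2'⟩ := hy'
    refine ⟨x + x', z + z', t + t', ?_, ?_⟩
    · rw [h1, h1', Finsupp.mapDomain_add, Finsupp.mapDomain_add, Finsupp.mapDomain_add]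
      abel
    · rw [map_add, h2, h2', map_add, map_add, map_add, map_add, smul_add]
      abel
  | single u r =>
    rcases u with a | w | w
    · exact ⟨Finsupp.single a r, 0, 0, by simp, by simp [newRow]⟩
    · exact ⟨0, Finsupp.single w r, 0, by simp, by simp [newRow]⟩
    · exact ⟨0, 0, Finsupp.single w r, by simp, by simp [newRow, smul_comm r c]⟩

/-- The `Ψ^a`, the `w` and the `c σ^F w` form a basis of the span of the fields. -/
theorem bijective_newRow (hW : IsRhoBasis par W pw) {c : ℝ} (hc : c ≠ 0) :
    Function.Bijective (Finsupp.linearCombination ℝ (newRow par W c)) := by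
  have hrange : Submodule.span ℝ W = LinearMap.range (rhoL par) := hW.2.1
  have hmem : ∀ z : W →₀ ℝ, Finsupp.linearCombination ℝ (Subtype.val : W → FieldSpan n I) z ∈
      LinearMap.range (rhoL par) := fun z => by
    rw [← hrange]
    refine Submodule.sum_mem _ fun w _ => Submodule.smul_mem _ _ (Submodule.subset_span w.2)
  have hker : ∀ u ∈ LinearMap.range (rhoL (n := n) par), rhoL par u = 0 := by
    rintro _ ⟨v, rfl⟩
    exact rhoL_rhoL v
  have hbase : ∀ x : I →₀ ℝ,
      rhoL par (Finsupp.linearCombination ℝ (fun a => fld a (0 : Fin n → ℕ) ∅) x) = 0 := fun x => by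
    rw [Finsupp.linearCombination_apply, Finsupp.sum, map_sum]
    exact Finset.sum_eq_zero fun a _ => by rw [map_smul, rhoL_base, smul_zero]
  constructor
  · rw [injective_iff_map_eq_zero]
    intro y hy
    obtain ⟨x, z, t, h1, h2⟩ := linearCombination_newRow (par := par) c y
    rw [h2] at hy
    have ht : Finsupp.linearCombination ℝ (Subtype.val : W → FieldSpan n I) t = 0 := by
      have h3 := congrArg (rhoL par) hy
      rw [map_add, map_add, hbase, hker _ (hmem z), zero_add, zero_add, map_smul, map_zero,
        smul_eq_zero_iff_right hc] at h3
      exact eq_zero_of_rhoL_sigmaL (hmem t) h3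
    rw [ht, map_zero, smul_zero, add_zero] at hy
    have hx : x = 0 := by
      refine Finsupp.ext fun a => ?_
      have h4 := DFunLike.congr_fun hy (a, 0, ∅)
      have h5 : Finsupp.linearCombination ℝ (Subtype.val : W → FieldSpan n I) z (a, 0, ∅) = 0 := by
        by_contra h
        exact Finset.not_nonempty_empty (Finsupp.mem_supported _ _ |>.1 (range_rhoL_le (hmem z))
          (Finsupp.mem_support_iff.2 h))
      have h6 : Finsupp.linearCombination ℝ (fun a => fld a (0 : Fin n → ℕ) ∅) x =
          x.mapDomain fun a => (a, 0, ∅) := by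
        simp [Finsupp.linearCombination_apply, Finsupp.mapDomain, fld]
      rw [Finsupp.add_apply, h5, add_zero, Finsupp.zero_apply, h6,
        Finsupp.mapDomain_apply fun a b h => congrArg Prod.fst h] at h4
      exact h4
    rw [hx, map_zero, zero_add] at hy
    have hli := linearIndependent_iff.1 hW.1
    rw [h1, hx, hli z hy, hli t ht]
    simp
  · rw [← LinearMap.range_eq_top, eq_top_iff]
    have hle : LinearMap.range (rhoL par) ≤
        LinearMap.range (Finsupp.linearCombination ℝ (newRow par W c)) := by
      rw [← hrange, Submodule.span_le]
      intro w hw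
      exact ⟨Finsupp.single (Sum.inr (Sum.inl ⟨w, hw⟩)) 1, by simp [newRow]⟩
    have hle' : ∀ u ∈ LinearMap.range (rhoL par), sigmaL par u ∈
        LinearMap.range (Finsupp.linearCombination ℝ (newRow par W c)) := by
      rw [← hrange]
      intro u hu
      induction hu using Submodule.span_induction with
      | mem w hw =>
        exact ⟨Finsupp.single (Sum.inr (Sum.inr ⟨w, hw⟩)) c⁻¹, by simp [newRow, smul_smul, hc]⟩
      | zero => rw [map_zero]; exact zero_mem _
      | add u v _ _ hu hv => rw [map_add]; exact add_mem hu hv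
      | smul r u _ hu => rw [map_smul]; exact Submodule.smul_mem _ r hu
    intro u _
    induction u using Finsupp.induction_linear with
    | zero => exact zero_mem _
    | add u v hu hv => exact add_mem (hu trivial) (hv trivial)
    | single f r =>
      rw [single_eq_smul_fld]
      refine Submodule.smul_mem _ r ?_
      obtain ⟨a, l, N⟩ := f
      dsimp only
      by_cases h0 : len l + N.card = 0
      · obtain ⟨hl, hN⟩ := Nat.add_eq_zero_iff.1 h0
        have hl : l = 0 := by
          funext i
          exact Finset.sum_eq_zero_iff.1 hl i (Finset.mem_univ i)
        rw [hl, Finset.card_eq_zero.1 hN]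
        exact ⟨Finsupp.single (Sum.inl a) 1, by simp [newRow]⟩
      · have h1 := homotopy_fld par a l N
        have h2 : fld a l N = ((len l + N.card : ℕ) : ℝ)⁻¹ •
            (sigmaL par (rhoL par (fld a l N)) + rhoL par (sigmaL par (fld a l N))) := by
          rw [h1, smul_smul, inv_mul_cancel₀ (Nat.cast_ne_zero.2 h0), one_smul]
        rw [h2]
        exact Submodule.smul_mem _ _ (add_mem (hle' _ ⟨_, rfl⟩) (hle ⟨_, rfl⟩))

/-- A basis of the image can be chosen among the images of single fields, which have definite
parities. -/
theorem exists_isRhoBasis (par : I → ZMod 2) :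
    ∃ (W : Set (PField n I →₀ ℝ)) (pw : W → ZMod 2), IsRhoBasis par W pw := by
  obtain ⟨W, hW, hspan, hli⟩ := exists_linearIndependent ℝ (Set.range (rhoRow (n := n) par))
  choose f hf using fun w : W => hW w.2
  refine ⟨W, fun w => ppar par n (f w) + 1, hli, ?_, fun w => ?_⟩
  · rw [hspan, Finsupp.range_linearCombination]
  · rw [← hf w]
    exact mem_homog.1 (rhoRow_mem_homog (f w))

/-- The change of fields that introduces the `w` and the `c σ^F w`. -/
theorem exists_fieldChange_newRow (hW : IsRhoBasis par W pw) {c : ℝ} (hc : c ≠ 0) :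
    ∃ Φ : LocalFun n (splitPar par pw) ≃ₐ[ℝ] PFun n par,
      IsFieldChange (ppar par n) (splitPar par pw)
        (fun u => lin (ppar par n) n (newRow par W c u)) Φ ∧
      ∀ G : LocalFun n par, Φ (rename par (splitPar par pw) Sum.inl G) = incl par n G := by
  obtain ⟨Φ, hΦ, h⟩ := exists_fieldChange (n := n) (newRow_parity hW c) (bijective_newRow hW hc)
  refine ⟨Φ, hΦ, fun G => (h _).trans ?_⟩
  have h1 := fsub_fsub (L := fun a m => Finsupp.single ((Sum.inl a : I ⊕ W ⊕ W), m) 1)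
    (par := par) (fieldParity_row (n := n) (newRow_parity hW c)) G
  simp only [Finsupp.linearCombination_single, one_smul, newRow, Sum.elim_inl, fld,
    Finsupp.mapDomain_single] at h1
  exact h1

end Parent

/-! ### Vector fields and ideals -/

namespace SF

variable {V : Type*} {p : V → ZMod 2} {ε : ZMod 2} {X : Module.End ℝ (SF p)}

theorem smul_mem_ideal (K : Ideal (SF p)) (c : ℝ) {G : SF p} (hG : G ∈ K) : c • G ∈ K :=
  Submodule.smul_of_tower_mem K c hG

/-- A vector field `X` maps the left ideal generated by `s` to `K` as soon as `K` contains, for `G` in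
`s`, the images `X G` and the products `X b * G`. -/
theorem IsVF.map_mem_of_span (hX : IsVF ε X) {s : Set (SF p)} {K : Ideal (SF p)}
    (h1 : ∀ G ∈ s, ∀ b, X b * G ∈ K) (h2 : ∀ G ∈ s, X G ∈ K) {G : SF p}
    (hG : G ∈ Ideal.span s) : X G ∈ K := by
  refine Submodule.closure_induction (p := fun G _ => X G ∈ K) ?_ ?_ ?_ hG
  · rw [map_zero]; exact zero_mem _
  · intro G H _ _ hG hH
    rw [map_add]; exact add_mem hG hH
  · intro a G hG
    rw [smul_eq_mul, hX.leibniz]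
    exact add_mem (h1 G hG a) (K.mul_mem_left _ (h2 G hG))

theorem IsVF.map_mem_span (hX : IsVF ε X) {s : Set (SF p)}
    (h : ∀ G ∈ s, X G ∈ Ideal.span s) {G : SF p} (hG : G ∈ Ideal.span s) : X G ∈ Ideal.span s :=
  hX.map_mem_of_span (fun _ hG _ => Ideal.mul_mem_left _ _ (Ideal.subset_span hG)) h hG

variable {Z : Set (SF p)}

theorem span_pow_zero : Ideal.span (Z ^ 0) = ⊤ :=
  (Ideal.eq_top_iff_one _).2 (Ideal.subset_span (by rw [pow_zero]; exact Set.mem_one.2 rfl))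

/-- Left multiplication with a homogeneous element maps the left ideal generated by `s` to the one
generated by the products. -/
theorem mul_mem_span_mul {z : SF p} {a : ZMod 2} (hz : Par a z) {s : Set (SF p)} {G : SF p}
    (hG : G ∈ Ideal.span s) : z * G ∈ Ideal.span ((fun G => z * G) '' s) := by
  refine Submodule.closure_induction (p := fun G _ => z * G ∈ Ideal.span ((fun G => z * G) '' s))
    ?_ ?_ ?_ hG
  · rw [mul_zero]; exact zero_mem _
  · intro G H _ _ hG hH
    rw [mul_add]; exact add_mem hG hH
  · intro b G hG
    rw [smul_eq_mul, ← mul_assoc, hz.supercomm, mul_assoc]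
    exact Ideal.mul_mem_left _ _ (Ideal.subset_span ⟨G, hG, rfl⟩)

theorem mul_mem_span_sq {x z : SF p} (hx : x ∈ Ideal.span Z) (hz : z ∈ Z) :
    x * z ∈ Ideal.span (Z ^ 2) := by
  refine Submodule.closure_induction (p := fun x _ => x * z ∈ Ideal.span (Z ^ 2)) ?_ ?_ ?_ hx
  · rw [zero_mul]; exact zero_mem _
  · intro G H _ _ hG hH
    rw [add_mul]; exact add_mem hG hH
  · intro b G hG
    rw [smul_eq_mul, mul_assoc, sq]
    exact Ideal.mul_mem_left _ _ (Ideal.subset_span (Set.mul_mem_mul hG hz))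

theorem mul_mem_span_pow_succ (hZ : ∀ z ∈ Z, ∃ a, Par a z) {z : SF p} (hz : z ∈ Z) {k : ℕ}
    {G : SF p} (hG : G ∈ Ideal.span (Z ^ k)) : z * G ∈ Ideal.span (Z ^ (k + 1)) := by
  obtain ⟨a, ha⟩ := hZ z hz
  refine Ideal.span_mono ?_ (mul_mem_span_mul ha hG)
  rintro _ ⟨H, hH, rfl⟩
  rw [pow_succ']
  exact Set.mul_mem_mul hz hH

/-- A vector field lowers the order in a set of homogeneous elements by at most one. -/
theorem IsVF.map_mem_span_pow (hX : IsVF ε X) (hZ : ∀ z ∈ Z, ∃ a, Par a z) {k : ℕ} {G : SF p}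
    (hG : G ∈ Ideal.span (Z ^ (k + 1))) : X G ∈ Ideal.span (Z ^ k) := by
  have hle : ∀ k b, ∀ G ∈ Z ^ (k + 1), b * G ∈ Ideal.span (Z ^ k) := fun k b G hG => by
    rw [pow_succ'] at hG
    obtain ⟨z, -, H, hH, rfl⟩ := Set.mem_mul.1 hG
    rw [← mul_assoc]
    exact Ideal.mul_mem_left _ _ (Ideal.subset_span hH)
  refine hX.map_mem_of_span (fun G hG b => hle k _ G hG) ?_ hG
  clear hG
  induction k with
  | zero =>
    intro G _
    rw [span_pow_zero]
    exact Submodule.mem_top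
  | succ k ih =>
    intro G hG
    rw [pow_succ'] at hG
    obtain ⟨z, hz, H, hH, rfl⟩ := Set.mem_mul.1 hG
    obtain ⟨a, ha⟩ := hZ z hz
    rw [hX.leibniz, ha.tw_eq, smul_mul_assoc]
    exact add_mem (Ideal.mul_mem_left _ _ (Ideal.subset_span hH))
      (smul_mem_ideal _ _ (mul_mem_span_pow_succ hZ hz (ih H hH)))

/-- A vector field that maps `Z` to itself preserves the powers of the ideal generated by `Z`. -/
theorem IsVF.map_mem_span_pow_self (hX : IsVF ε X) (hZ : ∀ z ∈ Z, ∃ a, Par a z)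
    (hXZ : ∀ z ∈ Z, X z ∈ Z) (k : ℕ) {G : SF p} (hG : G ∈ Ideal.span (Z ^ k)) :
    X G ∈ Ideal.span (Z ^ k) := by
  refine hX.map_mem_span ?_ hG
  clear hG
  induction k with
  | zero =>
    intro G _
    rw [span_pow_zero]
    exact Submodule.mem_top
  | succ k ih =>
    intro G hG
    rw [pow_succ'] at hG
    obtain ⟨z, hz, H, hH, rfl⟩ := Set.mem_mul.1 hG
    obtain ⟨a, ha⟩ := hZ z hz
    rw [hX.leibniz, ha.tw_eq, smul_mul_assoc]
    exact add_mem (mul_mem_span_pow_succ hZ (hXZ z hz) (Ideal.subset_span hH))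
      (smul_mem_ideal _ _ (mul_mem_span_pow_succ hZ hz (ih H hH)))

/-- If `Z` lies in an ideal up to terms of second order, then it does so up to terms of arbitrarily
high order. -/
theorem subset_sup_span_pow (hZ : ∀ z ∈ Z, ∃ a, Par a z) {K : Ideal (SF p)}
    (h : ∀ z ∈ Z, z ∈ K ⊔ Ideal.span (Z ^ 2)) (k : ℕ) : ∀ z ∈ Z, z ∈ K ⊔ Ideal.span (Z ^ k) := by
  -- in `Z²`, the second factor may be replaced by its expression modulo `(Z^k)`
  have step : ∀ k, (∀ z ∈ Z, z ∈ K ⊔ Ideal.span (Z ^ k)) →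
      ∀ z ∈ Z, z ∈ K ⊔ Ideal.span (Z ^ (k + 1)) := fun k ih z hz => by
    refine (sup_le le_sup_left (Ideal.span_le.2 ?_) : _ ≤ K ⊔ Ideal.span (Z ^ (k + 1))) (h z hz)
    intro G hG
    rw [sq] at hG
    obtain ⟨z₁, hz₁, z₂, hz₂, rfl⟩ := Set.mem_mul.1 hG
    obtain ⟨H, hH, H', hH', e⟩ := Submodule.mem_sup.1 (ih z₂ hz₂)
    change z₁ * z₂ ∈ _
    rw [← e, mul_add]
    exact Submodule.add_mem_sup (K.mul_mem_left _ hH) (mul_mem_span_pow_succ hZ hz₁ hH')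
  induction k with
  | zero =>
    intro z _
    rw [span_pow_zero, sup_top_eq]
    exact Submodule.mem_top
  | succ k ih => exact step k ih

end SF

namespace LF

open SF LocalTheory

variable {n : ℕ} {F C : Type*} {par : F → ZMod 2}

/-- The differential ideal generated by the `u c`, in terms of operators. -/
noncomputable def dIdeal (u : C → LF n par) : Ideal (LF n par) :=
  Ideal.span {G | ∃ c m, G = totP par m (u c)}

theorem diffIdeal_eq (u : C → LF n par) : diffIdeal par u = dIdeal u := by
  have h : {G : LF n par | ∃ c m, G = totP par m (u c)} = {G | ∃ c m, G = totIter par m (u c)} := by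
    simp only [totP_apply]
    rfl
  unfold dIdeal
  rw [h]
  rfl

theorem totP_mem_dIdeal (u : C → LF n par) (c : C) (m : Fin n → ℕ) :
    totP par m (u c) ∈ dIdeal u := Ideal.subset_span ⟨c, m, rfl⟩

theorem mem_dIdeal (u : C → LF n par) (c : C) : u c ∈ dIdeal u := by
  have h := totP_mem_dIdeal u c 0
  rwa [totP_zero] at h

theorem totL_mem_dIdeal {u : C → LF n par} (μ : Fin n) {G : LF n par} (hG : G ∈ dIdeal u) :
    totL par μ G ∈ dIdeal u := by
  refine (isVF_totL μ).map_mem_span ?_ hG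
  rintro _ ⟨c, m, rfl⟩
  rw [← Module.End.mul_apply, ← totP_add_single]
  exact totP_mem_dIdeal u c _

theorem totP_mem_of_totL {K : Ideal (LF n par)} (hK : ∀ μ, ∀ G ∈ K, totL par μ G ∈ K) {G : LF n par}
    (hG : G ∈ K) (m : Fin n → ℕ) : totP par m G ∈ K := by
  induction m using multiIndex_induction with
  | zero => rwa [totP_zero]
  | step m μ ih =>
    rw [totP_add_single, Module.End.mul_apply]
    exact hK μ _ ih

theorem dIdeal_le {u : C → LF n par} {K : Ideal (LF n par)}
    (hK : ∀ μ, ∀ G ∈ K, totL par μ G ∈ K) (hu : ∀ c, u c ∈ K) : dIdeal u ≤ K := by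
  refine Ideal.span_le.2 ?_
  rintro _ ⟨c, m, rfl⟩
  exact totP_mem_of_totL hK (hu c) m

end LF

/-! ### The surface -/

namespace Parent

open SuperFun (sgn sgn_zero sgn_one sgn_add sgn_mul_self zmod_two_cases PreservesParity)
open LocalTheory LF SF

variable {n : ℕ} {I : Type*} {par : I → ZMod 2}

variable (par) in
/-- The difference of a linear combination of fields and its restriction to the surface. -/
noncomputable def devL (n : ℕ) : FieldSpan n I →ₗ[ℝ] PF n par :=
  linL (ppar par n) -
    ((incL par n).toLinearMap ∘ₗ (resL par n).toLinearMap ∘ₗ linL (ppar par n))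

theorem devL_apply (u : FieldSpan n I) :
    devL par n u = linL (ppar par n) u - incL par n (resL par n (linL (ppar par n) u)) := rfl

theorem devL_fld (a : I) (l : Fin n → ℕ) (N : Finset (Fin n)) :
    devL par n (fld a l N) = jt (ppar par n) (a, l, N) 0 -
      if N = ∅ then jt (ppar par n) (a, 0, ∅) l else 0 := by
  rw [devL_apply, linL_fld, resL_jt]
  dsimp only
  split_ifs
  · rw [incL_jt, add_zero]
  · rw [map_zero]

variable (par) in
/-- The ideal of the surface `Ψ^A_{(l)[]} = ∂_{(l)} Ψ^A`, `Ψ^A_{(l)[N]} = 0` for `N ≠ ∅`. -/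
noncomputable def zIdeal (n : ℕ) : Ideal (PF n par) :=
  dIdeal fun f : PField n I => devL par n (fld f.1 f.2.1 f.2.2)

theorem totL_mem_zIdeal (μ : Fin n) (G : PF n par) (hG : G ∈ zIdeal par n) :
    totL (ppar par n) μ G ∈ zIdeal par n := totL_mem_dIdeal μ hG

theorem devL_mem_zIdeal (u : FieldSpan n I) : devL par n u ∈ zIdeal par n := by
  induction u using Finsupp.induction_linear with
  | zero => rw [map_zero]; exact zero_mem _
  | add u v hu hv => rw [map_add]; exact add_mem hu hv
  | single f c =>
    rw [single_eq_smul_fld, map_smul]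
    exact smul_mem_ideal _ _ (mem_dIdeal (fun f : PField n I => devL par n (fld f.1 f.2.1 f.2.2)) f)

variable (par) in
/-- The coordinates that carry skew indices. -/
def skewJets (n : ℕ) : Set (PF n par) :=
  {G | ∃ (f : PField n I) (m : Fin n → ℕ), f.2.2.Nonempty ∧ G = jt (ppar par n) f m}

theorem par_skewJets (z : PF n par) (hz : z ∈ skewJets par n) : ∃ a, Par a z := by
  obtain ⟨f, m, -, rfl⟩ := hz
  exact ⟨_, par_jt f m⟩

theorem totL_mem_skewJets (μ : Fin n) (z : PF n par) (hz : z ∈ skewJets par n) :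
    totL (ppar par n) μ z ∈ skewJets par n := by
  obtain ⟨f, m, hf, rfl⟩ := hz
  exact ⟨f, m + Pi.single μ 1, hf, totL_jt μ f m⟩

theorem skewJets_subset_zIdeal : skewJets par n ⊆ zIdeal par n := by
  rintro _ ⟨⟨a, l, N⟩, m, hf, rfl⟩
  have h := totP_mem_of_totL totL_mem_zIdeal (devL_mem_zIdeal (par := par) (fld a l N)) m
  rwa [devL_fld, if_neg (Finset.nonempty_iff_ne_empty.1 hf), sub_zero, totP_jt, zero_add] at h

/-- The image of `∂^F/∂θ` lies in the ideal of the coordinates with skew indices. -/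
theorem thE_mem_span (ν : Fin n) (G : PF n par) : thE par ν G ∈ Ideal.span (skewJets par n) := by
  obtain ⟨V, hV⟩ := exists_support G
  rw [(isVF_thE ν).eq_sum G hV]
  refine Submodule.sum_mem _ fun v _ => ?_
  rw [((isVF_thE ν).parity v).supercomm]
  refine Ideal.mul_mem_left _ _ ?_
  obtain κ | ⟨⟨a, l, N⟩, m⟩ := v
  · have h := thE_xx (par := par) ν κ
    rw [xx] at h
    rw [h]
    exact zero_mem _
  · have h : thE par ν (co _ (Sum.inr ((a, l, N), m))) =
        totP (ppar par n) m (thE par ν (jt (ppar par n) (a, l, N) 0)) := by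
      rw [← Module.End.mul_apply, ← (commute_totP (commute_thE_totL ν) m).eq, Module.End.mul_apply,
        ← jt_eq_totP]
      rfl
    rw [h, thE_jt]
    split_ifs
    · rw [map_zero]; exact zero_mem _
    · rw [map_smul, totP_jt]
      exact smul_mem_ideal _ _ (Ideal.subset_span ⟨_, _, Finset.insert_nonempty ν N, rfl⟩)

theorem sbChar_insert (S : I → LF n par) {ν : Fin n} (a : I) (l : Fin n → ℕ)
    {N : Finset (Fin n)} (hν : ν ∉ N) : sbChar S (a, l, insert ν N) =
      (-(sgn (par a) * eps ν N)) • thE par ν (sbChar S (a, l, N)) := by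
  rw [thE_sbChar (S := S) a l hν, smul_smul, neg_mul_neg, mul_mul_mul_comm, sgn_mul_self,
    eps_mul_self, one_mul, one_smul]

theorem sbChar_mem_span (S : I → LF n par) (a : I) (l : Fin n → ℕ) {N : Finset (Fin n)}
    (hN : N.Nonempty) : sbChar S (a, l, N) ∈ Ideal.span (skewJets par n) := by
  obtain ⟨ν, hν⟩ := hN
  rw [← Finset.insert_erase hν, sbChar_insert S a l (Finset.notMem_erase ν N)]
  exact smul_mem_ideal _ _ (thE_mem_span ν _)

variable (par) in
/-- The ideal generated by the coordinates with at least `q` skew indices and the products of two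
coordinates with skew indices. -/
noncomputable def skewIdeal (n q : ℕ) : Ideal (PF n par) :=
  Ideal.span {G | ∃ (f : PField n I) (m : Fin n → ℕ), q ≤ f.2.2.card ∧ G = jt (ppar par n) f m} ⊔
    Ideal.span (skewJets par n ^ 2)

variable {S : I → LF n par}

/-- `∂^F/∂θ` raises the number of skew indices. -/
theorem thE_mem_skewIdeal (ν : Fin n) {q : ℕ} (hq : 1 ≤ q) {G : PF n par}
    (hG : G ∈ skewIdeal par n q) : thE par ν G ∈ skewIdeal par n (q + 1) := by
  have hthe : ∀ (f : PField n I) m, thE par ν (jt (ppar par n) f m) =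
      if ν ∈ f.2.2 then 0 else (sgn (par f.1) * eps ν f.2.2) •
        jt (ppar par n) (f.1, f.2.1, insert ν f.2.2) m := by
    rintro ⟨a, l, N⟩ m
    rw [jt_eq_totP, ← Module.End.mul_apply, (commute_totP (commute_thE_totL ν) m).eq,
      Module.End.mul_apply, thE_jt]
    split_ifs
    · rw [map_zero]
    · rw [map_smul, totP_jt, zero_add]
  obtain ⟨H, hH, H', hH', rfl⟩ := Submodule.mem_sup.1 hG
  rw [map_add]
  refine add_mem ((isVF_thE ν).map_mem_of_span ?_ ?_ hH)
    (Submodule.mem_sup_right ((isVF_thE ν).map_mem_span ?_ hH'))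
  · rintro _ ⟨f, m, hf, rfl⟩ b
    -- products with elements of the image of `∂^F/∂θ` are of second order
    exact Submodule.mem_sup_right (mul_mem_span_sq (thE_mem_span ν b)
      ⟨f, m, Finset.card_pos.1 (hq.trans hf), rfl⟩)
  · rintro _ ⟨f, m, hf, rfl⟩
    rw [hthe]
    split_ifs with hν
    · exact zero_mem _
    · refine smul_mem_ideal _ _ (Submodule.mem_sup_left (Ideal.subset_span ⟨_, m, ?_, rfl⟩))
      rw [Finset.card_insert_of_notMem hν]
      exact Nat.succ_le_succ hf
  · intro G hG
    rw [sq] at hG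
    obtain ⟨z, hz, z', hz', rfl⟩ := Set.mem_mul.1 hG
    obtain ⟨a, ha⟩ := par_skewJets z hz
    obtain ⟨f, m, hf, rfl⟩ := hz'
    rw [(isVF_thE ν).leibniz, hthe, ha.tw_eq]
    refine add_mem (mul_mem_span_sq (thE_mem_span ν z) ⟨f, m, hf, rfl⟩) ?_
    split_ifs
    · rw [mul_zero]; exact zero_mem _
    · rw [smul_mul_assoc, mul_smul_comm, sq]
      exact smul_mem_ideal _ _ (smul_mem_ideal _ _ (Ideal.subset_span (Set.mul_mem_mul hz
        ⟨_, m, Finset.insert_nonempty _ _, rfl⟩)))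

/-- `s̄` of a field with `q ≥ 1` skew indices contains, up to second order terms, only coordinates
with at least `q` skew indices. -/
theorem sbChar_mem_skewIdeal (a : I) (l : Fin n → ℕ) {N : Finset (Fin n)} (hN : N.Nonempty) :
    sbChar S (a, l, N) ∈ skewIdeal par n N.card := by
  induction hN using Finset.Nonempty.cons_induction with
  | singleton ν =>
    refine (Ideal.span_mono ?_ : _ ≤ _).trans le_sup_left
      (sbChar_mem_span S a l (Finset.singleton_nonempty ν))
    rintro _ ⟨f, m, hf, rfl⟩
    exact ⟨f, m, by rw [Finset.card_singleton]; exact hf.card_pos, rfl⟩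
  | cons ν N hν hN ih =>
    rw [Finset.cons_eq_insert, Finset.card_insert_of_notMem hν, sbChar_insert S a l hν]
    exact smul_mem_ideal _ _ (thE_mem_skewIdeal ν hN.card_pos ih)

/-! ### The equations of motion -/

variable {W : Set (FieldSpan n I)} {pw : W → ZMod 2}

variable (S W) in
/-- The ideal of the equations `w = 0`, `s^P w = 0`. -/
noncomputable def eqI : Ideal (PF n par) :=
  dIdeal (fun w : W => linL (ppar par n) w.1) ⊔ dIdeal fun w : W => spE S (linL (ppar par n) w.1)

theorem map_mem_sup {X : Module.End ℝ (PF n par)} {K L K' : Ideal (PF n par)}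
    (hK : ∀ G ∈ K, X G ∈ K') (hL : ∀ G ∈ L, X G ∈ K') {G : PF n par} (hG : G ∈ K ⊔ L) :
    X G ∈ K' := by
  obtain ⟨H, hH, H', hH', rfl⟩ := Submodule.mem_sup.1 hG
  rw [map_add]
  exact add_mem (hK _ hH) (hL _ hH')

theorem totL_mem_eqI (μ : Fin n) (G : PF n par) (hG : G ∈ eqI S W) :
    totL (ppar par n) μ G ∈ eqI S W :=
  map_mem_sup (fun _ h => Submodule.mem_sup_left (totL_mem_dIdeal μ h))
    (fun _ h => Submodule.mem_sup_right (totL_mem_dIdeal μ h)) hG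

theorem linL_mem_eqI {u : FieldSpan n I} (hu : u ∈ Submodule.span ℝ W) :
    linL (ppar par n) u ∈ eqI S W := by
  induction hu using Submodule.span_induction with
  | zero => rw [map_zero]; exact zero_mem _
  | add u v _ _ hu hv => rw [map_add]; exact add_mem hu hv
  | smul c u _ hu => rw [map_smul]; exact smul_mem_ideal _ c hu
  | mem w hw =>
    exact Submodule.mem_sup_left (mem_dIdeal (fun w : W => linL (ppar par n) w.1) ⟨w, hw⟩)

theorem spE_linL_mem_eqI {u : FieldSpan n I} (hu : u ∈ Submodule.span ℝ W) :
    spE S (linL (ppar par n) u) ∈ eqI S W := by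
  induction hu using Submodule.span_induction with
  | zero => rw [map_zero, map_zero]; exact zero_mem _
  | add u v _ _ hu hv => rw [map_add, map_add]; exact add_mem hu hv
  | smul c u _ hu => rw [map_smul, map_smul]; exact smul_mem_ideal _ c hu
  | mem w hw =>
    exact Submodule.mem_sup_right
      (mem_dIdeal (fun w : W => spE S (linL (ppar par n) w.1)) ⟨w, hw⟩)

section

variable (hpar : ∀ a, Par (par a + 1) (S a)) (hnil : ∀ a, evolL par S (S a) = 0)
include hpar hnil

/-- `E` is stable under `s^P`, because `s^P` maps the generators `w` to `s^P w` and `s^P w` to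
`(s^P)² w = 0`. -/
theorem spE_mem_eqI {G : PF n par} (hG : G ∈ eqI S W) : spE S G ∈ eqI S W := by
  refine map_mem_sup (fun G hG => ?_) (fun G hG => ?_) hG
  · refine (isVF_spE hpar).map_mem_of_span ?_ ?_ hG
    · exact fun H hH b => Ideal.mul_mem_left _ _ (Submodule.mem_sup_left (Ideal.subset_span hH))
    · rintro _ ⟨w, m, rfl⟩
      rw [← Module.End.mul_apply, (commute_totP (commute_spE_totL hpar) m).eq,
        Module.End.mul_apply]
      exact Submodule.mem_sup_right
        (totP_mem_dIdeal (fun w : W => spE S (linL (ppar par n) w.1)) w m)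
  · refine (isVF_spE hpar).map_mem_of_span ?_ ?_ hG
    · exact fun H hH b => Ideal.mul_mem_left _ _ (Submodule.mem_sup_right (Ideal.subset_span hH))
    · rintro _ ⟨w, m, rfl⟩
      have h := LinearMap.congr_fun (spE_mul_self hpar hnil) (linL (ppar par n) w.1)
      rw [Module.End.mul_apply] at h
      rw [← Module.End.mul_apply, (commute_totP (commute_spE_totL hpar) m).eq,
        Module.End.mul_apply, h, LinearMap.zero_apply, map_zero]
      exact zero_mem _

end

/-- The surface solves the equations of motion. -/
theorem spE_linL_mem_zIdeal {u : FieldSpan n I} (hu : u ∈ skewSpan n I) :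
    spE S (linL (ppar par n) u) ∈ zIdeal par n := by
  rw [spE, LinearMap.add_apply]
  refine add_mem ?_ ((Ideal.span_le.2 skewJets_subset_zIdeal : _ ≤ zIdeal par n) ?_)
  · -- up to the ideal of the surface, `d^F - σ^F` may be evaluated on the surface, where it vanishes
    have hinc : ∀ i G, totL (ppar par n) i (incL par n G) = incL par n (totL par i G) := fun i G =>
      (fsub_totL fieldParity_incl (fun a m μ => by
        rw [linJ_single, linJ_single, one_smul, one_smul, totL_jt]) i G).symm
    have h1 : dsE par (linL (ppar par n) u) =
        ∑ i, totL (ppar par n) i (devL par n (signA par (contr i u))) -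
          devL par n (sigmaL par u) := by
      have h2 := resL_dsE (linL (ppar par n) u)
      rw [dsE, LinearMap.sub_apply, dE_linL, sigE_linL] at h2 ⊢
      simp only [devL_apply, map_sub, hinc, ← resL_totL]
      rw [Finset.sum_sub_distrib, ← map_sum, ← map_sum, sub_sub_sub_comm, ← map_sub, ← map_sub, h2,
        map_zero, sub_zero]
    rw [h1]
    exact sub_mem (Submodule.sum_mem _ fun i _ => totL_mem_zIdeal i _ (devL_mem_zIdeal _))
      (devL_mem_zIdeal _)
  · rw [sbE, evolL_linL, Finsupp.linearCombination_apply]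
    refine Submodule.sum_mem _ fun f hf => smul_mem_ideal _ _ ?_
    exact sbChar_mem_span S f.1 f.2.1 (Finsupp.mem_supported _ _ |>.1 hu hf)

theorem span_le_skewSpan (hW : IsRhoBasis par W pw) : Submodule.span ℝ W ≤ skewSpan n I := by
  have h : Submodule.span ℝ W = LinearMap.range (rhoL par) := hW.2.1
  rw [h]
  exact range_rhoL_le

theorem eqI_le_zIdeal (hW : IsRhoBasis par W pw) : eqI S W ≤ zIdeal par n := by
  refine sup_le (dIdeal_le totL_mem_zIdeal fun w => ?_) (dIdeal_le totL_mem_zIdeal fun w =>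
    spE_linL_mem_zIdeal (span_le_skewSpan hW (Submodule.subset_span w.2)))
  refine (Ideal.span_le.2 skewJets_subset_zIdeal : _ ≤ zIdeal par n)
    (Submodule.sum_mem _ fun f hf => smul_mem_ideal _ _ (Ideal.subset_span ⟨f, 0, ?_, rfl⟩))
  exact Finsupp.mem_supported _ _ |>.1 (span_le_skewSpan hW (Submodule.subset_span w.2)) hf

theorem totL_mem_eqI_sup (k : ℕ) (μ : Fin n) (G : PF n par)
    (hG : G ∈ eqI S W ⊔ Ideal.span (skewJets par n ^ k)) :
    totL (ppar par n) μ G ∈ eqI S W ⊔ Ideal.span (skewJets par n ^ k) :=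
  map_mem_sup (fun _ h => Submodule.mem_sup_left (totL_mem_eqI μ _ h))
    (fun _ h => Submodule.mem_sup_right
      ((isVF_totL μ).map_mem_span_pow_self par_skewJets (totL_mem_skewJets μ) k h)) hG

theorem len_sub_single {l : Fin n → ℕ} {i : Fin n} (hi : l i ≠ 0) :
    len (l - Pi.single i 1) + 1 = len l := by
  rw [← len_add_single _ i]
  congr 1
  funext k
  by_cases hk : k = i
  · subst hk; simp; omega
  · simp [hk]

/-- The equations of motion imply the vanishing of the coordinates with skew indices, up to second
order terms. The proof expresses a field by means of the homotopy `ρ^F`; the corrections that come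
from `s̄` have more skew indices, those that come from `d^F` have fewer symmetric ones. -/
theorem jt_mem_eqI_sup (hW : IsRhoBasis par W pw) (f : PField n I) (hf : f.2.2.Nonempty)
    (m : Fin n → ℕ) :
    jt (ppar par n) f m ∈ eqI S W ⊔ Ideal.span (skewJets par n ^ 2) := by
  have hrange : Submodule.span ℝ W = LinearMap.range (rhoL par) := hW.2.1
  -- descending induction on the number of skew indices
  suffices h : ∀ d (f : PField n I), f.2.2.Nonempty → n + 1 ≤ f.2.2.card + d → ∀ m,
      jt (ppar par n) f m ∈ eqI S W ⊔ Ideal.span (skewJets par n ^ 2) from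
    h (n + 1) f hf (Nat.le_add_left _ _) m
  intro d
  induction d with
  | zero =>
    intro f _ h
    have h1 := f.2.2.card_le_univ
    rw [Fintype.card_fin] at h1
    omega
  | succ d ihd =>
    rintro ⟨a, l, N⟩ hN hd m
    dsimp only at hN hd
    rw [jt_eq_totP]
    refine totP_mem_of_totL (totL_mem_eqI_sup 2) ?_ m
    clear m hf f
    -- induction on the number of symmetric indices
    induction hl : len l using Nat.strong_induction_on generalizing l N with
    | _ r ihl =>
    have hs : linL (ppar par n) (sigmaL par (rhoL par (fld a l N))) ∈
        eqI S W ⊔ Ideal.span (skewJets par n ^ 2) := by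
      have h1 : linL (ppar par n) (sigmaL par (rhoL par (fld a l N))) =
          dE par (linL (ppar par n) (rhoL par (fld a l N))) +
            sbE S (linL (ppar par n) (rhoL par (fld a l N))) -
            spE S (linL (ppar par n) (rhoL par (fld a l N))) := by
        rw [← sigE_linL, spE, dsE, LinearMap.add_apply, LinearMap.sub_apply]
        abel
      rw [h1]
      refine sub_mem ?_ (Submodule.mem_sup_left
        (spE_linL_mem_eqI (by rw [hrange]; exact ⟨_, rfl⟩)))
      rw [rhoL, fld, Finsupp.linearCombination_single, one_smul, rhoRow, map_sum, map_sum, map_sum,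
        ← Finset.sum_add_distrib]
      refine Submodule.sum_mem _ fun i hi => ?_
      have hiN : i ∉ N := Finset.mem_compl.1 hi
      dsimp only
      rw [linL_single, map_smul, map_smul, ← smul_add]
      by_cases hli : l i = 0
      · rw [hli, Nat.cast_zero, mul_zero, zero_mul, zero_smul]
        exact zero_mem _
      · refine smul_mem_ideal _ _ (add_mem ?_ ?_)
        · rw [dE_jt]
          refine Submodule.sum_mem _ fun j hj => smul_mem_ideal _ _ ?_
          have hcard : ((insert i N).erase j).card = N.card := by
            rw [Finset.card_erase_of_mem hj, Finset.card_insert_of_notMem hiN, Nat.add_sub_cancel]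
          rw [jt_eq_totP]
          refine totP_mem_of_totL (totL_mem_eqI_sup 2) (ihl (len (l - Pi.single i 1)) ?_ _ _ ?_ ?_
            rfl) _
          · have := len_sub_single hli
            omega
          · rw [← Finset.card_pos, hcard]; exact hN.card_pos
          · rw [hcard]; exact hd
        · rw [sbE, evolL_jt_zero]
          refine (sup_le ?_ le_sup_right : skewIdeal par n (insert i N).card ≤ _)
            (sbChar_mem_skewIdeal a _ (Finset.insert_nonempty i N))
          refine Ideal.span_le.2 ?_
          rintro _ ⟨f', m', hf', rfl⟩
          rw [Finset.card_insert_of_notMem hiN] at hf'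
          exact ihd f' (Finset.card_pos.1 (by omega)) (by omega) m'
    have hr : linL (ppar par n) (rhoL par (sigmaL par (fld a l N))) ∈
        eqI S W ⊔ Ideal.span (skewJets par n ^ 2) :=
      Submodule.mem_sup_left (linL_mem_eqI (by rw [hrange]; exact ⟨_, rfl⟩))
    have h2 := add_mem hs hr
    rw [← map_add, homotopy_fld, map_smul, linL_fld] at h2
    have h3 : ((len l + N.card : ℕ) : ℝ) ≠ 0 := by
      have := hN.card_pos
      exact Nat.cast_ne_zero.2 (by omega)
    have h4 := smul_mem_ideal _ ((len l + N.card : ℕ) : ℝ)⁻¹ h2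
    rwa [smul_smul, inv_mul_cancel₀ h3, one_smul] at h4

/-- The equations of motion imply the vanishing of the coordinates with skew indices, up to terms
of arbitrarily high order. -/
theorem skewJets_mem_eqI_sup (hW : IsRhoBasis par W pw) (k : ℕ) (z : PF n par)
    (hz : z ∈ skewJets par n) : z ∈ eqI S W ⊔ Ideal.span (skewJets par n ^ k) := by
  refine subset_sup_span_pow par_skewJets (fun z hz => ?_) k z hz
  obtain ⟨f, m, hf, rfl⟩ := hz
  exact jt_mem_eqI_sup hW f hf m

/-- The equations of motion imply those of the surface, up to terms of arbitrarily high order in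
the coordinates with skew indices. -/
theorem zIdeal_le_eqI_sup (hpar : ∀ a, Par (par a + 1) (S a))
    (hnil : ∀ a, evolL par S (S a) = 0) (hW : IsRhoBasis par W pw) (k : ℕ) :
    zIdeal par n ≤ eqI S W ⊔ Ideal.span (skewJets par n ^ k) := by
  refine dIdeal_le (totL_mem_eqI_sup k) ?_
  rintro ⟨a, l, N⟩
  dsimp only
  rw [devL_fld]
  split_ifs with hN
  · subst hN
    induction l using multiIndex_induction with
    | zero => rw [sub_self]; exact zero_mem _
    | step l κ ih =>
      -- the equation of motion of a field with one skew index
      have hz : jt (ppar par n) (a, l, {κ}) 0 ∈ skewJets par n :=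
        ⟨_, _, Finset.singleton_nonempty κ, rfl⟩
      -- one order is lost, since `s^P` is a first order operator
      have h1 : spE S (jt (ppar par n) (a, l, {κ}) 0) ∈
          eqI S W ⊔ Ideal.span (skewJets par n ^ k) :=
        map_mem_sup (fun G hG => Submodule.mem_sup_left (spE_mem_eqI hpar hnil hG))
          (fun G hG => Submodule.mem_sup_right
            ((isVF_spE hpar).map_mem_span_pow par_skewJets hG))
          (skewJets_mem_eqI_sup hW (k + 1) _ hz)
      have h2 : sbE S (jt (ppar par n) (a, l, {κ}) 0) ∈
          eqI S W ⊔ Ideal.span (skewJets par n ^ k) := by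
        rw [sbE, evolL_jt_zero]
        exact (Ideal.span_le.2 (skewJets_mem_eqI_sup hW k) : _ ≤ _)
          (sbChar_mem_span S a l (Finset.singleton_nonempty κ))
      have h3 := sub_mem h1 h2
      rw [spE, LinearMap.add_apply, add_sub_cancel_right, dsE, LinearMap.sub_apply, dE_jt, sigE_jt,
        Finset.sum_singleton, Finset.sum_singleton, ← smul_sub] at h3
      have h4 := smul_mem_ideal _ (sgn (par a) * eps κ {κ}) h3
      rw [smul_smul, mul_mul_mul_comm, sgn_mul_self, eps_mul_self, one_mul, one_smul,
        Finset.erase_singleton] at h4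
      have h5 := sub_mem (totL_mem_eqI_sup k κ _ ih) h4
      rw [map_sub, totL_jt, totL_jt, zero_add] at h5
      convert h5 using 1
      abel
  · rw [sub_zero]
    exact skewJets_mem_eqI_sup hW k _ ⟨_, _, Finset.nonempty_iff_ne_empty.2 hN, rfl⟩

/-- The ideal of the surface is generated by `w` and `σ^F w` minus its restriction. -/
theorem surfIdeal_eq_zIdeal (hW : IsRhoBasis par W pw) :
    dIdeal (fun w : W => linL (ppar par n) w.1) ⊔
      dIdeal (fun w : W => devL par n (sigmaL par w.1)) = zIdeal par n := by
  have hw : ∀ w : W, linL (ppar par n) w.1 = devL par n w.1 := fun w => by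
    have h : resL par n (linL (ppar par n) w.1) = 0 := by
      rw [linL, Finsupp.linearCombination_apply, Finsupp.sum, map_sum]
      refine Finset.sum_eq_zero fun f hf => ?_
      rw [map_smul, resL_jt, if_neg, smul_zero]
      exact Finset.nonempty_iff_ne_empty.1 (Finsupp.mem_supported _ _ |>.1
        (span_le_skewSpan hW (Submodule.subset_span w.2)) hf)
    rw [devL_apply, h, map_zero, sub_zero]
  simp only [hw]
  refine le_antisymm (sup_le (dIdeal_le totL_mem_zIdeal fun w => devL_mem_zIdeal _)
    (dIdeal_le totL_mem_zIdeal fun w => devL_mem_zIdeal _)) ?_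
  refine dIdeal_le (fun μ G hG => ?_) fun f => ?_
  · exact map_mem_sup (fun _ h => Submodule.mem_sup_left (totL_mem_dIdeal μ h))
      (fun _ h => Submodule.mem_sup_right (totL_mem_dIdeal μ h)) hG
  · obtain ⟨y, hy⟩ := (bijective_newRow hW one_ne_zero).2 (fld f.1 f.2.1 f.2.2)
    rw [← hy, Finsupp.linearCombination_apply, Finsupp.sum, map_sum]
    refine Submodule.sum_mem _ fun u _ => ?_
    rw [map_smul]
    refine smul_mem_ideal _ _ ?_
    rcases u with a | w | w
    · have h : devL par n (newRow par W 1 (Sum.inl a)) = 0 := by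
        rw [newRow, Sum.elim_inl, devL_fld, if_pos rfl, sub_self]
      rw [h]
      exact zero_mem _
    · exact Submodule.mem_sup_left (mem_dIdeal (fun w : W => devL par n w.1) w)
    · rw [newRow, Sum.elim_inr, Sum.elim_inr, one_smul]
      exact Submodule.mem_sup_right (mem_dIdeal (fun w : W => devL par n (sigmaL par w.1)) w)

end Parent

/-! ### The parent theory -/

namespace Parent

open LocalTheory LF SF

variable {n : ℕ} {I : Type*} {par : I → ZMod 2} {W : Set (FieldSpan n I)} {pw : W → ZMod 2}
  {S : I → LF n par}

theorem newRow_lin (c : ℝ) (φ : I → PFun n par) (w v : W → PFun n par)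
    (hφ : ∀ a, φ a = jc (ppar par n) (a, 0, ∅) 0) (hw : ∀ b, w b = lin (ppar par n) n b.1)
    (hv : ∀ b, v b = c • sigmaF par (lin (ppar par n) n b.1)) :
    Sum.elim φ (Sum.elim w v) = fun u => lin (ppar par n) n (newRow par W c u) := by
  funext u
  rcases u with a | b | b
  · refine (hφ a).trans ?_
    exact (linL_fld a 0 ∅).symm
  · exact hw b
  · refine (hv b).trans ?_
    have h := (sigE_linL (par := par) b.1).symm.trans (sigE_apply _)
    have h2 := map_smul (linL (n := n) (ppar par n)) c (sigmaL par b.1)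
    rw [h] at h2
    exact h2.symm

theorem isAlgTrivialPairs (hW : IsRhoBasis par W pw) :
    IsAlgTrivialPairs (ppar par n) par pw (fun G => -sigmaF par G)
      (fun a => jc (ppar par n) (a, 0, ∅) 0) (fun w : W => lin (ppar par n) n w.1) := by
  obtain ⟨Φ, hΦ, -⟩ := exists_fieldChange_newRow hW (neg_ne_zero.2 one_ne_zero)
  refine ⟨Φ, ?_, fun a => ⟨0, ?_⟩⟩
  · exact (congrArg (fun u => IsFieldChange (ppar par n) (splitPar par pw) u Φ)
      (newRow_lin (-1) _ _ _ (fun _ => rfl) (fun _ => rfl) fun b =>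
        (neg_one_smul (M := PF n par) ℝ _).symm)).mpr hΦ
  · have h : sigmaF par (jc (ppar par n) (a, 0, ∅) 0) = 0 := by
      have h1 := sigE_jt (n := n) (par := par) a 0 ∅
      rw [Finset.sum_empty] at h1
      exact (sigE_apply _).symm.trans h1
    rw [map_zero, map_zero]
    exact (congrArg Neg.neg h).trans (neg_zero (G := PF n par))

theorem resL_jt_zero (f : PField n I) : resL par n (jt (ppar par n) f 0) =
    if f.2.2 = ∅ then jt par f.1 f.2.1 else 0 := by
  rw [resL_jt, add_zero]

theorem par_of_eq {a : ZMod 2} {G H : PF n par} (hG : Par a G) (h : G = H) : Par a H := h ▸ hG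

theorem eqIdeal_eq : eqIdeal (ppar par n) (sP par (sbQ S))
    (fun w : W => lin (ppar par n) n w.1) = eqI S W := by
  have h : (fun w : W => sP par (sbQ S) (lin (ppar par n) n w.1)) =
      fun w : W => spE S (linL (ppar par n) w.1) := funext fun w => sP_sbQ S _
  unfold eqIdeal eqI
  rw [h]
  exact congrArg₂ _ (diffIdeal_eq _) (diffIdeal_eq _)

theorem surfIdeal_eq (hW : IsRhoBasis par W pw) {w v U : W → PF n par}
    (hw : ∀ b, w b = linL (ppar par n) b.1) (hU : ∀ b, v b - U b = devL par n (sigmaL par b.1)) :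
    surfIdeal (ppar par n) w v U = zIdeal par n := by
  unfold surfIdeal
  rw [← surfIdeal_eq_zIdeal hW, ← funext hw, ← funext hU]
  exact congrArg₂ _ (diffIdeal_eq w) (diffIdeal_eq fun b => v b - U b)

theorem sigmaF_sub_restrict (u : FieldSpan n I) (G : PF n par)
    (hG : sigE par (linL (ppar par n) u) = G) :
    G - incL par n (resL par n G) = devL par n (sigmaL par u) := by
  rw [← hG, devL_apply, ← sigE_linL]

theorem surfIdeal_eq_diffIdeal (hW : IsRhoBasis par W pw) {w v U : W → PF n par}
    (hw : ∀ b, w b = linL (ppar par n) b.1) (hU : ∀ b, v b - U b = devL par n (sigmaL par b.1))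
    {u : PField n I → PF n par} (hu : ∀ f, u f = devL par n (fld f.1 f.2.1 f.2.2)) :
    surfIdeal (ppar par n) w v U = diffIdeal (ppar par n) u := by
  refine (surfIdeal_eq hW hw hU).trans ?_
  rw [zIdeal, ← funext hu]
  exact (diffIdeal_eq u).symm

theorem isGenAux (hpar : ∀ a, Par (par a + 1) (S a)) (hnil : ∀ a, evolL par S (S a) = 0)
    (hW : IsRhoBasis par W pw) :
    IsGenAux (ppar par n) par pw (sP par (sbQ S)) (thetaCoords par n)
      (fun a => jc (ppar par n) (a, 0, ∅) 0) (fun w : W => lin (ppar par n) n w.1)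
      (fun w : W => sigmaF par (lin (ppar par n) n w.1))
      (fun w : W => incl par n (restrict par n (sigmaF par (lin (ppar par n) n w.1)))) := by
  obtain ⟨Φ, hΦ, hincl⟩ := exists_fieldChange_newRow hW one_ne_zero
  have hs : surfIdeal (ppar par n) (fun w : W => lin (ppar par n) n w.1)
      (fun w : W => sigmaF par (lin (ppar par n) n w.1))
      (fun w : W => incl par n (restrict par n (sigmaF par (lin (ppar par n) n w.1)))) =
      zIdeal par n :=
    surfIdeal_eq hW (fun _ => rfl) fun b => sigmaF_sub_restrict b.1 _ (sigE_apply _)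
  unfold IsGenAux
  rw [hs, eqIdeal_eq]
  refine ⟨⟨Φ, ?_, fun b => ⟨_, (hincl _).symm⟩⟩, eqI_le_zIdeal hW, skewJets_subset_zIdeal,
    zIdeal_le_eqI_sup hpar hnil hW⟩
  exact (congrArg (fun u => IsFieldChange (ppar par n) (splitPar par pw) u Φ)
    (newRow_lin 1 _ _ _ (fun _ => rfl) (fun _ => rfl) fun b =>
      (one_smul (α := PF n par) ℝ _).symm)).mpr hΦ

end Parent

open SuperFun LocalTheory Parent in
theorem proposition2p4 {n : ℕ} {I : Type*} (par : I → ZMod 2) (gh : I → ℤ)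
    (S : I → LocalFun n par)
    (hpar : ∀ a, HasParity _ (par a + 1) (S a))
    (hgh : ∀ a, euler par (fun b _ => gh b) (S a) = ((gh a + 1 : ℤ) : ℝ) • S a)
    (hnil : ∀ G, evol par S (evol par S G) = 0) :
    -- the extension `s̄` of the original differential exists and is unique
    (∃! Q, IsSBar par S Q) ∧
    ∀ Q, IsSBar par S Q →
    -- the parent differential is nilpotent, odd, of ghost number one
    (∀ G, sP par Q (sP par Q G) = 0) ∧
    (∀ a G, HasParity _ a G → HasParity _ (a + 1) (sP par Q G)) ∧
    (∀ (g : ℤ) G, euler (ppar par n) (fun f _ => pgh gh n f) G = (g : ℝ) • G →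
      euler (ppar par n) (fun f _ => pgh gh n f) (sP par Q G) = ((g + 1 : ℤ) : ℝ) • sP par Q G) ∧
    -- its lowest degree part is `-σ^F`, in degree `-1`
    (∀ T : ℕ, DerivBound par S T → ∀ (g : ℤ) (G : PFun n par), degOp par gh T G = (g : ℝ) • G →
      degOp par gh T (sigmaF par G) = ((g - 1 : ℤ) : ℝ) • sigmaF par G ∧
      degOp par gh T (dF par G) = (g : ℝ) • dF par G ∧
      vf _ Q G ∈ degGE par gh T g) ∧
    -- splitting of the fields into `Ψ^A`, a basis `w` of the image of `ρ^F`, and `v = σ^F w`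
    (∃ (W : Set (PField n I →₀ ℝ)) (pw : W → ZMod 2), IsRhoBasis par W pw) ∧
    (∀ (W : Set (PField n I →₀ ℝ)) (pw : W → ZMod 2), IsRhoBasis par W pw →
      -- all additional fields form algebraically trivial pairs for `-σ^F`
      IsAlgTrivialPairs (ppar par n) par pw (fun G => -sigmaF par G)
        (fun a => jc (ppar par n) (a, 0, ∅) 0) (fun w : W => lin (ppar par n) n w.1) ∧
      -- they are generalized auxiliary fields for the parent differential
      IsGenAux (ppar par n) par pw (sP par Q) (thetaCoords par n)
        (fun a => jc (ppar par n) (a, 0, ∅) 0) (fun w : W => lin (ppar par n) n w.1)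
        (fun w : W => sigmaF par (lin (ppar par n) n w.1))
        (fun w : W => incl par n (restrict par n (sigmaF par (lin (ppar par n) n w.1)))) ∧
      -- the surface is `Ψ^A_{(l)[]} = ∂_{(l)} Ψ^A`, `Ψ^A_{(l)[N]} = 0` for `N ≠ ∅`
      surfIdeal (ppar par n) (fun w : W => lin (ppar par n) n w.1)
        (fun w : W => sigmaF par (lin (ppar par n) n w.1))
        (fun w : W => incl par n (restrict par n (sigmaF par (lin (ppar par n) n w.1)))) =
      diffIdeal (ppar par n) (fun f : PField n I => jc (ppar par n) f 0 -
        if f.2.2 = ∅ then jc (ppar par n) (f.1, 0, ∅) f.2.1 else 0)) ∧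
    -- restriction to this surface is compatible with total derivatives and leaves `Ψ^A` free
    (∀ μ G, restrict par n (tot (ppar par n) μ G) = tot par μ (restrict par n G)) ∧
    (∀ G, restrict par n (incl par n G) = G) ∧
    (∀ f : PField n I, restrict par n (jc (ppar par n) f 0) =
      if f.2.2 = ∅ then jc par f.1 f.2.1 else 0) ∧
    -- the reduced differential is the original one
    (∀ a, restrict par n (sP par Q (jc (ppar par n) (a, 0, ∅) 0)) = S a) ∧
    (∀ G, restrict par n (sP par Q (incl par n G)) = evol par S G) ∧
    (∀ G, restrict par n (sP par Q G) = evol par S (restrict par n G)) := by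
  have hnil' : ∀ a, LF.evolL par S (S a) = 0 := fun a =>
    (congrArg (LF.evolL par S) ((LF.evolL_jt_zero S a).symm.trans (LF.evolL_apply par S _))).trans
      ((LF.evolL_apply par S _).trans (hnil (jc par a 0)))
  refine ⟨⟨sbQ S, isSBar_sbQ hpar, fun Q => eq_sbQ_of_isSBar hpar⟩, fun Q hQ => ?_⟩
  obtain rfl := eq_sbQ_of_isSBar hpar hQ
  have hres : ∀ G, restrict par n (sP par (sbQ S) G) = evol par S (restrict par n G) := fun G =>
    (congrArg (restrict par n) (sP_sbQ S G)).trans ((resL_spE hpar G).trans (LF.evolL_apply _ _ _))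
  have hjt : ∀ f : PField n I, restrict par n (jc (ppar par n) f 0) =
      if f.2.2 = ∅ then jc par f.1 f.2.1 else 0 := resL_jt_zero
  refine ⟨fun G => ?_, fun a G hG => ?_, fun g G hG => ?_, fun T hT g G hG => ⟨?_, ?_, ?_⟩,
    exists_isRhoBasis par, fun W pw hW => ⟨isAlgTrivialPairs hW, isGenAux hpar hnil' hW, ?_⟩,
    resL_totL, resL_incL, hjt, fun a => ?_, fun G => ?_, hres⟩
  · exact (congrArg (sP par (sbQ S)) (sP_sbQ S G)).trans ((sP_sbQ S _).trans
      (LinearMap.congr_fun (spE_mul_self hpar hnil') G))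
  · exact par_of_eq ((isVF_spE hpar).map_parity hG) (sP_sbQ S G).symm
  · exact eigen_shift (ghE_spE hpar hgh) hG (sP_sbQ S G).symm
  · exact eigen_shift (degE_sigE gh T) hG (sigE_apply G)
  · have h := eigen_shift (degE_dE gh T) hG (dE_apply G)
    rw [add_zero] at h
    exact h
  · exact sbE_mem_geSpan hpar hgh hT hG
  · exact surfIdeal_eq_diffIdeal hW (fun _ => rfl)
      (fun b => sigmaF_sub_restrict b.1 _ (sigE_apply _)) fun f => (devL_fld f.1 f.2.1 f.2.2).symm
  · exact (hres _).trans ((congrArg (evol par S) (hjt (a, 0, ∅))).trans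
      ((LF.evolL_apply par S _).symm.trans (LF.evolL_jt_zero S a)))
  · exact (hres _).trans (congrArg (evol par S) (resL_incL G))
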